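/- **Model.** Let $J,P\ge 1$, $L\ge 0$ and $K=J+L$. The $i$-th observation of group $j\in\{1,\dots,J\}$ is $y_{ji}=\Theta' x_{ji}+e_{ji}\in\mathbb R^P$, where $x_{ji}'=(d_j',w_{ji}')$, $d_j\in\mathbb R^J$ is the $j$-th unit vector (group dummies), $w_{ji}\in\mathbb R^L$ are predictors, $\Theta\in\mathbb R^{K\times P}$ is the true coefficient matrix and $\theta=\mathrm{vec}(\Theta)$. The pairs $(w_{ji},e_{ji})$ are independent; $w_{ji}$ and $e_{ji}$ are independent; $e_{ji}\sim N(0,\Sigma)$ with $\Sigma$ positive definite; within group $j$ the $w_{ji}$ are identically distributed with finite second moments; and $G=\sum_{j=1}^J E[x_{j1}x_{j1}']$ is positive definite. From group $j$ the first $n_j$ observations are used, $N=\sum_j n_j$, and $X$ ($N\times K$), $Y$ ($N\times P$) are the stacked matrices of the $x_{ji}'$ and $y_{ji}'$. **Constrained models.** $M_1,\dots,M_T$ are models $M_t:\ R_{t,E}\theta=r_{t,E},\ R_{t,O}\theta>r_{t,O}$, where $R_{t,E}$ has $r_t\ge 0$ rows and full row rank, the constraints are compatible, and there is a point $\theta_{0}=\theta_{t,0}$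 with $R_{t,E}\theta_0=r_{t,E}$, $R_{t,O}\theta_0=r_{t,O}$. Let $\mathcal M_t$ be the set of parameters satisfying all constraints of $M_t$ and $\mathcal A_t=\{\vartheta: R_{t,E}\vartheta=r_{t,E}\}$. **Bayes factor.** Let $\mathcal T_{K\times P}(M,U,S,\nu)$ be the matrix $t$ distribution, with Lebesgue density proportional to $|S+(\Theta-M)'U^{-1}(\Theta-M)|^{-(\nu+K+P-1)/2}$. For matrices $X,Y$ put $\hat\Theta=(X'X)^{-1}X'Y$ and $S=(Y-X\hat\Theta)'(Y-X\hat\Theta)$. Let $b_i=\frac{P+K}{J n_j}$ for an observation $i$ of group $j$, let $X_b,Y_b$ be $X,Y$ with the $i$-th row multiplied by $\sqrt{b_i}$, and let $S_b$ be formed from $X_b,Y_b$ as $S$ is from $X,Y$. The unconstrained posterior and default prior are $$\pi_u=\mathcal T_{K\times P}(\hat\Theta,(X'X)^{-1},S,N-K-P+1),\qquad \pi_u^*=\mathcal T_{K\times P}(\Theta_0,(X_b'X_b)^{-1},S_b,\textstyle\sum_i b_i-K-P+1),$$ the latter being matrix Cauchy since $\sum_i b_i=P+K$. Let $f_t^E$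 and $c_t^E$ be the densities of $R_{t,E}\theta$ at $r_{t,E}$, and $f_t^O$ and $c_t^O$ the conditional probabilities of $R_{t,O}\theta>r_{t,O}$ given $R_{t,E}\theta=r_{t,E}$, under $\pi_u$ and $\pi_u^*$ respectively. The default Bayes factor of $M_t$ against the unconstrained model is $$B_{tu}=\frac{f_t^E}{c_t^E}\cdot\frac{f_t^O}{c_t^O},\qquad\text{and } B_{ts}=B_{tu}/B_{su}.$$ **Lemma 2 (consistency).** Let all group sizes $n_j\to\infty$ in such a way that $\log N/n_j\to 0$ for every $j$. Then, in probability: 1. For every $t$, $c_t^E$ and $c_t^O$ converge to positive constants $\bar c_t^E,\bar c_t^O$, namely to the corresponding quantities of the fixed matrix Cauchy distribution $\mathcal T_{K\times P}(\Theta_0,(\tfrac{P+K}{J}G)^{-1},(P+K)\Sigma,1)$. 2. If $M_t$ is true ($\theta\in\mathcal M_t$), then $B_{tu}\to\infty$ if $r_t\ge1$, and $B_{tu}\to 1/\bar c_t^O$ if $M_t$ has order constraints only ($r_t=0$). 3. If $\theta\notin\overline{\mathcal M_s}$, then $B_{su}\to 0$. 4. If $M_t$ is true, then $B_{ts}\to\infty$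 for every competing model $M_s$ such that $\theta\notin\overline{\mathcal M_s}$, or $\mathcal A_t\subsetneq\mathcal A_s$, or $r_s<r_t$ and the ratios $n_i/n_j$ of the group sizes remain bounded. -/

import Mathlib

open MeasureTheory ProbabilityTheory Filter Topology Matrix

noncomputable section

/-- Row index of the coefficient matrix `Θ`: `J` (adjusted) group means followed by `L` regression
coefficients, so that `K = J + L`. -/
abbrev Coef (J L : ℕ) : Type := Fin J ⊕ Fin L

/-- The vectorization `θ = vec(Θ)` of the `K × P` coefficient matrix `Θ`; the entry of `Θ` in
row `a` and column `p` is `θ (a, p)`. -/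
abbrev Param (J L P : ℕ) : Type := Coef J L × Fin P → ℝ

/-- The matrix `Θ` with `vec(Θ) = θ`. -/
def Param.toMat {J L P : ℕ} (θ : Param J L P) : Matrix (Coef J L) (Fin P) ℝ :=
  Matrix.of fun a p => θ (a, p)

/-! ### The data -/

/-- Observations, labelled by their group `j` and their number within the group. -/
abbrev Obs {J : ℕ} (n : Fin J → ℕ) : Type := (j : Fin J) × Fin (n j)

/-- The regressor `x' = (d', w')` of an observation from group `j` with predictor values `w`. -/
def designRow {J L : ℕ} (j : Fin J) (w : Fin L → ℝ) : Coef J L → ℝ :=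
  Sum.elim (Pi.single j 1) w

/-- The `N × K` design matrix `X` of the first `n j` observations of every group `j`. -/
def designMatrix {J L : ℕ} (n : Fin J → ℕ) (w : Fin J → ℕ → Fin L → ℝ) :
    Matrix (Obs n) (Coef J L) ℝ :=
  Matrix.of fun o => designRow o.1 (w o.1 o.2)

/-- The `N × P` matrix `Y = X Θ + E` of the first `n j` responses of every group `j`. -/
def responseMatrix {J L P : ℕ} (n : Fin J → ℕ) (θ : Param J L P) (w : Fin J → ℕ → Fin L → ℝ)
    (e : Fin J → ℕ → EuclideanSpace ℝ (Fin P)) : Matrix (Obs n) (Fin P) ℝ :=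
  designMatrix n w * θ.toMat + Matrix.of fun o p => e o.1 o.2 p

/-- The least squares estimate `(X'X)⁻¹ X'Y`. -/
def lsEstimate {ι κ π : Type*} [Fintype ι] [Fintype κ] [DecidableEq κ]
    (X : Matrix ι κ ℝ) (Y : Matrix ι π ℝ) : Matrix κ π ℝ :=
  (Xᵀ * X)⁻¹ * Xᵀ * Y

/-- The sums of squares matrix `(Y - X Θ̂)'(Y - X Θ̂)`. -/
def sumSq {ι κ π : Type*} [Fintype ι] [Fintype κ] [DecidableEq κ]
    (X : Matrix ι κ ℝ) (Y : Matrix ι π ℝ) : Matrix π π ℝ :=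
  (Y - X * lsEstimate X Y)ᵀ * (Y - X * lsEstimate X Y)

/-- The minimal group specific fraction `b_i = (P + K) / (J n_j)` of an observation of group `j`. -/
def fraction (L P : ℕ) {J : ℕ} (n : Fin J → ℕ) (o : Obs n) : ℝ :=
  ((P : ℝ) + ((J : ℝ) + (L : ℝ))) / ((J : ℝ) * (n o.1 : ℝ))

/-- The matrix with the rows `√b_i • a_i'`, where `a_i'` are the rows of `A`. -/
def scaleRows {ι κ : Type*} (b : ι → ℝ) (A : Matrix ι κ ℝ) : Matrix ι κ ℝ :=
  Matrix.of fun i k => √(b i) * A i k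

/-! ### The matrix `t` distribution -/

/-- The kernel of the matrix `t` distribution `𝒯_{K×P}(M, U, S, ν)`:
`|S + (Θ - M)' U⁻¹ (Θ - M)| ^ (-(ν + K + P - 1) / 2)`. -/
def matrixTKernel {J L P : ℕ} (M : Matrix (Coef J L) (Fin P) ℝ)
    (U : Matrix (Coef J L) (Coef J L) ℝ) (S : Matrix (Fin P) (Fin P) ℝ) (ν : ℝ)
    (θ : Param J L P) : ℝ :=
  (S + (θ.toMat - M)ᵀ * U⁻¹ * (θ.toMat - M)).det
    ^ (-(ν + ((J : ℝ) + (L : ℝ)) + (P : ℝ) - 1) / 2)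

/-- The density of `𝒯_{K×P}(M, U, S, ν)` with respect to Lebesgue measure; for `ν = 1` it is the
matrix Cauchy density. -/
def matrixTDensity {J L P : ℕ} (M : Matrix (Coef J L) (Fin P) ℝ)
    (U : Matrix (Coef J L) (Coef J L) ℝ) (S : Matrix (Fin P) (Fin P) ℝ) (ν : ℝ)
    (θ : Param J L P) : ℝ :=
  matrixTKernel M U S ν θ / ∫ θ' : Param J L P, matrixTKernel M U S ν θ'

/-! ### Models with equality and order constraints -/

/-- A model `R_E θ = r_E & R_O θ > r_O`. -/
structure ConstrainedModel (J L P : ℕ) where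
  /-- number of equality constraints -/
  rE : ℕ
  /-- number of order constraints -/
  rO : ℕ
  /-- number of parameters that remain free under the equality constraints -/
  q : ℕ
  RE : Matrix (Fin rE) (Coef J L × Fin P) ℝ
  rhsE : Fin rE → ℝ
  RO : Matrix (Fin rO) (Coef J L × Fin P) ℝ
  rhsO : Fin rO → ℝ
  /-- The matrix `D` that completes `R_E` to the one-to-one transformation `H = [R_E' D']'`. -/
  D : Matrix (Fin q) (Coef J L × Fin P) ℝ
  bijective_H : Function.Bijective (Matrix.fromRows RE D).mulVec
  /-- The prior location, a point on the boundary of the constrained space. -/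
  θ₀ : Param J L P
  RE_θ₀ : RE *ᵥ θ₀ = rhsE
  RO_θ₀ : RO *ᵥ θ₀ = rhsO
  /-- The constraints are compatible. -/
  exists_mem : ∃ θ : Param J L P, RE *ᵥ θ = rhsE ∧ ∀ i, rhsO i < (RO *ᵥ θ) i

namespace ConstrainedModel

variable {J L P : ℕ} (M : ConstrainedModel J L P)

/-- The affine space given by the equality constraints. -/
def eqSpace : Set (Param J L P) := {θ | M.RE *ᵥ θ = M.rhsE}

/-- The constrained parameter space. -/
def space : Set (Param J L P) := {θ | M.RE *ᵥ θ = M.rhsE ∧ ∀ i, M.rhsO i < (M.RO *ᵥ θ) i}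

/-- `H = [R_E' D']'`. -/
def H : Matrix (Fin M.rE ⊕ Fin M.q) (Coef J L × Fin P) ℝ := Matrix.fromRows M.RE M.D

/-- The transformation `ζ = (ζ_E, ζ_O) = H θ`. -/
def zeta : Param J L P ≃ₗ[ℝ] (Fin M.rE ⊕ Fin M.q → ℝ) :=
  LinearEquiv.ofBijective M.H.mulVecLin M.bijective_H

/-- The parameter `θ` with `ζ_E = r_E` and the given `ζ_O`. -/
def atEq (ζO : Fin M.q → ℝ) : Param J L P := M.zeta.symm (Sum.elim M.rhsE ζO)

/-- For a density `π` of `θ`, the density of `ζ = H θ` at `(r_E, ζ_O)`. The Jacobian `|det H|` is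
written as `√det(H H')` because rows and columns of `H` have different index types. -/
def zetaDensity (π : Param J L P → ℝ) (ζO : Fin M.q → ℝ) : ℝ :=
  π (M.atEq ζO) / √(M.H * M.Hᵀ).det

/-- The marginal density of `R_E θ` at `r_E`, if `θ` has density `π`. -/
def eqDensity (π : Param J L P → ℝ) : ℝ := ∫ ζO : Fin M.q → ℝ, M.zetaDensity π ζO

/-- The conditional probability of `R_O θ > r_O` given `R_E θ = r_E`, if `θ` has density `π`. -/
def ordProb (π : Param J L P → ℝ) : ℝ :=
  (∫ ζO in {ζO : Fin M.q → ℝ | ∀ i, M.rhsO i < (M.RO *ᵥ M.atEq ζO) i}, M.zetaDensity π ζO)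
    / M.eqDensity π

end ConstrainedModel

/-! ### The default Bayes factor -/

section BayesFactor

variable {J L P : ℕ} {n : Fin J → ℕ}

/-- The unconstrained posterior of `θ`: `𝒯_{K×P}(Θ̂, (X'X)⁻¹, S, N - K - P + 1)`. -/
def posterior (X : Matrix (Obs n) (Coef J L) ℝ) (Y : Matrix (Obs n) (Fin P) ℝ) :
    Param J L P → ℝ :=
  matrixTDensity (lsEstimate X Y) (Xᵀ * X)⁻¹ (sumSq X Y)
    (((∑ j, n j : ℕ) : ℝ) - ((J : ℝ) + (L : ℝ)) - (P : ℝ) + 1)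

/-- The unconstrained default prior of `θ` with the minimal group specific fractions, located at
`θ₀`: `𝒯_{K×P}(Θ₀, (X_b'X_b)⁻¹, S_b, ∑ b_i - K - P + 1)`. -/
def defaultPrior (θ₀ : Param J L P) (X : Matrix (Obs n) (Coef J L) ℝ)
    (Y : Matrix (Obs n) (Fin P) ℝ) : Param J L P → ℝ :=
  let b := fraction L P n
  let Xb := scaleRows b X
  let Yb := scaleRows b Y
  matrixTDensity θ₀.toMat (Xbᵀ * Xb)⁻¹ (sumSq Xb Yb)
    ((∑ o, b o) - ((J : ℝ) + (L : ℝ)) - (P : ℝ) + 1)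

variable (M : ConstrainedModel J L P) (X : Matrix (Obs n) (Coef J L) ℝ)
  (Y : Matrix (Obs n) (Fin P) ℝ)

/-- `f^E`, the posterior density of `R_E θ` at `r_E`. -/
def fitE : ℝ := M.eqDensity (posterior X Y)

/-- `f^O`, the conditional posterior probability of the order constraints. -/
def fitO : ℝ := M.ordProb (posterior X Y)

/-- `c^E`, the default prior density of `R_E θ` at `r_E`. -/
def complexityE : ℝ := M.eqDensity (defaultPrior M.θ₀ X Y)

/-- `c^O`, the conditional default prior probability of the order constraints. -/
def complexityO : ℝ := M.ordProb (defaultPrior M.θ₀ X Y)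

/-- The default Bayes factor `B_tu` of a constrained model against the unconstrained model. -/
def bayesFactor : ℝ := fitE M X Y / complexityE M X Y * (fitO M X Y / complexityO M X Y)

end BayesFactor

/-! ### Asymptotics -/

section Asymptotics

variable {Ω : Type*} [MeasurableSpace Ω]

/-- `Z k → ∞` in probability. -/
def TendstoAtTopInProb (μ : Measure Ω) (Z : ℕ → Ω → ℝ) : Prop :=
  ∀ C : ℝ, Tendsto (fun k => μ {ω | Z k ω ≤ C}) atTop (𝓝 0)

/-- `∑_j E[x_j x_j']`, where `x_j' = (d_j', w_j')` is the regressor of an observation of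
group `j`. -/
def populationGram {J L : ℕ} (μ : Measure Ω) (w : Fin J → ℕ → Ω → Fin L → ℝ) :
    Matrix (Coef J L) (Coef J L) ℝ :=
  ∑ j, Matrix.of fun a b => ∫ ω, designRow j (w j 0 ω) a * designRow j (w j 0 ω) b ∂μ

/-- The matrix Cauchy density
`𝒯_{K×P}(Θ₀, (((P + K) / J) G)⁻¹, (P + K) Σ, 1)`, the large sample limit of the default prior, for
the population matrix `G` of the regressors and the error covariance matrix `Σ`. -/
def limitPrior {J L P : ℕ} (θ₀ : Param J L P) (G : Matrix (Coef J L) (Coef J L) ℝ)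
    (V : Matrix (Fin P) (Fin P) ℝ) : Param J L P → ℝ :=
  matrixTDensity θ₀.toMat ((((P : ℝ) + ((J : ℝ) + (L : ℝ))) / (J : ℝ)) • G)⁻¹
    (((P : ℝ) + ((J : ℝ) + (L : ℝ))) • V) 1

end Asymptotics

end

set_option linter.unusedSectionVars false

/-! ### Determinants and quadratic forms -/


namespace Matrix

variable {ι κ : Type*} [Fintype ι] [Fintype κ] [DecidableEq ι] [DecidableEq κ]

/-! Let δ be the deviation of the parameter from the least squares estimate. With ν = N - K - P + 1
the posterior kernel is exactly |S + δ'X'Xδ|^(-N/2). Put H(δ) = |S + δ'X'Xδ| / |S| = |1 + F'δ'X'XδF|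
with S⁻¹ = FF'. Positive semidefinite M satisfy 1 + tr M ≤ det (1 + M) ≤ exp (tr M), so 1 + ‖Ψδ‖²/N
≤ H(δ) ≤ exp (‖Ψδ‖²/N) for a linear map Ψ whose squared norm lies between the orders n‖δ‖² and
N‖δ‖², where n is the smallest group size (`exists_ellipticBounds`). Thus H^(-N/2) is squeezed
between a Gaussian and a Student kernel.

The product f^E f^O is, up to a fixed Jacobian, the mass of the constrained region under H^(-N/2)
divided by the mass of the whole space (`RegularData.eventually_fit_eq`). On an affine subspace the
mass is at most a constant times the volume of the ellipsoid {‖Ψδ‖ ≤ 1} in its direction space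
(`EllipticBounds.exists_lintegral_le`). It is at least such a multiple if the model is true, because
the true parameter then lies in the subspace, its standardized deviation is bounded, and a small
ellipsoid around it satisfies the open order constraints (`EllipticRegime.eventually_le_sliceMass`).
Ellipsoids shrink at least like n^(-1/2), so the one in a larger subspace has negligible volume
relative to the one in a proper subspace. If n is of the order N, the dimensions alone decide. A
region at positive distance from the true parameter has relative mass at most a power of √N times
exp(-c n), which vanishes because log N = o(n) (`EllipticBounds.exists_setLIntegral_le`,
`tendsto_far_bound`).

The default prior is a matrix Cauchy distribution whose scale matrices converge by the law of large
numbers within groups. Its quantities are continuous in these matrices by dominated convergence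
(`tendsto_integral_detForm`), so complexities have positive limits and fits decide the Bayes
factors.

Convergence in probability is convergence along the filter `inProb` on pairs (index, outcome), so
the arguments above can be deterministic. The only random bound without a limit is tr E'ΠE, the
error sum of squares explained by the regressors (Π is the projection onto the columns of X). Its
mean is at most K tr Σ, so it is tight, and `tendsto_inProb_of_tight` permits treating it as
bounded. -/

lemma IsHermitian.det_one_add {M : Matrix ι ι ℝ} (hM : M.IsHermitian) :
    (1 + M).det = ∏ i, (1 + hM.eigenvalues i) := by
  have h := hM.charpoly_eq
  have h2 := congrArg (Polynomial.eval (-1 : ℝ)) h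
  rw [Matrix.eval_charpoly, Polynomial.eval_prod] at h2
  have h3 : (Matrix.scalar ι (-1 : ℝ) - M) = -(1 + M) := by
    ext i j
    simp [Matrix.scalar_apply, Matrix.one_apply, Matrix.diagonal_apply]
    split_ifs <;> ring
  rw [h3, Matrix.det_neg] at h2
  have h4 : ∏ i, Polynomial.eval (-1 : ℝ) (Polynomial.X - Polynomial.C ((hM.eigenvalues i : ℝ)))
      = (-1) ^ Fintype.card ι * ∏ i, (1 + hM.eigenvalues i) := by
    rw [← Finset.card_univ, ← Finset.prod_const, ← Finset.prod_mul_distrib]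
    refine Finset.prod_congr rfl fun i _ => ?_
    simp; ring
  have h5 : ((-1 : ℝ) ^ Fintype.card ι) ≠ 0 := by simp
  exact mul_left_cancel₀ h5 (h2.trans h4)

/-- Expanding ∏ (1 + λ_i) over nonnegative eigenvalues leaves 1 + ∑ λ_i plus nonnegative terms. This
gives the Student type upper bound of the posterior kernel. -/
lemma PosSemidef.one_add_trace_le_det {M : Matrix ι ι ℝ} (hM : M.PosSemidef) :
    1 + M.trace ≤ (1 + M).det := by
  rw [hM.1.det_one_add, hM.1.trace_eq_sum_eigenvalues]
  have key : ∀ s : Finset ι, 1 + ∑ i ∈ s, hM.1.eigenvalues i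
      ≤ ∏ i ∈ s, (1 + hM.1.eigenvalues i) := by
    intro s
    induction s using Finset.induction_on with
    | empty => simp
    | insert a s ha ih =>
      rw [Finset.sum_insert ha, Finset.prod_insert ha]
      nlinarith [hM.eigenvalues_nonneg a, Finset.sum_nonneg fun i (_ : i ∈ s) =>
        hM.eigenvalues_nonneg i]
  exact key Finset.univ

/-- Each eigenvalue satisfies 1 + λ ≤ exp λ. This gives the Gaussian lower bound of the posterior
kernel. -/
lemma PosSemidef.det_one_add_le_exp_trace {M : Matrix ι ι ℝ} (hM : M.PosSemidef) :
    (1 + M).det ≤ Real.exp M.trace := by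
  rw [hM.1.det_one_add, hM.1.trace_eq_sum_eigenvalues, Real.exp_sum]
  refine Finset.prod_le_prod (fun i _ => ?_) fun i _ => ?_
  · have := hM.eigenvalues_nonneg i
    positivity
  · rw [add_comm]
    exact Real.add_one_le_exp _

lemma PosSemidef.exists_eq_transpose_mul_self {A : Matrix ι ι ℝ} (hA : A.PosSemidef) :
    ∃ C : Matrix ι ι ℝ, A = Cᵀ * C := by
  open scoped MatrixOrder Matrix.Norms.L2Operator in
  obtain ⟨C, hC⟩ := CStarAlgebra.nonneg_iff_eq_star_mul_self.1 (Matrix.nonneg_iff_posSemidef.2 hA)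
  exact ⟨C, by simpa [Matrix.star_eq_conjTranspose] using hC⟩

lemma posSemidef_transpose_mul_self (A : Matrix κ ι ℝ) : (Aᵀ * A).PosSemidef := by
  simpa using Matrix.posSemidef_conjTranspose_mul_self A

lemma PosSemidef.transpose_mul_mul_same {A : Matrix κ κ ℝ} (hA : A.PosSemidef)
    (B : Matrix κ ι ℝ) : (Bᵀ * A * B).PosSemidef := by
  simpa using hA.conjTranspose_mul_mul_same B

/-- The factorization `det (S + M) = det S * det (1 + R⁻ᵀ M R⁻¹)`, where `S = Rᵀ R`. -/
lemma PosDef.det_add {S M : Matrix ι ι ℝ} (hS : S.PosDef) {F : Matrix ι ι ℝ}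
    (hF : S⁻¹ = F * Fᵀ) : (S + M).det = S.det * (1 + Fᵀ * M * F).det := by
  have hd : S.det ≠ 0 := hS.det_pos.ne'
  have hu : IsUnit S.det := hd.isUnit
  have h1 : (S⁻¹).det = F.det * F.det := by rw [hF, det_mul, det_transpose]
  have hFd : F.det ≠ 0 := by
    intro h
    rw [h, Matrix.det_nonsing_inv, Ring.inverse_eq_inv'] at h1
    simp [hd] at h1
  have h2 : Fᵀ * S * F = 1 := by
    have : F * (Fᵀ * S) = 1 := by
      rw [← mul_assoc, ← hF, Matrix.nonsing_inv_mul _ hu]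
    exact mul_eq_one_comm.1 this
  have h3 : 1 + Fᵀ * M * F = Fᵀ * (S + M) * F := by
    rw [mul_add, add_mul, h2]
  have h4 : S.det * (F.det * F.det) = 1 := by
    rw [← h1, ← det_mul, Matrix.mul_nonsing_inv _ hu, det_one]
  rw [h3, det_mul, det_mul, det_transpose]
  linear_combination -(S + M).det * h4

/-- After the factor `S.det` is split off, the remaining determinant is at least 1 plus a
nonnegative trace. -/
lemma PosDef.det_le_det_add {S M : Matrix ι ι ℝ} (hS : S.PosDef) (hM : M.PosSemidef) :
    S.det ≤ (S + M).det := by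
  obtain ⟨C, hC⟩ := hS.inv.posSemidef.exists_eq_transpose_mul_self
  have hF : S⁻¹ = Cᵀ * Cᵀᵀ := by rw [transpose_transpose]; exact hC
  rw [hS.det_add hF]
  have h1 := (hM.transpose_mul_mul_same Cᵀ)
  have h2 := h1.one_add_trace_le_det
  have h3 := h1.trace_nonneg
  nlinarith [hS.det_pos]

lemma trace_mul_transpose_self_eq_sum (A : Matrix ι κ ℝ) :
    (A * Aᵀ).trace = ∑ i, ∑ k, A i k ^ 2 := by
  simp [Matrix.trace, Matrix.mul_apply, pow_two]

lemma trace_transpose_mul_self_eq_sum (A : Matrix ι κ ℝ) :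
    (Aᵀ * A).trace = ∑ i, ∑ k, A i k ^ 2 := by
  rw [trace_mul_comm, trace_mul_transpose_self_eq_sum]

lemma trace_mul_mul_transpose_eq_sum (R : Matrix ι κ ℝ) (W : Matrix κ κ ℝ) :
    (R * W * Rᵀ).trace = ∑ i, R i ⬝ᵥ (W *ᵥ R i) := by
  simp only [Matrix.trace, Matrix.diag_apply]
  refine Finset.sum_congr rfl fun i _ => ?_
  rw [Matrix.mul_assoc, Matrix.mul_apply, dotProduct]
  refine Finset.sum_congr rfl fun j _ => ?_
  rw [Matrix.mul_apply, mulVec, dotProduct]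
  rfl

/-- Bounds of a quadratic form pass to traces. -/
lemma le_trace_mul_mul_transpose {W : Matrix κ κ ℝ} {c : ℝ}
    (hW : ∀ x, c * (x ⬝ᵥ x) ≤ x ⬝ᵥ (W *ᵥ x)) (R : Matrix ι κ ℝ) :
    c * (R * Rᵀ).trace ≤ (R * W * Rᵀ).trace := by
  rw [trace_mul_mul_transpose_eq_sum, trace_mul_transpose_self_eq_sum, Finset.mul_sum]
  refine Finset.sum_le_sum fun i _ => ?_
  simpa [dotProduct, pow_two] using hW (R i)

lemma trace_mul_mul_transpose_le {W : Matrix κ κ ℝ} {c : ℝ}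
    (hW : ∀ x, x ⬝ᵥ (W *ᵥ x) ≤ c * (x ⬝ᵥ x)) (R : Matrix ι κ ℝ) :
    (R * W * Rᵀ).trace ≤ c * (R * Rᵀ).trace := by
  rw [trace_mul_mul_transpose_eq_sum, trace_mul_transpose_self_eq_sum, Finset.mul_sum]
  refine Finset.sum_le_sum fun i _ => ?_
  simpa [dotProduct, pow_two] using hW (R i)

lemma posSemidef_sub_smul_one {A : Matrix ι ι ℝ} (hA : A.IsHermitian) {c : ℝ}
    (h : ∀ x, c * (x ⬝ᵥ x) ≤ x ⬝ᵥ (A *ᵥ x)) : (A - c • 1).PosSemidef := by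
  refine PosSemidef.of_dotProduct_mulVec_nonneg ?_ fun x => ?_
  · refine hA.sub ?_
    simp [IsHermitian]
  · have := h x
    simp only [star_trivial, sub_mulVec, smul_mulVec, one_mulVec, dotProduct_sub, dotProduct_smul,
      smul_eq_mul]
    linarith

lemma posDef_of_le_dotProduct {A : Matrix ι ι ℝ} (hA : A.IsHermitian) {c : ℝ} (hc : 0 < c)
    (h : ∀ x, c * (x ⬝ᵥ x) ≤ x ⬝ᵥ (A *ᵥ x)) : A.PosDef := by
  refine PosDef.of_dotProduct_mulVec_pos hA fun x hx => ?_
  have h1 : 0 < x ⬝ᵥ x := by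
    have := Matrix.dotProduct_star_self_pos_iff.2 hx
    simpa using this
  have := h x
  simp only [star_trivial]
  nlinarith

lemma dotProduct_mulVec_le_of_abs_le {A : Matrix ι ι ℝ} {ε : ℝ} (h : ∀ i j, |A i j| ≤ ε)
    (x : ι → ℝ) : |x ⬝ᵥ (A *ᵥ x)| ≤ ε * Fintype.card ι * (x ⬝ᵥ x) := by
  have h1 : |x ⬝ᵥ (A *ᵥ x)| ≤ ∑ i, ∑ j, |x i| * (ε * |x j|) := by
    simp only [dotProduct, mulVec, Finset.mul_sum]
    refine (Finset.abs_sum_le_sum_abs _ _).trans (Finset.sum_le_sum fun i _ => ?_)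
    refine (Finset.abs_sum_le_sum_abs _ _).trans (Finset.sum_le_sum fun j _ => ?_)
    rw [abs_mul, abs_mul]
    gcongr
    exact h i j
  have h2 : ∑ i, ∑ j, |x i| * (ε * |x j|) = ε * (∑ i, |x i|) ^ 2 := by
    rw [pow_two, Finset.sum_mul_sum, Finset.mul_sum]
    refine Finset.sum_congr rfl fun i _ => ?_
    rw [Finset.mul_sum]
    exact Finset.sum_congr rfl fun j _ => by ring
  rcases isEmpty_or_nonempty ι with hι | ⟨⟨i0⟩⟩
  · simp [dotProduct]
  have hε : 0 ≤ ε := (abs_nonneg _).trans (h i0 i0)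
  have h3 : (∑ i, |x i|) ^ 2 ≤ Fintype.card ι * (x ⬝ᵥ x) := by
    have := sq_sum_le_card_mul_sum_sq (s := Finset.univ) (f := fun i => |x i|)
    simpa [dotProduct, pow_two] using this
  calc _ ≤ _ := h1
    _ = _ := h2
    _ ≤ ε * (Fintype.card ι * (x ⬝ᵥ x)) := by gcongr
    _ = _ := by ring

lemma PosDef.exists_le_dotProduct {A : Matrix ι ι ℝ} (hA : A.PosDef) :
    ∃ c > 0, ∀ x, c * (x ⬝ᵥ x) ≤ x ⬝ᵥ (A *ᵥ x) := by
  obtain ⟨C, hC⟩ := hA.inv.posSemidef.exists_eq_transpose_mul_self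
  -- `x ⬝ x ≤ (trace A⁻¹ + 1) x ⬝ A x` by the Cauchy-Schwarz inequality
  obtain ⟨R, hR⟩ := hA.posSemidef.exists_eq_transpose_mul_self
  have hRd : IsUnit R.det := by
    have : A.det = R.det * R.det := by rw [hR, det_mul, det_transpose]
    refine IsUnit.mk0 _ fun h => hA.det_pos.ne' ?_
    rw [this, h, zero_mul]
  set B := R⁻¹ with hB
  set t : ℝ := ∑ i, ∑ j, B i j ^ 2 with ht
  have ht0 : 0 ≤ t := by positivity
  have key : ∀ y : ι → ℝ, (B *ᵥ y) ⬝ᵥ (B *ᵥ y) ≤ t * (y ⬝ᵥ y) := by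
    intro y
    simp only [dotProduct, mulVec, ht]
    rw [Finset.sum_mul]
    refine Finset.sum_le_sum fun i _ => ?_
    have := Finset.sum_mul_sq_le_sq_mul_sq Finset.univ (fun j => B i j) y
    simpa [pow_two] using this
  -- The summand 1 keeps the constant meaningful for an empty index type, where t = 0.
  refine ⟨1 / (t + 1), by positivity, fun x => ?_⟩
  have h1 := key (R *ᵥ x)
  rw [mulVec_mulVec, hB, nonsing_inv_mul _ hRd, one_mulVec] at h1
  have h2 : x ⬝ᵥ (A *ᵥ x) = (R *ᵥ x) ⬝ᵥ (R *ᵥ x) := by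
    rw [hR, ← mulVec_mulVec, dotProduct_mulVec, vecMul_transpose]
  rw [h2, div_mul_eq_mul_div, one_mul, div_le_iff₀ (by positivity)]
  have h3 : 0 ≤ (R *ᵥ x) ⬝ᵥ (R *ᵥ x) := by
    simp only [dotProduct]; exact Finset.sum_nonneg fun i _ => mul_self_nonneg _
  nlinarith

/-- Near a positive definite matrix, quadratic forms are bounded below uniformly. -/
lemma PosDef.exists_eventually_le_dotProduct {A : Matrix ι ι ℝ} (hA : A.PosDef) :
    ∃ c > 0, ∀ᶠ B in 𝓝 A, ∀ x, c * (x ⬝ᵥ x) ≤ x ⬝ᵥ (B *ᵥ x) := by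
  obtain ⟨c, hc, h⟩ := hA.exists_le_dotProduct
  set ε := c / (2 * (Fintype.card ι + 1)) with hε
  have hε0 : 0 < ε := by positivity
  have hev : ∀ᶠ B in 𝓝 A, ∀ i j, |(B - A) i j| ≤ ε := by
    simp only [eventually_all]
    intro i j
    have : Continuous fun B : Matrix ι ι ℝ => |(B - A) i j| := by
      simp only [sub_apply]; fun_prop
    have h2 := this.tendsto A
    simp only [sub_self, zero_apply, abs_zero] at h2
    exact h2.eventually_le_const hε0
  refine ⟨c / 2, by positivity, hev.mono fun B hB x => ?_⟩
  have h1 := (abs_le.1 (dotProduct_mulVec_le_of_abs_le hB x)).1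
  have h2 : x ⬝ᵥ (B *ᵥ x) = x ⬝ᵥ (A *ᵥ x) + x ⬝ᵥ ((B - A) *ᵥ x) := by
    rw [sub_mulVec, dotProduct_sub]; ring
  have h3 : 0 ≤ x ⬝ᵥ x := by
    simp only [dotProduct]; exact Finset.sum_nonneg fun i _ => mul_self_nonneg _
  have h4 : ε * Fintype.card ι ≤ c / 2 := by
    rw [hε, div_mul_eq_mul_div, div_le_div_iff₀ (by positivity) (by positivity)]
    nlinarith
  have h5 := h x
  nlinarith

lemma exists_eventually_dotProduct_le (A : Matrix ι ι ℝ) :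
    ∃ C > 0, ∀ᶠ B in 𝓝 A, ∀ x, x ⬝ᵥ (B *ᵥ x) ≤ C * (x ⬝ᵥ x) := by
  set m : ℝ := 1 + ∑ i, ∑ j, |A i j| with hm
  have hm0 : 0 < m := by positivity
  have hev : ∀ᶠ B in 𝓝 A, ∀ i j, |B i j| ≤ m := by
    simp only [eventually_all]
    intro i j
    have : Continuous fun B : Matrix ι ι ℝ => |B i j| := by fun_prop
    refine (this.tendsto A).eventually_le_const ?_
    have h1 : |A i j| ≤ ∑ j, |A i j| :=
      Finset.single_le_sum (f := fun j => |A i j|) (fun _ _ => abs_nonneg _) (Finset.mem_univ j)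
    have h2 : ∑ j, |A i j| ≤ ∑ i, ∑ j, |A i j| :=
      Finset.single_le_sum (f := fun i => ∑ j, |A i j|)
        (fun _ _ => Finset.sum_nonneg fun _ _ => abs_nonneg _) (Finset.mem_univ i)
    linarith
  refine ⟨m * (Fintype.card ι + 1), by positivity, hev.mono fun B hB x => ?_⟩
  have h1 := (abs_le.1 (dotProduct_mulVec_le_of_abs_le hB x)).2
  have h3 : 0 ≤ x ⬝ᵥ x := by
    simp only [dotProduct]; exact Finset.sum_nonneg fun i _ => mul_self_nonneg _
  nlinarith [mul_nonneg hm0.le h3]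

end Matrix

/-! ### Haar measure and linear maps -/

section Haar

variable {E F G : Type*}
  [NormedAddCommGroup E] [NormedSpace ℝ E] [FiniteDimensional ℝ E] [MeasurableSpace E] [BorelSpace E]
  [NormedAddCommGroup F] [NormedSpace ℝ F] [FiniteDimensional ℝ F] [MeasurableSpace F] [BorelSpace F]
  [NormedAddCommGroup G] [InnerProductSpace ℝ G]

/-- The image of a Haar measure under T is a Haar measure, and these are unique up to a positive
finite factor. Since T is a measurable equivalence, f need not be measurable. -/
lemma LinearEquiv.exists_lintegral_comp_eq (μ : Measure E) [μ.IsAddHaarMeasure]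
    (ν : Measure F) [ν.IsAddHaarMeasure] (T : E ≃ₗ[ℝ] F) :
    ∃ c : ENNReal, c ≠ 0 ∧ c ≠ ⊤ ∧ ∀ f : F → ENNReal, ∫⁻ x, f (T x) ∂μ = c * ∫⁻ y, f y ∂ν := by
  set T' := T.toContinuousLinearEquiv with hT'
  have : (Measure.map T' μ).IsAddHaarMeasure := T'.isAddHaarMeasure_map μ
  have h := Measure.isAddLeftInvariant_eq_smul (Measure.map T' μ) ν
  refine ⟨((Measure.map T' μ).addHaarScalarFactor ν : NNReal), ?_, ENNReal.coe_ne_top, fun f => ?_⟩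
  · have := Measure.addHaarScalarFactor_pos_of_isAddHaarMeasure (Measure.map T' μ) ν
    exact_mod_cast this.ne'
  · have h2 : ∫⁻ x, f (T x) ∂μ = ∫⁻ y, f y ∂(Measure.map T' μ) :=
      (lintegral_map_equiv f T'.toHomeomorph.toMeasurableEquiv).symm
    rw [h2]
    conv_lhs => rw [h, lintegral_smul_measure]
    rfl

/-- For a linear injection into a Euclidean space, integrals of functions of `‖L x‖` are, up to a
constant, integrals of radial functions. -/
lemma LinearMap.exists_lintegral_norm_comp_eq (μ : Measure E) [μ.IsAddHaarMeasure]
    (L : E →ₗ[ℝ] G) (hL : Function.Injective L) :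
    ∃ c : ENNReal, c ≠ 0 ∧ c ≠ ⊤ ∧ ∀ f : ℝ → ENNReal,
      ∫⁻ x, f ‖L x‖ ∂μ
        = c * ∫⁻ y : EuclideanSpace ℝ (Fin (Module.finrank ℝ E)), f ‖y‖ := by
  let e : E ≃ₗ[ℝ] LinearMap.range L := LinearEquiv.ofInjective L hL
  have hfin : FiniteDimensional ℝ (LinearMap.range L) := e.finiteDimensional
  have hr : Module.finrank ℝ (LinearMap.range L) = Module.finrank ℝ E := e.finrank_eq.symm
  let b := (stdOrthonormalBasis ℝ (LinearMap.range L)).reindex (finCongr hr)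
  obtain ⟨c, hc0, hct, hc⟩ := LinearEquiv.exists_lintegral_comp_eq μ
    (volume : Measure (EuclideanSpace ℝ (Fin (Module.finrank ℝ E))))
    (e.trans b.repr.toLinearEquiv)
  refine ⟨c, hc0, hct, fun f => ?_⟩
  rw [← hc fun y => f ‖y‖]
  refine lintegral_congr fun x => ?_
  have : ‖(e.trans b.repr.toLinearEquiv) x‖ = ‖L x‖ := by
    change ‖b.repr (e x)‖ = ‖L x‖
    rw [LinearIsometryEquiv.norm_map]
    rfl
  rw [this]

/-- Take for `L x₀` the orthogonal projection of u onto the range of L; projecting u + L x does not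
increase its norm. -/
lemma LinearMap.exists_norm_comp_add_le (L : E →ₗ[ℝ] G) (u : G) :
    ∃ x₀, ∀ x, ‖L (x + x₀)‖ ≤ ‖u + L x‖ := by
  obtain ⟨x₀, hx₀⟩ : (LinearMap.range L).starProjection u ∈ LinearMap.range L :=
    Submodule.starProjection_apply_mem _ u
  refine ⟨x₀, fun x => ?_⟩
  have h1 : L (x + x₀) = (LinearMap.range L).starProjection (u + L x) := by
    have h2 : (LinearMap.range L).starProjection (L x) = L x :=
      Submodule.starProjection_eq_self_iff.2 ⟨x, rfl⟩
    rw [map_add, map_add, hx₀, h2, add_comm]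
  rw [h1]
  exact Submodule.norm_starProjection_apply_le _ _

/-- Radially decreasing functions have the largest integrals along subspaces through the origin. -/
lemma LinearMap.lintegral_norm_add_comp_le (μ : Measure E) [μ.IsAddHaarMeasure]
    (L : E →ₗ[ℝ] G) (u : G) {f : ℝ → ENNReal} (hf : AntitoneOn f (Set.Ici 0)) :
    ∫⁻ x, f ‖u + L x‖ ∂μ ≤ ∫⁻ x, f ‖L x‖ ∂μ := by
  obtain ⟨x₀, hx₀⟩ := L.exists_norm_comp_add_le u
  rw [← lintegral_add_right_eq_self (fun x => f ‖L x‖) x₀]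
  exact lintegral_mono fun x => hf (norm_nonneg _) (norm_nonneg _) (hx₀ x)

lemma LinearMap.measure_norm_add_comp_le (μ : Measure E) [μ.IsAddHaarMeasure]
    (L : E →ₗ[ℝ] G) (u : G) :
    μ {x | ‖u + L x‖ ≤ 1} ≤ μ {x | ‖L x‖ ≤ 1} := by
  obtain ⟨x₀, hx₀⟩ := L.exists_norm_comp_add_le u
  have : μ {x | ‖L x‖ ≤ 1} = μ ((fun x => x + x₀) ⁻¹' {x | ‖L x‖ ≤ 1}) :=
    (measure_preimage_add_right μ x₀ _).symm
  rw [this]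
  exact measure_mono fun x hx => (hx₀ x).trans hx

lemma lintegral_one_add_norm_sq_div_lt_top (μ : Measure E) [μ.IsAddHaarMeasure] {m : ℝ}
    (hm1 : 1 ≤ m) (hm : (Module.finrank ℝ E : ℝ) < m) :
    ∫⁻ y, ENNReal.ofReal ((1 + ‖y‖ ^ 2 / m) ^ (-m / 2)) ∂μ < ⊤ := by
  -- The factor comes from (1 + ‖y‖²) / m ≤ 1 + ‖y‖² / m, valid for m ≥ 1.
  have h1 := (integrable_rpow_neg_one_add_norm_sq (μ := μ) hm).const_mul ((1 / m) ^ (-m / 2))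
  have h2 := h1.lintegral_lt_top
  refine lt_of_le_of_lt (lintegral_mono fun y => ENNReal.ofReal_le_ofReal ?_) h2
  have hm0 : 0 < m := by linarith
  rw [← Real.mul_rpow (by positivity) (by positivity)]
  refine Real.rpow_le_rpow_of_nonpos (by positivity) ?_ (by linarith)
  have : 1 / m ≤ 1 := by rw [div_le_one hm0]; exact hm1
  rw [mul_add, mul_one, one_div_mul_eq_div]
  gcongr

/-- Student type integrals over affine subspaces are bounded by volumes of ellipsoids. -/
lemma exists_lintegral_one_add_norm_sq_le (μ : Measure E) [μ.IsAddHaarMeasure] {m : ℝ}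
    (hm1 : 1 ≤ m) (hm : (Module.finrank ℝ E : ℝ) < m) :
    ∃ C : ENNReal, C ≠ ⊤ ∧ ∀ (L : E →ₗ[ℝ] G), Function.Injective L → ∀ u : G,
      ∫⁻ x, ENNReal.ofReal ((1 + ‖u + L x‖ ^ 2 / m) ^ (-m / 2)) ∂μ
        ≤ C * μ {x | ‖L x‖ ≤ 1} := by
  have hm0 : 0 < m := by linarith
  set q := Module.finrank ℝ E with hq
  set I := ∫⁻ y : EuclideanSpace ℝ (Fin q), ENNReal.ofReal ((1 + ‖y‖ ^ 2 / m) ^ (-m / 2)) with hI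
  have hIt : I < ⊤ := lintegral_one_add_norm_sq_div_lt_top _ hm1 (by simpa using hm)
  set v := ∫⁻ y : EuclideanSpace ℝ (Fin q), (Set.Iic (1 : ℝ)).indicator 1 ‖y‖ with hv
  have hv' : v = volume (Metric.closedBall (0 : EuclideanSpace ℝ (Fin q)) 1) := by
    rw [hv, ← lintegral_indicator_one measurableSet_closedBall]
    refine lintegral_congr fun y => ?_
    simp [Set.indicator]
  have hv0 : v ≠ 0 := by
    rw [hv']; exact (Metric.measure_closedBall_pos _ _ one_pos).ne'
  have hvt : v ≠ ⊤ := by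
    rw [hv']; exact measure_closedBall_lt_top.ne
  -- The Student integral over the central subspace and the volume of the ellipsoid are I and v
  -- times the same factor, which depends on L; their quotient does not.
  refine ⟨I / v, (ENNReal.div_lt_top hIt.ne hv0).ne, fun L hL u => ?_⟩
  obtain ⟨c, hc0, hct, hc⟩ := LinearMap.exists_lintegral_norm_comp_eq μ L hL
  have h1 : ∫⁻ x, ENNReal.ofReal ((1 + ‖u + L x‖ ^ 2 / m) ^ (-m / 2)) ∂μ
      ≤ ∫⁻ x, ENNReal.ofReal ((1 + ‖L x‖ ^ 2 / m) ^ (-m / 2)) ∂μ := by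
    refine L.lintegral_norm_add_comp_le μ u
      (f := fun r => ENNReal.ofReal ((1 + r ^ 2 / m) ^ (-m / 2))) ?_
    intro a ha b hb hab
    refine ENNReal.ofReal_le_ofReal (Real.rpow_le_rpow_of_nonpos (by positivity) ?_ (by linarith))
    have : (0 : ℝ) ≤ a := ha
    gcongr
  have h2 : μ {x | ‖L x‖ ≤ 1} = c * v := by
    rw [hv, ← hc, ← lintegral_indicator_one]
    · refine lintegral_congr fun y => ?_
      simp [Set.indicator]
    · exact measurableSet_le (L.continuous_of_finiteDimensional.norm.measurable) measurable_const
  have h3 := hc fun r => ENNReal.ofReal ((1 + r ^ 2 / m) ^ (-m / 2))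
  rw [h2]
  refine h1.trans ?_
  rw [h3, ← hI]
  calc c * I = c * (I / v * v) := by rw [ENNReal.div_mul_cancel hv0 hvt]
    _ ≤ _ := le_of_eq (by ring)

lemma LinearMap.measure_norm_le_one_pos_lt_top (μ : Measure E) [μ.IsAddHaarMeasure]
    (L : E →ₗ[ℝ] G) (hL : Function.Injective L) :
    0 < μ {x | ‖L x‖ ≤ 1} ∧ μ {x | ‖L x‖ ≤ 1} < ⊤ := by
  have hcont : Continuous L := L.continuous_of_finiteDimensional
  constructor
  · have hopen : IsOpen {x | ‖L x‖ < 1} := isOpen_lt hcont.norm continuous_const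
    exact (hopen.measure_pos μ ⟨0, by simp⟩).trans_le (measure_mono fun x (hx : ‖L x‖ < 1) => hx.le)
  · obtain ⟨K, hK, hKL⟩ := L.exists_antilipschitzWith (LinearMap.ker_eq_bot.2 hL)
    refine (measure_mono (t := Metric.closedBall 0 K) fun x (hx : ‖L x‖ ≤ 1) => ?_).trans_lt
      measure_closedBall_lt_top
    have := hKL.le_mul_dist x 0
    simp only [map_zero, dist_zero_right] at this
    rw [mem_closedBall_zero_iff]
    nlinarith [K.coe_nonneg]

/-- The volume of an ellipsoid is bounded by the product of its central slice and its shadow. -/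
lemma LinearMap.measure_prod_norm_le_one_le (μ : Measure E) [μ.IsAddHaarMeasure]
    (ν : Measure F) [ν.IsAddHaarMeasure] (L : E × F →ₗ[ℝ] G) {c : ℝ} (hc : 0 < c)
    (h : ∀ x y, c * ‖y‖ ≤ ‖L (x, y)‖) :
    (μ.prod ν) {z | ‖L z‖ ≤ 1} ≤ μ {x | ‖L (x, 0)‖ ≤ 1} * ν (Metric.closedBall 0 (1 / c)) := by
  have hcont : Continuous L := L.continuous_of_finiteDimensional
  have hm : MeasurableSet {z | ‖L z‖ ≤ 1} :=
    (isClosed_le hcont.norm continuous_const).measurableSet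
  rw [Measure.prod_apply_symm hm, ← lintegral_indicator_const measurableSet_closedBall]
  refine lintegral_mono fun y => ?_
  by_cases hy : y ∈ Metric.closedBall (0 : F) (1 / c)
  · rw [Set.indicator_of_mem hy]
    -- A slice of the ellipsoid off the centre has at most the volume of the central one.
    have := (L ∘ₗ LinearMap.inl ℝ E F).measure_norm_add_comp_le μ (L (0, y))
    simp only [LinearMap.comp_apply, LinearMap.inl_apply, ← map_add, Prod.mk_add_mk, zero_add,
      add_zero] at this
    exact this
  · rw [Set.indicator_of_notMem hy]
    have : ((fun x => (x, y)) ⁻¹' {z : E × F | ‖L z‖ ≤ 1}) = ∅ := by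
      ext x
      simp only [Set.mem_preimage, Set.mem_ofPred_eq, Set.mem_empty_iff_false, iff_false, not_le]
      rw [mem_closedBall_zero_iff, not_le, div_lt_iff₀ hc] at hy
      linarith [h x y, mul_comm c ‖y‖]
    rw [this]
    simp

end Haar

/-- Bernoulli's inequality gives 1 + x/M ≤ (1 + x/N)^(N/M). A Student kernel with growing N can thus
be replaced by one with a fixed exponent, which makes integral bounds uniform in N. -/
lemma one_add_div_rpow_neg_le {M N x : ℝ} (hM : 0 < M) (hMN : M ≤ N) (hx : 0 ≤ x) :
    (1 + x / N) ^ (-N / 2) ≤ (1 + x / M) ^ (-M / 2) := by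
  have hN : 0 < N := by linarith
  have h1 : 1 + x / M ≤ (1 + x / N) ^ (N / M) := by
    have h := one_add_mul_self_le_rpow_one_add (s := x / N) (p := N / M)
      (by have : 0 ≤ x / N := by positivity
          linarith) (by rwa [le_div_iff₀ hM, one_mul])
    have h2 : N / M * (x / N) = x / M := by field_simp
    rwa [h2] at h
  have h3 : (1 + x / N) ^ (-N / 2) = ((1 + x / N) ^ (N / M)) ^ (-M / 2) := by
    rw [← Real.rpow_mul (by positivity)]
    congr 1
    field_simp
  rw [h3]
  exact Real.rpow_le_rpow_of_nonpos (by positivity) h1 (by linarith)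

/-! ### Integrability of the matrix `t` kernel -/

lemma lintegral_one_add_dotProduct_lt_top {ι : Type*} [Fintype ι] {m : ℝ}
    (hm : (Fintype.card ι : ℝ) < m) :
    ∫⁻ u : ι → ℝ, ENNReal.ofReal ((1 + u ⬝ᵥ u) ^ (-m / 2)) < ⊤ := by
  have h1 := integrable_rpow_neg_one_add_norm_sq (E := ι → ℝ) (μ := volume) (r := m) (by simpa)
  refine lt_of_le_of_lt (lintegral_mono fun u => ENNReal.ofReal_le_ofReal ?_) h1.lintegral_lt_top
  have hm0 : 0 ≤ m := le_trans (Nat.cast_nonneg _) hm.le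
  refine Real.rpow_le_rpow_of_nonpos (by positivity) ?_ (by linarith)
  gcongr
  have h0 : 0 ≤ u ⬝ᵥ u := Finset.sum_nonneg fun i _ => mul_self_nonneg _
  -- The norm of the function space is the maximum norm, which the Euclidean norm dominates.
  have : ‖u‖ ≤ √(u ⬝ᵥ u) := by
    refine (pi_norm_le_iff_of_nonneg (Real.sqrt_nonneg _)).2 fun i => ?_
    rw [Real.norm_eq_abs]
    refine Real.abs_le_sqrt ?_
    rw [pow_two]
    exact Finset.single_le_sum (f := fun i => u i * u i) (fun i _ => mul_self_nonneg _)
      (Finset.mem_univ i)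
  calc ‖u‖ ^ 2 ≤ √(u ⬝ᵥ u) ^ 2 := by gcongr
    _ = _ := Real.sq_sqrt h0

lemma Matrix.PosDef.det_add_vecMulVec {ι : Type*} [Fintype ι] [DecidableEq ι] {A : Matrix ι ι ℝ}
    (hA : A.PosDef) {F : Matrix ι ι ℝ} (hF : A⁻¹ = F * Fᵀ) (z : ι → ℝ) :
    (A + vecMulVec z z).det = A.det * (1 + (Fᵀ *ᵥ z) ⬝ᵥ (Fᵀ *ᵥ z)) := by
  have h := Matrix.det_add_replicateCol_mul_replicateRow (ι := Unit) (A := A)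
    hA.det_pos.ne'.isUnit z z
  rw [vecMulVec_eq Unit, h]
  congr 1
  rw [Matrix.det_unique, Matrix.add_apply, Matrix.one_apply_eq, hF]
  congr 1
  rw [← Matrix.mul_assoc, Matrix.mul_assoc (replicateRow Unit z * F), Matrix.mul_apply, dotProduct]
  refine Finset.sum_congr rfl fun i _ => ?_
  congr 1
  rw [Matrix.mul_apply, mulVec, dotProduct]
  exact Finset.sum_congr rfl fun j _ => by simp [mul_comm]

/-- The matrix determinant lemma and the substitution u = C z with A⁻¹ = C'C separate the variables.
The Jacobian |det C|⁻¹ = (det A)^(1/2) lowers the exponent from m to m - 1. -/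
lemma Matrix.PosDef.lintegral_det_add_vecMulVec {ι : Type*} [Fintype ι] [DecidableEq ι]
    {A : Matrix ι ι ℝ} (hA : A.PosDef) (m : ℝ) :
    ∫⁻ z : ι → ℝ, ENNReal.ofReal ((A + vecMulVec z z).det ^ (-m / 2))
      = ENNReal.ofReal (A.det ^ (-(m - 1) / 2))
        * ∫⁻ u : ι → ℝ, ENNReal.ofReal ((1 + u ⬝ᵥ u) ^ (-m / 2)) := by
  obtain ⟨C, hC⟩ := hA.inv.posSemidef.exists_eq_transpose_mul_self
  have hF : A⁻¹ = Cᵀ * Cᵀᵀ := by rw [transpose_transpose]; exact hC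
  have hdA := hA.det_pos
  have hdet : A.det⁻¹ = C.det ^ 2 := by
    rw [pow_two, ← Ring.inverse_eq_inv', ← Matrix.det_nonsing_inv, hC, det_mul, det_transpose]
  have hCd : C.det ≠ 0 := by
    intro h
    rw [h] at hdet
    have := inv_pos.2 hdA
    rw [hdet] at this
    simp at this
  set g : (ι → ℝ) → ENNReal := fun u => ENNReal.ofReal ((1 + u ⬝ᵥ u) ^ (-m / 2)) with hg
  have h1 : ∀ z : ι → ℝ, ENNReal.ofReal ((A + vecMulVec z z).det ^ (-m / 2))
      = ENNReal.ofReal (A.det ^ (-m / 2)) * g (toLin' C z) := by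
    intro z
    have h0 : 0 ≤ (C *ᵥ z) ⬝ᵥ (C *ᵥ z) := Finset.sum_nonneg fun i _ => mul_self_nonneg _
    rw [hA.det_add_vecMulVec hF, transpose_transpose, Real.mul_rpow hdA.le (by positivity),
      ENNReal.ofReal_mul (by positivity)]
    rfl
  simp_rw [h1]
  have hmeas : Measurable g := by
    simp only [hg, dotProduct]
    fun_prop
  rw [lintegral_const_mul' _ _ ENNReal.ofReal_ne_top, ← lintegral_map hmeas (LinearMap.continuous_of_finiteDimensional _).measurable,
    Real.map_matrix_volume_pi_eq_smul_volume_pi hCd, lintegral_smul_measure, smul_eq_mul,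
    ← mul_assoc, ← ENNReal.ofReal_mul (by positivity)]
  congr 2
  have h3 : |C.det⁻¹| = A.det ^ ((1 : ℝ) / 2) := by
    rw [← Real.sqrt_eq_rpow, ← Real.sqrt_sq_eq_abs, inv_pow, ← hdet, inv_inv]
  rw [h3, ← Real.rpow_add hdA]
  congr 1
  ring

lemma posDef_one_add_sum_vecMulVec {ι κ : Type*} [Fintype ι] [DecidableEq ι] [Fintype κ]
    (Z : κ → ι → ℝ) : (1 + ∑ k, vecMulVec (Z k) (Z k)).PosDef := by
  refine PosDef.one.add_posSemidef (posSemidef_sum _ fun k _ => ?_)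
  simpa using posSemidef_vecMulVec_self_star (Z k)

/-- Integrate out one row at a time. Each integration costs one unit of the exponent, and the last
row still needs an exponent above the number of columns, whence the bound on m. -/
lemma lintegral_det_one_add_sum_vecMulVec_lt_top {ι : Type*} [Fintype ι] [DecidableEq ι] (k : ℕ) :
    ∀ m : ℝ, (Fintype.card ι : ℝ) + k - 1 < m →
    ∫⁻ Z : Fin k → ι → ℝ,
      ENNReal.ofReal ((1 + ∑ a, vecMulVec (Z a) (Z a)).det ^ (-m / 2)) < ⊤ := by
  induction k with
  | zero =>
    intro m hm
    simp
  | succ k ih =>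
    intro m hm
    push_cast at hm
    set f : (ι → ℝ) × (Fin k → ι → ℝ) → ENNReal := fun p => ENNReal.ofReal
      (((1 + ∑ a, vecMulVec (p.2 a) (p.2 a)) + vecMulVec p.1 p.1).det ^ (-m / 2)) with hf
    have hfm : Measurable f := by
      refine ENNReal.measurable_ofReal.comp (Measurable.pow_const ?_ _)
      refine Continuous.measurable ?_
      refine Continuous.matrix_det ?_
      refine Continuous.add (Continuous.add continuous_const ?_) ?_
      · refine continuous_finsetSum _ fun a _ => ?_
        exact Continuous.matrix_vecMulVec (by fun_prop) (by fun_prop)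
      · exact Continuous.matrix_vecMulVec (by fun_prop) (by fun_prop)
    have h := (volume_preserving_piFinSuccAbove (fun _ : Fin (k + 1) => ι → ℝ) 0).lintegral_comp hfm
    have h2 : ∀ Z : Fin (k + 1) → ι → ℝ,
        f (MeasurableEquiv.piFinSuccAbove (fun _ : Fin (k + 1) => ι → ℝ) 0 Z)
          = ENNReal.ofReal ((1 + ∑ a, vecMulVec (Z a) (Z a)).det ^ (-m / 2)) := by
      intro Z
      rw [hf]
      simp only [MeasurableEquiv.piFinSuccAbove_apply, Fin.insertNthEquiv_symm_apply]
      rw [Fin.sum_univ_succ]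
      congr 3
      simp only [Fin.removeNth, Fin.zero_succAbove]
      abel
    simp_rw [h2] at h
    rw [h, Measure.volume_eq_prod, lintegral_prod_symm' _ hfm]
    simp only [hf, (posDef_one_add_sum_vecMulVec _).lintegral_det_add_vecMulVec]
    have hI : ∫⁻ u : ι → ℝ, ENNReal.ofReal ((1 + u ⬝ᵥ u) ^ (-m / 2)) < ⊤ :=
      lintegral_one_add_dotProduct_lt_top (by
        have : (0 : ℝ) ≤ k := Nat.cast_nonneg _
        linarith)
    rw [lintegral_mul_const' _ _ hI.ne]
    exact ENNReal.mul_lt_top (ih (m - 1) (by linarith)) hI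

noncomputable section

/-! ### The coordinates of a constrained model -/

namespace ConstrainedModel

variable {J L P : ℕ} (M : ConstrainedModel J L P)

/-- The linear map that embeds the free parameters `ζ_O` as directions with `ζ_E = 0`. -/
def freeDir : (Fin M.q → ℝ) →ₗ[ℝ] Param J L P where
  toFun ζ := M.zeta.symm (Sum.elim 0 ζ)
  map_add' x y := by
    rw [← map_add]
    congr 1
    ext i
    rcases i with i | i <;> simp
  map_smul' c x := by
    rw [RingHom.id_apply, ← map_smul]
    congr 1
    ext i
    rcases i with i | i <;> simp

lemma freeDir_apply (ζ : Fin M.q → ℝ) : M.freeDir ζ = M.zeta.symm (Sum.elim 0 ζ) := rfl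

lemma zeta_apply (θ : Param J L P) : M.zeta θ = Sum.elim (M.RE *ᵥ θ) (M.D *ᵥ θ) := by
  change (Matrix.fromRows M.RE M.D) *ᵥ θ = _
  rw [Matrix.fromRows_mulVec]

lemma freeDir_injective : Function.Injective M.freeDir := by
  intro x y h
  have := M.zeta.symm.injective h
  ext i
  simpa using congrFun this (Sum.inr i)

lemma RE_mulVec_zeta_symm (z : Fin M.rE ⊕ Fin M.q → ℝ) :
    M.RE *ᵥ M.zeta.symm z = z ∘ Sum.inl := by
  have h := M.zeta.apply_symm_apply z
  rw [zeta_apply] at h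
  ext i
  exact congrFun h (Sum.inl i)

lemma RE_mulVec_atEq (ζ : Fin M.q → ℝ) : M.RE *ᵥ M.atEq ζ = M.rhsE := by
  rw [atEq, RE_mulVec_zeta_symm]
  rfl

lemma RE_mulVec_freeDir (ζ : Fin M.q → ℝ) : M.RE *ᵥ M.freeDir ζ = 0 := by
  rw [freeDir_apply, RE_mulVec_zeta_symm]
  rfl

lemma freeDir_D_mulVec {δ : Param J L P} (hδ : M.RE *ᵥ δ = 0) : M.freeDir (M.D *ᵥ δ) = δ := by
  rw [freeDir_apply, LinearEquiv.symm_apply_eq, zeta_apply, hδ]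

lemma range_freeDir : LinearMap.range M.freeDir = LinearMap.ker M.RE.mulVecLin := by
  ext δ
  simp only [LinearMap.mem_range, LinearMap.mem_ker, mulVecLin_apply]
  constructor
  · rintro ⟨ζ, rfl⟩
    exact M.RE_mulVec_freeDir ζ
  · exact fun h => ⟨_, M.freeDir_D_mulVec h⟩

/-- The slice may be parametrized from any of its points. The prior uses the base point `M.θ₀`, the
posterior of a true model uses the true parameter. -/
lemma atEq_eq {θ : Param J L P} (hθ : θ ∈ M.eqSpace) (ζ : Fin M.q → ℝ) :
    M.atEq ζ = θ + M.freeDir (ζ - M.D *ᵥ θ) := by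
  have h : M.RE *ᵥ (M.atEq ζ - θ) = 0 := by
    rw [mulVec_sub, RE_mulVec_atEq, show M.RE *ᵥ θ = M.rhsE from hθ, sub_self]
  have h2 := M.freeDir_D_mulVec h
  have h3 : M.D *ᵥ M.atEq ζ = ζ := by
    have := M.zeta.apply_symm_apply (Sum.elim M.rhsE ζ)
    rw [zeta_apply] at this
    ext i
    exact congrFun this (Sum.inr i)
  rw [mulVec_sub, h3] at h2
  rw [h2]
  abel

lemma continuous_atEq : Continuous M.atEq := by
  have h : M.atEq = fun ζ => M.θ₀ + M.freeDir (ζ - M.D *ᵥ M.θ₀) :=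
    funext fun ζ => M.atEq_eq M.RE_θ₀ ζ
  rw [h]
  have := M.freeDir.continuous_of_finiteDimensional
  fun_prop

/-- The values of the free parameters that satisfy the order constraints. -/
def ordSet : Set (Fin M.q → ℝ) := {ζO | ∀ i, M.rhsO i < (M.RO *ᵥ M.atEq ζO) i}

lemma isOpen_ordSet : IsOpen M.ordSet := by
  have : M.ordSet = ⋂ i, {ζO | M.rhsO i < (M.RO *ᵥ M.atEq ζO) i} := by
    ext; simp [ordSet]
  rw [this]
  refine isOpen_iInter_of_finite fun i => isOpen_lt continuous_const ?_
  exact (continuous_apply i).comp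
    ((M.RO.mulVecLin.continuous_of_finiteDimensional).comp M.continuous_atEq)

lemma ordSet_nonempty : M.ordSet.Nonempty := by
  obtain ⟨θ, h1, h2⟩ := M.exists_mem
  refine ⟨M.D *ᵥ θ, fun i => ?_⟩
  rw [M.atEq_eq h1]
  simpa using h2 i

lemma mem_ordSet_iff {ζ : Fin M.q → ℝ} : ζ ∈ M.ordSet ↔ M.atEq ζ ∈ M.space :=
  ⟨fun h => ⟨M.RE_mulVec_atEq ζ, h⟩, fun h => h.2⟩

lemma sqrt_det_pos : 0 < √(M.H * M.Hᵀ).det := by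
  refine Real.sqrt_pos.2 ?_
  -- Surjectivity of H makes v ↦ v'H injective.
  have h : (M.H * M.Hᴴ).PosDef := by
    refine PosDef.mul_conjTranspose_self _ fun v v' hv => ?_
    refine dotProduct_eq _ _ fun u => ?_
    obtain ⟨x, rfl⟩ := M.bijective_H.2 u
    change v ⬝ᵥ (M.H *ᵥ x) = v' ⬝ᵥ (M.H *ᵥ x)
    rw [dotProduct_mulVec, dotProduct_mulVec]
    exact congrArg (· ⬝ᵥ x) hv
  simpa using h.det_pos

end ConstrainedModel

/-! ### Comparison of matrix `t` kernels -/

section Kernel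

variable {J L P : ℕ}

lemma Param.toMat_add (x y : Param J L P) : (x + y).toMat = x.toMat + y.toMat := rfl
lemma Param.toMat_smul (c : ℝ) (x : Param J L P) : (c • x).toMat = c • x.toMat := rfl

lemma Param.continuous_toMat : Continuous (Param.toMat : Param J L P → _) :=
  continuous_matrix fun a p => continuous_apply (a, p)

/-- The determinant `|S + Δ' A Δ|` as a function of `vec Δ`. -/
def detForm (A : Matrix (Coef J L) (Coef J L) ℝ) (S : Matrix (Fin P) (Fin P) ℝ)
    (δ : Param J L P) : ℝ := (S + δ.toMatᵀ * A * δ.toMat).det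

lemma continuous_detForm (A : Matrix (Coef J L) (Coef J L) ℝ) (S : Matrix (Fin P) (Fin P) ℝ) :
    Continuous (detForm A S) := by
  unfold detForm
  have := Param.continuous_toMat (J := J) (L := L) (P := P)
  exact Continuous.matrix_det (continuous_const.add
    ((this.matrix_transpose.matrix_mul continuous_const).matrix_mul this))

lemma detForm_pos {A : Matrix (Coef J L) (Coef J L) ℝ} {S : Matrix (Fin P) (Fin P) ℝ}
    (hA : A.PosSemidef) (hS : S.PosDef) (δ : Param J L P) : 0 < detForm A S δ :=
  (hS.add_posSemidef (hA.transpose_mul_mul_same _)).det_pos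

/-- In the Loewner order S + δ'Aδ dominates c (1 + δ'δ), and determinants are monotone. The power P
is the size of the matrix. This reduces all integrability questions to A = 1 and S = 1. -/
lemma le_detForm {A : Matrix (Coef J L) (Coef J L) ℝ} {S : Matrix (Fin P) (Fin P) ℝ} {c : ℝ}
    (hc : 0 < c) (hA : A.IsHermitian) (hS : S.IsHermitian)
    (hA' : ∀ x, c * (x ⬝ᵥ x) ≤ x ⬝ᵥ (A *ᵥ x)) (hS' : ∀ x, c * (x ⬝ᵥ x) ≤ x ⬝ᵥ (S *ᵥ x))
    (δ : Param J L P) : c ^ P * detForm 1 1 δ ≤ detForm A S δ := by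
  have h1 := posSemidef_sub_smul_one hA hA'
  have h2 := posSemidef_sub_smul_one hS hS'
  have h3 : (c • (1 + δ.toMatᵀ * (1 : Matrix (Coef J L) (Coef J L) ℝ) * δ.toMat)).PosDef :=
    (PosDef.one.add_posSemidef (PosSemidef.one.transpose_mul_mul_same _)).smul hc
  have h4 := h3.det_le_det_add (h2.add (h1.transpose_mul_mul_same δ.toMat))
  rw [det_smul, Fintype.card_fin] at h4
  unfold detForm
  refine h4.trans (le_of_eq ?_)
  congr 1
  simp only [smul_add, Matrix.mul_sub, Matrix.sub_mul, Matrix.mul_one, Matrix.mul_smul,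
    Matrix.smul_mul]
  abel

/-- The difference (2t + 3)(1 + δ'δ) - (1 + (δ + v)'(δ + v)) equals (2t + 1) δ'δ + (δ - v)'(δ - v) +
(2t - 2v'v) + 2. Every summand is positive semidefinite, since v'v ≤ t when the K·P = t entries of v
are at most 1 in absolute value. -/
lemma detForm_add_le : ∃ c > 0, ∀ v : Param J L P, ‖v‖ ≤ 1 → ∀ δ : Param J L P,
    detForm 1 1 (δ + v) ≤ c * detForm 1 1 δ := by
  set t : ℝ := Fintype.card (Coef J L) * Fintype.card (Fin P) with ht
  have ht0 : 0 ≤ t := by positivity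
  refine ⟨(2 * t + 3) ^ P, by positivity, fun v hv δ => ?_⟩
  have hV : ((2 * t) • (1 : Matrix (Fin P) (Fin P) ℝ) - (2 : ℝ) • (v.toMatᵀ * v.toMat)).PosSemidef := by
    refine PosSemidef.of_dotProduct_mulVec_nonneg ?_ fun x => ?_
    · simp [IsHermitian]
    · have h1 : (v.toMat *ᵥ x) ⬝ᵥ (v.toMat *ᵥ x) ≤ t * (x ⬝ᵥ x) := by
        have h2 : ∀ a, (v.toMat *ᵥ x) a * (v.toMat *ᵥ x) a
            ≤ Fintype.card (Fin P) * (x ⬝ᵥ x) := by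
          intro a
          have h3 := Finset.sum_mul_sq_le_sq_mul_sq Finset.univ (fun j => v.toMat a j) x
          have h4 : ∑ j, v.toMat a j ^ 2 ≤ Fintype.card (Fin P) := by
            have : ∀ j ∈ Finset.univ, v.toMat a j ^ 2 ≤ 1 := fun j _ => by
              have := (norm_le_pi_norm v (a, j)).trans hv
              rw [Real.norm_eq_abs] at this
              change v (a, j) ^ 2 ≤ 1
              rw [← sq_abs]
              exact pow_le_one₀ (abs_nonneg _) this
            simpa using Finset.sum_le_card_nsmul _ _ _ this
          have h5 : 0 ≤ ∑ j, x j ^ 2 := by positivity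
          have h6 : x ⬝ᵥ x = ∑ j, x j ^ 2 := by simp [dotProduct, pow_two]
          rw [h6, ← pow_two]
          refine h3.trans ?_
          gcongr
        refine (Finset.sum_le_sum fun a _ => h2 a).trans ?_
        rw [Finset.sum_const, Finset.card_univ, nsmul_eq_mul, ht, mul_assoc]
      have h2 : x ⬝ᵥ ((v.toMatᵀ * v.toMat) *ᵥ x) = (v.toMat *ᵥ x) ⬝ᵥ (v.toMat *ᵥ x) := by
        rw [← mulVec_mulVec, dotProduct_mulVec, vecMul_transpose]
      simp only [star_trivial, sub_mulVec, smul_mulVec, one_mulVec, dotProduct_sub,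
        dotProduct_smul, smul_eq_mul, h2]
      linarith
  have h1 : (1 + (δ + v).toMatᵀ * (1 : Matrix (Coef J L) (Coef J L) ℝ) * (δ + v).toMat).PosDef :=
    PosDef.one.add_posSemidef (PosSemidef.one.transpose_mul_mul_same _)
  have h3 := (posSemidef_transpose_mul_self δ.toMat).smul (show 0 ≤ 2 * t + 1 by positivity)
  have h4 := posSemidef_transpose_mul_self (δ.toMat - v.toMat)
  have h6 : (2 : Matrix (Fin P) (Fin P) ℝ).PosSemidef := PosSemidef.ofNat 2
  have h5 := h1.det_le_det_add (((h3.add h4).add hV).add h6)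
  unfold detForm
  refine h5.trans (le_of_eq ?_)
  have h7 : (2 * t + 3) ^ P * (1 + δ.toMatᵀ * (1 : Matrix (Coef J L) (Coef J L) ℝ) * δ.toMat).det
      = ((2 * t + 3) • (1 + δ.toMatᵀ * (1 : Matrix (Coef J L) (Coef J L) ℝ) * δ.toMat)).det := by
    rw [det_smul, Fintype.card_fin]
  rw [h7]
  congr 1
  simp only [Param.toMat_add, Matrix.mul_one, transpose_add, transpose_sub, Matrix.add_mul,
    Matrix.mul_add, Matrix.sub_mul, Matrix.mul_sub, smul_add, add_smul, mul_smul, one_smul,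
    show (3 : ℝ) = 1 + 1 + 1 by norm_num, show (2 : ℝ) = 1 + 1 by norm_num,
    show (2 : Matrix (Fin P) (Fin P) ℝ) = 1 + 1 by norm_num]
  abel

/-- The matrix δ'δ is the sum of the outer products of the K = J + L rows of Δ, so the row by row
integration applies. -/
lemma lintegral_detForm_lt_top {m : ℝ} (hm : (P : ℝ) + (J + L) - 1 < m) :
    ∫⁻ δ : Param J L P, ENNReal.ofReal (detForm 1 1 δ ^ (-m / 2)) < ⊤ := by
  let T : Param J L P ≃ₗ[ℝ] (Fin (J + L) → Fin P → ℝ) :=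
    (LinearEquiv.curry ℝ ℝ (Coef J L) (Fin P)).trans
      (LinearEquiv.funCongrLeft ℝ (Fin P → ℝ) finSumFinEquiv.symm)
  obtain ⟨c, -, hct, hc⟩ := T.exists_lintegral_comp_eq volume volume
  have h := hc fun Z => ENNReal.ofReal ((1 + ∑ a, vecMulVec (Z a) (Z a)).det ^ (-m / 2))
  have h2 : ∀ δ : Param J L P, 1 + ∑ a, vecMulVec (T δ a) (T δ a)
      = 1 + δ.toMatᵀ * (1 : Matrix (Coef J L) (Coef J L) ℝ) * δ.toMat := by
    intro δ
    congr 1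
    ext p p'
    rw [Matrix.mul_one, Matrix.mul_apply, Matrix.sum_apply,
      ← (finSumFinEquiv (m := J) (n := L)).sum_comp]
    refine Finset.sum_congr rfl fun a _ => ?_
    simp [T, vecMulVec_apply, Param.toMat]
  simp_rw [h2] at h
  unfold detForm
  rw [h]
  refine ENNReal.mul_lt_top hct.lt_top (lintegral_det_one_add_sum_vecMulVec_lt_top _ m ?_)
  push_cast
  simpa using hm

/-- By Tonelli the integral over the whole space is an integral of slice integrals. If the central
slice had infinite mass, `detForm_add_le` would give infinite mass to every parallel slice in a
neighbourhood, contradicting finiteness of the total. -/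
lemma ConstrainedModel.lintegral_freeDir_detForm_lt_top (M : ConstrainedModel J L P) {m : ℝ}
    (hm : (P : ℝ) + (J + L) - 1 < m) (hm0 : 0 ≤ m) :
    ∫⁻ ζ, ENNReal.ofReal (detForm 1 1 (M.freeDir ζ) ^ (-m / 2)) < ⊤ := by
  have hpos := fun δ : Param J L P => detForm_pos (S := 1) PosSemidef.one PosDef.one δ
  set g : Param J L P → ENNReal := fun δ => ENNReal.ofReal (detForm 1 1 δ ^ (-m / 2)) with hg
  have hgc : Continuous g := ENNReal.continuous_ofReal.comp
    ((continuous_detForm 1 1).rpow_const fun δ => Or.inl (hpos δ).ne')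
  let T : ((Fin M.rE → ℝ) × (Fin M.q → ℝ)) ≃ₗ[ℝ] Param J L P :=
    (LinearEquiv.sumArrowLequivProdArrow (Fin M.rE) (Fin M.q) ℝ ℝ).symm.trans M.zeta.symm
  have hTc : Continuous T := T.toLinearMap.continuous_of_finiteDimensional
  have hT : ∀ a b, T (a, b) = T (a, 0) + M.freeDir b := by
    intro a b
    have h1 : (a, b) = (a, 0) + ((0, b) : (Fin M.rE → ℝ) × (Fin M.q → ℝ)) := by simp
    rw [h1, map_add]
    congr 1
  have hHaar := Measure.prod.instIsAddHaarMeasure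
    (volume : Measure (Fin M.rE → ℝ)) (volume : Measure (Fin M.q → ℝ))
  obtain ⟨c, -, hct, hc⟩ := T.exists_lintegral_comp_eq
    ((volume : Measure (Fin M.rE → ℝ)).prod (volume : Measure (Fin M.q → ℝ))) volume
  have h1 : ∫⁻ z, g (T z) ∂((volume : Measure (Fin M.rE → ℝ)).prod
      (volume : Measure (Fin M.q → ℝ))) < ⊤ := by
    rw [hc g]
    exact ENNReal.mul_lt_top hct.lt_top (lintegral_detForm_lt_top hm)
  rw [lintegral_prod (fun z => g (T z)) (hgc.comp hTc).measurable.aemeasurable] at h1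
  obtain ⟨C, hC, hCle⟩ := detForm_add_le (J := J) (L := L) (P := P)
  set U : Set (Fin M.rE → ℝ) := {a | ‖T (a, 0)‖ < 1} with hU
  have hUo : IsOpen U := isOpen_lt (by fun_prop) continuous_const
  have hU0 : 0 < volume U := hUo.measure_pos _ ⟨0, by simp [hU, ← Prod.zero_eq_mk]⟩
  set k : ENNReal := ENNReal.ofReal (C ^ (-m / 2)) with hk
  have hk0 : k ≠ 0 := by rw [hk]; exact (ENNReal.ofReal_pos.2 (by positivity)).ne'
  have h2 : ∫⁻ a in U, k * ∫⁻ b, g (M.freeDir b) ≤ ∫⁻ a, ∫⁻ b, g (T (a, b)) := by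
    refine (setLIntegral_mono' hUo.measurableSet fun a ha => ?_).trans
      (setLIntegral_le_lintegral U fun a => ∫⁻ b, g (T (a, b)))
    rw [← lintegral_const_mul' _ _ ENNReal.ofReal_ne_top]
    refine lintegral_mono fun b => ?_
    rw [hg, ← ENNReal.ofReal_mul (by positivity), ← Real.mul_rpow hC.le (hpos _).le]
    refine ENNReal.ofReal_le_ofReal (Real.rpow_le_rpow_of_nonpos (hpos _) ?_ (by linarith))
    rw [hT, add_comm]
    exact hCle _ (le_of_lt ha) _
  rw [setLIntegral_const] at h2
  have h3 := h2.trans_lt h1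
  by_contra hcon
  rw [not_lt, top_le_iff] at hcon
  change ∫⁻ b, g (M.freeDir b) = ⊤ at hcon
  rw [hcon, ENNReal.mul_top hk0, ENNReal.top_mul hU0.ne'] at h3
  exact lt_irrefl _ h3

lemma ConstrainedModel.lintegral_atEq_detForm_lt_top (M : ConstrainedModel J L P) {m : ℝ}
    (hm : (P : ℝ) + (J + L) - 1 < m) (hm0 : 0 ≤ m) :
    ∫⁻ ζ, ENNReal.ofReal (detForm 1 1 (M.atEq ζ - M.θ₀) ^ (-m / 2)) < ⊤ := by
  have h : ∀ ζ, M.atEq ζ - M.θ₀ = M.freeDir (ζ - M.D *ᵥ M.θ₀) := fun ζ => by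
    rw [M.atEq_eq M.RE_θ₀, add_sub_cancel_left]
  simp_rw [h]
  rw [lintegral_sub_right_eq_self (μ := volume)
    (fun ζ => ENNReal.ofReal (detForm 1 1 (M.freeDir ζ) ^ (-m / 2)))]
  exact M.lintegral_freeDir_detForm_lt_top hm hm0

end Kernel

end

noncomputable section

/-! ### Matrix `t` densities and their conditional quantities -/

section Densities

variable {J L P : ℕ}

/-- The vectorization of a coefficient matrix. -/
def Param.ofMat (A : Matrix (Coef J L) (Fin P) ℝ) : Param J L P := fun x => A x.1 x.2

lemma matrixTKernel_eq (A : Matrix (Coef J L) (Fin P) ℝ) (U : Matrix (Coef J L) (Coef J L) ℝ)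
    (S : Matrix (Fin P) (Fin P) ℝ) (ν : ℝ) (θ : Param J L P) :
    matrixTKernel A U S ν θ
      = detForm U⁻¹ S (θ - Param.ofMat A) ^ (-(ν + (J + L) + P - 1) / 2) := rfl

lemma ConstrainedModel.eqDensity_div (M : ConstrainedModel J L P) (k : Param J L P → ℝ) (Z : ℝ) :
    M.eqDensity (fun θ => k θ / Z) = (∫ ζ, k (M.atEq ζ)) / Z / √(M.H * M.Hᵀ).det := by
  unfold eqDensity zetaDensity
  rw [integral_div, integral_div]

lemma ConstrainedModel.ordProb_div (M : ConstrainedModel J L P) (k : Param J L P → ℝ) {Z : ℝ}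
    (hZ : Z ≠ 0) : M.ordProb (fun θ => k θ / Z)
      = (∫ ζ in M.ordSet, k (M.atEq ζ)) / ∫ ζ, k (M.atEq ζ) := by
  unfold ordProb
  rw [eqDensity_div]
  unfold zetaDensity
  rw [integral_div, integral_div]
  have := M.sqrt_det_pos.ne'
  rw [div_div_div_cancel_right₀ this, div_div_div_cancel_right₀ hZ]
  rfl

variable {X : Type*} [MeasurableSpace X] {μ : Measure X} {φ : X → Param J L P}

lemma detForm_rpow_le {A : Matrix (Coef J L) (Coef J L) ℝ} {S : Matrix (Fin P) (Fin P) ℝ} {c : ℝ}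
    (hc : 0 < c) (hA : A.IsHermitian) (hS : S.IsHermitian)
    (hA' : ∀ x, c * (x ⬝ᵥ x) ≤ x ⬝ᵥ (A *ᵥ x)) (hS' : ∀ x, c * (x ⬝ᵥ x) ≤ x ⬝ᵥ (S *ᵥ x))
    {m : ℝ} (hm : 0 ≤ m) (δ : Param J L P) :
    ‖detForm A S δ ^ (-m / 2)‖ ≤ (c ^ P) ^ (-m / 2) * detForm 1 1 δ ^ (-m / 2) := by
  have h1 := detForm_pos (S := 1) PosSemidef.one PosDef.one δ
  have h2 := le_detForm hc hA hS hA' hS' δ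
  have h3 : 0 < c ^ P * detForm 1 1 δ := by positivity
  rw [Real.norm_of_nonneg (Real.rpow_nonneg (h3.le.trans h2) _),
    ← Real.mul_rpow (by positivity) h1.le]
  exact Real.rpow_le_rpow_of_nonpos h3 h2 (by linarith)

lemma integrable_detForm_one (hφ : Measurable φ) {m : ℝ}
    (hint : ∫⁻ x, ENNReal.ofReal (detForm 1 1 (φ x) ^ (-m / 2)) ∂μ < ⊤) :
    Integrable (fun x => detForm 1 1 (φ x) ^ (-m / 2)) μ := by
  refine ⟨(((continuous_detForm 1 1).measurable.comp hφ).pow_const _).aestronglyMeasurable, ?_⟩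
  rw [hasFiniteIntegral_iff_ofReal]
  · exact hint
  · exact Eventually.of_forall fun x =>
      Real.rpow_nonneg (detForm_pos (S := 1) PosSemidef.one PosDef.one _).le _

lemma integrable_detForm (hφ : Measurable φ) {m : ℝ} (hm : 0 ≤ m)
    (hint : ∫⁻ x, ENNReal.ofReal (detForm 1 1 (φ x) ^ (-m / 2)) ∂μ < ⊤)
    {A : Matrix (Coef J L) (Coef J L) ℝ} {S : Matrix (Fin P) (Fin P) ℝ}
    (hA : A.PosDef) (hS : S.PosDef) :
    Integrable (fun x => detForm A S (φ x) ^ (-m / 2)) μ := by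
  obtain ⟨c₁, hc₁, h₁⟩ := hA.exists_le_dotProduct
  obtain ⟨c₂, hc₂, h₂⟩ := hS.exists_le_dotProduct
  refine ((integrable_detForm_one hφ hint).const_mul ((min c₁ c₂ ^ P) ^ (-m / 2))).mono'
    (((continuous_detForm A S).measurable.comp hφ).pow_const _).aestronglyMeasurable
    (Eventually.of_forall fun x => ?_)
  refine detForm_rpow_le (lt_min hc₁ hc₂) hA.1 hS.1 (fun x => ?_) (fun x => ?_) hm _
  · refine le_trans ?_ (h₁ x)
    have : 0 ≤ x ⬝ᵥ x := Finset.sum_nonneg fun i _ => mul_self_nonneg _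
    gcongr
    exact min_le_left _ _
  · refine le_trans ?_ (h₂ x)
    have : 0 ≤ x ⬝ᵥ x := Finset.sum_nonneg fun i _ => mul_self_nonneg _
    gcongr
    exact min_le_right _ _

lemma integral_detForm_pos (hμ : μ ≠ 0) {r : ℝ} {A : Matrix (Coef J L) (Coef J L) ℝ}
    {S : Matrix (Fin P) (Fin P) ℝ} (hA : A.PosDef) (hS : S.PosDef)
    (hint : Integrable (fun x => detForm A S (φ x) ^ r) μ) :
    0 < ∫ x, detForm A S (φ x) ^ r ∂μ := by
  have hpos : ∀ x, 0 < detForm A S (φ x) ^ r := fun x =>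
    Real.rpow_pos_of_pos (detForm_pos hA.posSemidef hS _) _
  rw [integral_pos_iff_support_of_nonneg (fun x => (hpos x).le) hint]
  have : Function.support (fun x => detForm A S (φ x) ^ r) = Set.univ :=
    Set.eq_univ_of_forall fun x => (hpos x).ne'
  rw [this]
  exact Measure.measure_univ_pos.2 hμ

/-- The pairs of symmetric matrices. -/
def hermitianPairs (J L P : ℕ) :
    Set (Matrix (Coef J L) (Coef J L) ℝ × Matrix (Fin P) (Fin P) ℝ) :=
  {p | p.1.IsHermitian ∧ p.2.IsHermitian}

/-- Near a positive definite pair, quadratic forms have a common positive lower bound, so one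
multiple of the kernel with A = 1 and S = 1 dominates. Symmetry of the pairs is required because the
passage from quadratic forms to determinants uses the Loewner order. -/
lemma tendsto_integral_detForm (hφ : Measurable φ) {m : ℝ} (hm : 0 ≤ m)
    (hint : ∫⁻ x, ENNReal.ofReal (detForm 1 1 (φ x) ^ (-m / 2)) ∂μ < ⊤)
    {A : Matrix (Coef J L) (Coef J L) ℝ} {S : Matrix (Fin P) (Fin P) ℝ}
    (hA : A.PosDef) (hS : S.PosDef) :
    Tendsto (fun p : Matrix (Coef J L) (Coef J L) ℝ × Matrix (Fin P) (Fin P) ℝ =>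
        ∫ x, detForm p.1 p.2 (φ x) ^ (-m / 2) ∂μ) (𝓝[hermitianPairs J L P] (A, S))
      (𝓝 (∫ x, detForm A S (φ x) ^ (-m / 2) ∂μ)) := by
  obtain ⟨c₁, hc₁, h₁⟩ := hA.exists_eventually_le_dotProduct
  obtain ⟨c₂, hc₂, h₂⟩ := hS.exists_eventually_le_dotProduct
  have hc : 0 < min c₁ c₂ := lt_min hc₁ hc₂
  -- Dominated convergence along a filter requires it to be countably generated.
  have : (𝓝 (A, S)).IsCountablyGenerated := by
    have h₁ : (𝓝 A).IsCountablyGenerated :=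
      (inferInstance : FirstCountableTopology (Coef J L → Coef J L → ℝ)).nhds_generated_countable A
    have h₂ : (𝓝 S).IsCountablyGenerated :=
      (inferInstance : FirstCountableTopology (Fin P → Fin P → ℝ)).nhds_generated_countable S
    rw [nhds_prod_eq]
    infer_instance
  have : (𝓝[hermitianPairs J L P] (A, S)).IsCountablyGenerated := by
    unfold nhdsWithin
    infer_instance
  refine tendsto_integral_filter_of_dominated_convergence
    (fun x => (min c₁ c₂ ^ P) ^ (-m / 2) * detForm 1 1 (φ x) ^ (-m / 2)) ?_ ?_
    ((integrable_detForm_one hφ hint).const_mul _) ?_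
  · exact Eventually.of_forall fun p =>
      (((continuous_detForm _ _).measurable.comp hφ).pow_const _).aestronglyMeasurable
  · have hev : ∀ᶠ p : Matrix (Coef J L) (Coef J L) ℝ × Matrix (Fin P) (Fin P) ℝ in
        𝓝[hermitianPairs J L P] (A, S), (∀ x, c₁ * (x ⬝ᵥ x) ≤ x ⬝ᵥ (p.1 *ᵥ x)) ∧
          (∀ x, c₂ * (x ⬝ᵥ x) ≤ x ⬝ᵥ (p.2 *ᵥ x)) := by
      refine eventually_nhdsWithin_of_eventually_nhds ?_
      rw [nhds_prod_eq]
      exact h₁.prod_mk h₂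
    filter_upwards [hev, self_mem_nhdsWithin] with p hp hp'
    refine Eventually.of_forall fun x => ?_
    refine detForm_rpow_le hc hp'.1 hp'.2 (fun x => ?_) (fun x => ?_) hm _
    · refine le_trans ?_ (hp.1 x)
      have : 0 ≤ x ⬝ᵥ x := Finset.sum_nonneg fun i _ => mul_self_nonneg _
      gcongr
      exact min_le_left _ _
    · refine le_trans ?_ (hp.2 x)
      have : 0 ≤ x ⬝ᵥ x := Finset.sum_nonneg fun i _ => mul_self_nonneg _
      gcongr
      exact min_le_right _ _
  · refine Eventually.of_forall fun x => ?_
    have hcont : Continuous fun p : Matrix (Coef J L) (Coef J L) ℝ × Matrix (Fin P) (Fin P) ℝ =>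
        detForm p.1 p.2 (φ x) := by
      unfold detForm
      exact Continuous.matrix_det (continuous_snd.add
        ((continuous_const.matrix_mul continuous_fst).matrix_mul continuous_const))
    exact ((hcont.tendsto (A, S)).mono_left nhdsWithin_le_nhds).rpow_const
      (Or.inl (detForm_pos hA.posSemidef hS _).ne')

end Densities

/-! ### Continuity of the matrix Cauchy prior quantities -/

section Prior

variable {J L P : ℕ} (M : ConstrainedModel J L P)
  {A : Matrix (Coef J L) (Coef J L) ℝ} {S : Matrix (Fin P) (Fin P) ℝ}

/-- The exponent of the matrix Cauchy kernel. -/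
lemma cauchy_exponent (J L P : ℕ) :
    -((1 : ℝ) + (J + L) + P - 1) / 2 = -((P : ℝ) + (J + L)) / 2 := by ring

lemma matrixTDensity_cauchy_eq (θ₀ : Param J L P) (hA : A.det ≠ 0) :
    matrixTDensity θ₀.toMat A⁻¹ S 1 = fun θ => detForm A S (θ - θ₀) ^ (-((P : ℝ) + (J + L)) / 2)
      / ∫ θ', detForm A S (θ' - θ₀) ^ (-((P : ℝ) + (J + L)) / 2) := by
  unfold matrixTDensity
  simp_rw [matrixTKernel_eq, nonsing_inv_nonsing_inv A hA.isUnit, cauchy_exponent]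
  rfl

lemma lintegral_detForm_sub_lt_top (θ₀ : Param J L P) :
    ∫⁻ θ, ENNReal.ofReal (detForm 1 1 (θ - θ₀) ^ (-((P : ℝ) + (J + L)) / 2)) < ⊤ := by
  rw [lintegral_sub_right_eq_self (μ := volume)
    (fun θ => ENNReal.ofReal (detForm 1 1 θ ^ (-((P : ℝ) + (J + L)) / 2)))]
  exact lintegral_detForm_lt_top (by linarith)

lemma lintegral_atEq_cauchy_lt_top :
    ∫⁻ ζ, ENNReal.ofReal (detForm 1 1 (M.atEq ζ - M.θ₀) ^ (-((P : ℝ) + (J + L)) / 2)) < ⊤ :=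
  M.lintegral_atEq_detForm_lt_top (by linarith) (by positivity)

lemma volume_restrict_ordSet_ne_zero : (volume.restrict M.ordSet) ≠ 0 := by
  rw [Ne, Measure.restrict_eq_zero]
  exact (M.isOpen_ordSet.measure_pos _ M.ordSet_nonempty).ne'

lemma eventually_hermitianPairs_posDef (hA : A.PosDef) (hS : S.PosDef) :
    ∀ᶠ p in 𝓝[hermitianPairs J L P] (A, S), p.1.PosDef ∧ p.2.PosDef := by
  obtain ⟨c₁, hc₁, h₁⟩ := hA.exists_eventually_le_dotProduct
  obtain ⟨c₂, hc₂, h₂⟩ := hS.exists_eventually_le_dotProduct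
  have hev : ∀ᶠ p : Matrix (Coef J L) (Coef J L) ℝ × Matrix (Fin P) (Fin P) ℝ in
      𝓝[hermitianPairs J L P] (A, S), (∀ x, c₁ * (x ⬝ᵥ x) ≤ x ⬝ᵥ (p.1 *ᵥ x)) ∧
        (∀ x, c₂ * (x ⬝ᵥ x) ≤ x ⬝ᵥ (p.2 *ᵥ x)) := by
    refine eventually_nhdsWithin_of_eventually_nhds ?_
    rw [nhds_prod_eq]
    exact h₁.prod_mk h₂
  filter_upwards [hev, self_mem_nhdsWithin] with p hp hp'
  exact ⟨posDef_of_le_dotProduct hp'.1 hc₁ hp.1, posDef_of_le_dotProduct hp'.2 hc₂ hp.2⟩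

lemma integral_cauchy_pos (hA : A.PosDef) (hS : S.PosDef) (θ₀ : Param J L P) :
    0 < ∫ θ, detForm A S (θ - θ₀) ^ (-((P : ℝ) + (J + L)) / 2) :=
  integral_detForm_pos (NeZero.ne _) hA hS
    (integrable_detForm (by fun_prop) (by positivity) (lintegral_detForm_sub_lt_top θ₀) hA hS)

lemma integral_atEq_cauchy_pos (hA : A.PosDef) (hS : S.PosDef) :
    0 < ∫ ζ, detForm A S (M.atEq ζ - M.θ₀) ^ (-((P : ℝ) + (J + L)) / 2) :=
  integral_detForm_pos (NeZero.ne _) hA hS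
    (integrable_detForm (M.continuous_atEq.sub continuous_const).measurable (by positivity)
      (lintegral_atEq_cauchy_lt_top M) hA hS)

lemma setLIntegral_atEq_cauchy_lt_top :
    ∫⁻ ζ in M.ordSet,
      ENNReal.ofReal (detForm 1 1 (M.atEq ζ - M.θ₀) ^ (-((P : ℝ) + (J + L)) / 2)) < ⊤ :=
  (setLIntegral_le_lintegral _ _).trans_lt (lintegral_atEq_cauchy_lt_top M)

lemma setIntegral_atEq_cauchy_pos (hA : A.PosDef) (hS : S.PosDef) :
    0 < ∫ ζ in M.ordSet, detForm A S (M.atEq ζ - M.θ₀) ^ (-((P : ℝ) + (J + L)) / 2) :=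
  integral_detForm_pos (volume_restrict_ordSet_ne_zero M) hA hS
    (integrable_detForm (M.continuous_atEq.sub continuous_const).measurable (by positivity)
      (setLIntegral_atEq_cauchy_lt_top M) hA hS)

lemma eqDensity_cauchy_eq (hA : A.det ≠ 0) :
    M.eqDensity (matrixTDensity M.θ₀.toMat A⁻¹ S 1)
      = (∫ ζ, detForm A S (M.atEq ζ - M.θ₀) ^ (-((P : ℝ) + (J + L)) / 2))
        / (∫ θ', detForm A S (θ' - M.θ₀) ^ (-((P : ℝ) + (J + L)) / 2)) / √(M.H * M.Hᵀ).det := by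
  rw [matrixTDensity_cauchy_eq _ hA, M.eqDensity_div]

lemma ordProb_cauchy_eq (hA : A.PosDef) (hS : S.PosDef) :
    M.ordProb (matrixTDensity M.θ₀.toMat A⁻¹ S 1)
      = (∫ ζ in M.ordSet, detForm A S (M.atEq ζ - M.θ₀) ^ (-((P : ℝ) + (J + L)) / 2))
        / ∫ ζ, detForm A S (M.atEq ζ - M.θ₀) ^ (-((P : ℝ) + (J + L)) / 2) := by
  rw [matrixTDensity_cauchy_eq _ hA.det_pos.ne', M.ordProb_div _ (integral_cauchy_pos hA hS _).ne']

lemma eqDensity_cauchy_pos (hA : A.PosDef) (hS : S.PosDef) : 0 < M.eqDensity (matrixTDensity M.θ₀.toMat A⁻¹ S 1) := by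
  rw [eqDensity_cauchy_eq M hA.det_pos.ne']
  exact div_pos (div_pos (integral_atEq_cauchy_pos M hA hS) (integral_cauchy_pos hA hS _))
    M.sqrt_det_pos

lemma ordProb_cauchy_pos (hA : A.PosDef) (hS : S.PosDef) : 0 < M.ordProb (matrixTDensity M.θ₀.toMat A⁻¹ S 1) := by
  rw [ordProb_cauchy_eq M hA hS]
  exact div_pos (setIntegral_atEq_cauchy_pos M hA hS) (integral_atEq_cauchy_pos M hA hS)

lemma tendsto_eqDensity_cauchy (hA : A.PosDef) (hS : S.PosDef) :
    Tendsto (fun p : Matrix (Coef J L) (Coef J L) ℝ × Matrix (Fin P) (Fin P) ℝ =>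
        M.eqDensity (matrixTDensity M.θ₀.toMat p.1⁻¹ p.2 1)) (𝓝[hermitianPairs J L P] (A, S))
      (𝓝 (M.eqDensity (matrixTDensity M.θ₀.toMat A⁻¹ S 1))) := by
  rw [eqDensity_cauchy_eq M hA.det_pos.ne']
  refine Tendsto.congr' (f₁ := fun p : Matrix (Coef J L) (Coef J L) ℝ × Matrix (Fin P) (Fin P) ℝ =>
    (∫ ζ, detForm p.1 p.2 (M.atEq ζ - M.θ₀) ^ (-((P : ℝ) + (J + L)) / 2))
        / (∫ θ', detForm p.1 p.2 (θ' - M.θ₀) ^ (-((P : ℝ) + (J + L)) / 2)) / √(M.H * M.Hᵀ).det) ?_ ?_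
  · filter_upwards [eventually_hermitianPairs_posDef hA hS] with p hp
    rw [eqDensity_cauchy_eq M hp.1.det_pos.ne']
  · refine Tendsto.div_const (Tendsto.div ?_ ?_ (integral_cauchy_pos hA hS _).ne') _
    · exact tendsto_integral_detForm (M.continuous_atEq.sub continuous_const).measurable
        (by positivity) (lintegral_atEq_cauchy_lt_top M) hA hS
    · exact tendsto_integral_detForm (by fun_prop) (by positivity)
        (lintegral_detForm_sub_lt_top _) hA hS

lemma tendsto_ordProb_cauchy (hA : A.PosDef) (hS : S.PosDef) :
    Tendsto (fun p : Matrix (Coef J L) (Coef J L) ℝ × Matrix (Fin P) (Fin P) ℝ =>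
        M.ordProb (matrixTDensity M.θ₀.toMat p.1⁻¹ p.2 1)) (𝓝[hermitianPairs J L P] (A, S))
      (𝓝 (M.ordProb (matrixTDensity M.θ₀.toMat A⁻¹ S 1))) := by
  rw [ordProb_cauchy_eq M hA hS]
  refine Tendsto.congr' (f₁ := fun p : Matrix (Coef J L) (Coef J L) ℝ × Matrix (Fin P) (Fin P) ℝ =>
    (∫ ζ in M.ordSet, detForm p.1 p.2 (M.atEq ζ - M.θ₀) ^ (-((P : ℝ) + (J + L)) / 2))
        / ∫ ζ, detForm p.1 p.2 (M.atEq ζ - M.θ₀) ^ (-((P : ℝ) + (J + L)) / 2)) ?_ ?_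
  · filter_upwards [eventually_hermitianPairs_posDef hA hS] with p hp
    rw [ordProb_cauchy_eq M hp.1 hp.2]
  · refine Tendsto.div ?_ ?_ (integral_atEq_cauchy_pos M hA hS).ne'
    · exact tendsto_integral_detForm (M.continuous_atEq.sub continuous_const).measurable
        (by positivity) (setLIntegral_atEq_cauchy_lt_top M) hA hS
    · exact tendsto_integral_detForm (M.continuous_atEq.sub continuous_const).measurable
        (by positivity) (lintegral_atEq_cauchy_lt_top M) hA hS

end Prior

end

noncomputable section

/-! ### Kernels with elliptical bounds -/

section Elliptic

variable {E F V G : Type*}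
  [NormedAddCommGroup E] [NormedSpace ℝ E] [FiniteDimensional ℝ E] [MeasurableSpace E] [BorelSpace E]
  [NormedAddCommGroup F] [NormedSpace ℝ F] [FiniteDimensional ℝ F] [MeasurableSpace F] [BorelSpace F]
  [NormedAddCommGroup V] [NormedSpace ℝ V] [FiniteDimensional ℝ V]
  [NormedAddCommGroup G] [InnerProductSpace ℝ G]

/-- Bounds for a function `H` whose power `H ^ (-N / 2)` behaves like a Gaussian density with
precision form `‖Ψ δ‖ ^ 2`, whose order of magnitude lies between `n` and `N`. The true parameter
has the bounded standardized deviation `Ψ δ₀`. -/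
structure EllipticBounds (N n c C : ℝ) (Ψ : V →ₗ[ℝ] G) (H : V → ℝ) (δ₀ : V) : Prop where
  N_pos : 0 < N
  n_pos : 0 < n
  c_pos : 0 < c
  C_pos : 0 < C
  n_le : n ≤ N
  one_add_le : ∀ δ, 1 + ‖Ψ δ‖ ^ 2 / N ≤ H δ
  le_exp : ∀ δ, H δ ≤ Real.exp (‖Ψ δ‖ ^ 2 / N)
  le_sq : ∀ δ, c * n * ‖δ‖ ^ 2 ≤ ‖Ψ δ‖ ^ 2
  sq_le : ∀ δ, ‖Ψ δ‖ ^ 2 ≤ C * N * ‖δ‖ ^ 2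
  center : ‖Ψ δ₀‖ ^ 2 ≤ C

lemma LinearMap.exists_mul_norm_le (B : E →ₗ[ℝ] V) (hB : Function.Injective B) :
    ∃ b > 0, ∀ x, b * ‖x‖ ≤ ‖B x‖ := by
  obtain ⟨K, hK, hKB⟩ := B.exists_antilipschitzWith (LinearMap.ker_eq_bot.2 hB)
  have hK' : (0 : ℝ) < K := hK
  refine ⟨(K : ℝ)⁻¹, by positivity, fun x => ?_⟩
  have := hKB.le_mul_dist x 0
  simp only [map_zero, dist_zero_right] at this
  rw [inv_mul_le_iff₀ hK']
  exact this

lemma LinearMap.exists_norm_le_mul (B : E →ₗ[ℝ] V) : ∃ b > 0, ∀ x, ‖B x‖ ≤ b * ‖x‖ := by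
  refine ⟨‖LinearMap.toContinuousLinearMap B‖ + 1, by positivity, fun x => ?_⟩
  have := (LinearMap.toContinuousLinearMap B).le_opNorm x
  simp only [LinearMap.coe_toContinuousLinearMap'] at this
  nlinarith [norm_nonneg x]

namespace EllipticBounds

variable {N n c C : ℝ} {Ψ : V →ₗ[ℝ] G} {H : V → ℝ} {δ₀ : V}

lemma sqrt_mul_norm_le (h : EllipticBounds N n c C Ψ H δ₀) (δ : V) : √(c * n) * ‖δ‖ ≤ ‖Ψ δ‖ := by
  refine abs_le_of_sq_le_sq' ?_ (norm_nonneg _) |>.2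
  have := h.c_pos
  have := h.n_pos
  rw [mul_pow, Real.sq_sqrt (by positivity)]
  exact h.le_sq δ

lemma norm_le_sqrt_mul (h : EllipticBounds N n c C Ψ H δ₀) (δ : V) :
    ‖Ψ δ‖ ≤ √(C * N) * ‖δ‖ := by
  have h1 := h.C_pos
  have h2 := h.N_pos
  refine abs_le_of_sq_le_sq' ?_ (by positivity) |>.2
  rw [mul_pow, Real.sq_sqrt (by positivity)]
  exact h.sq_le δ

lemma injective (h : EllipticBounds N n c C Ψ H δ₀) : Function.Injective Ψ := by
  refine (injective_iff_map_eq_zero Ψ).2 fun δ hδ => ?_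
  have h1 := h.sqrt_mul_norm_le δ
  have := h.c_pos
  have := h.n_pos
  have h2 : 0 < √(c * n) := Real.sqrt_pos.2 (by positivity)
  rw [hδ, norm_zero] at h1
  have h3 : ‖δ‖ ≤ 0 := by
    by_contra hcon
    nlinarith
  exact norm_le_zero_iff.1 h3

lemma pos (h : EllipticBounds N n c C Ψ H δ₀) (δ : V) : 0 < H δ := by
  have := h.N_pos
  exact lt_of_lt_of_le (by positivity) (h.one_add_le δ)

/-- The constant K is fixed before N, n, Ψ and H: `one_add_div_rpow_neg_le` replaces N by a fixed m
above the dimension. Any translate v is allowed, so a false model is bounded in the same way. -/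
lemma exists_lintegral_le (μ : Measure E) [μ.IsAddHaarMeasure] (B : E →ₗ[ℝ] V)
    (hB : Function.Injective B) {m : ℝ} (hm1 : 1 ≤ m) (hm : (Module.finrank ℝ E : ℝ) < m) :
    ∃ K : ENNReal, K ≠ ⊤ ∧ ∀ (N n c C : ℝ) (Ψ : V →ₗ[ℝ] G) (H : V → ℝ) (δ₀ : V), m ≤ N →
      EllipticBounds N n c C Ψ H δ₀ → ∀ v : V,
      ∫⁻ x, ENNReal.ofReal (H (v + B x) ^ (-N / 2)) ∂μ ≤ K * μ {x | ‖Ψ (B x)‖ ≤ 1} := by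
  obtain ⟨K, hK, hle⟩ := exists_lintegral_one_add_norm_sq_le (G := G) μ hm1 hm
  refine ⟨K, hK, fun N n c C Ψ H δ₀ hmN h v => ?_⟩
  refine le_trans (lintegral_mono fun x => ENNReal.ofReal_le_ofReal ?_)
    (hle (Ψ ∘ₗ B) (h.injective.comp hB) (Ψ v))
  have hN := h.N_pos
  have h1 : H (v + B x) ^ (-N / 2) ≤ (1 + ‖Ψ (v + B x)‖ ^ 2 / N) ^ (-N / 2) :=
    Real.rpow_le_rpow_of_nonpos (by positivity) (h.one_add_le _) (by linarith)
  refine h1.trans ?_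
  rw [map_add]
  exact one_add_div_rpow_neg_le (by linarith) hmN (by positivity)

/-- On the ellipsoid around the true parameter the parallelogram law gives ‖Ψ(δ₀ + B x)‖² ≤ 2 (C +
1), and the exponential bound of H then keeps the kernel above exp (-(C + 1)). -/
lemma le_setLIntegral (h : EllipticBounds N n c C Ψ H δ₀) (μ : Measure E) [μ.IsAddHaarMeasure]
    (B : E →ₗ[ℝ] V) {R : Set E} (hR : {x | ‖Ψ (B x)‖ ≤ 1} ⊆ R) :
    ENNReal.ofReal (Real.exp (-(C + 1))) * μ {x | ‖Ψ (B x)‖ ≤ 1}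
      ≤ ∫⁻ x in R, ENNReal.ofReal (H (δ₀ + B x) ^ (-N / 2)) ∂μ := by
  have hm : MeasurableSet {x | ‖Ψ (B x)‖ ≤ 1} :=
    (isClosed_le ((Ψ ∘ₗ B).continuous_of_finiteDimensional.norm) continuous_const).measurableSet
  refine le_trans ?_ (lintegral_mono_set hR)
  rw [← setLIntegral_const]
  refine setLIntegral_mono' hm fun x hx => ENNReal.ofReal_le_ofReal ?_
  have hN := h.N_pos
  have hx' : ‖Ψ (B x)‖ ≤ 1 := hx
  have h1 : ‖Ψ (δ₀ + B x)‖ ^ 2 ≤ 2 * (C + 1) := by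
    have h2 := parallelogram_law_with_norm ℝ (Ψ δ₀) (Ψ (B x))
    have h3 := h.center
    rw [map_add]
    have h4 : ‖Ψ (B x)‖ * ‖Ψ (B x)‖ ≤ 1 := by nlinarith [norm_nonneg (Ψ (B x))]
    nlinarith [mul_self_nonneg ‖Ψ δ₀ - Ψ (B x)‖]
  have h2 : Real.exp (-(C + 1)) ≤ Real.exp (‖Ψ (δ₀ + B x)‖ ^ 2 / N) ^ (-N / 2) := by
    rw [← Real.exp_mul, Real.exp_le_exp]
    have : ‖Ψ (δ₀ + B x)‖ ^ 2 / N * (-N / 2) = -(‖Ψ (δ₀ + B x)‖ ^ 2 / 2) := by field_simp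
    rw [this]
    linarith
  exact h2.trans (Real.rpow_le_rpow_of_nonpos (h.pos _) (h.le_exp _) (by linarith))

end EllipticBounds

lemma measure_closedBall_zero_tendsto [Nontrivial E] (μ : Measure E) [μ.IsAddHaarMeasure] :
    Tendsto (fun r : ℝ => μ (Metric.closedBall 0 r)) (𝓝[>] 0) (𝓝 0) := by
  have h1 : Tendsto (fun r : ℝ => ENNReal.ofReal (r ^ Module.finrank ℝ E)
      * μ (Metric.ball (0 : E) 1)) (𝓝[>] 0) (𝓝 (ENNReal.ofReal (0 ^ Module.finrank ℝ E)
      * μ (Metric.ball (0 : E) 1))) := by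
    refine ENNReal.Tendsto.mul_const ?_ (Or.inr measure_ball_lt_top.ne)
    refine (ENNReal.continuous_ofReal.comp (continuous_pow _)).tendsto' _ _ rfl |>.mono_left
      nhdsWithin_le_nhds
  rw [zero_pow (Module.finrank_pos).ne', ENNReal.ofReal_zero, zero_mul] at h1
  refine h1.congr' ?_
  filter_upwards [self_mem_nhdsWithin] with r hr
  rw [Measure.addHaar_closedBall μ _ (le_of_lt hr)]

/-- Ellipsoids of a small diameter have much smaller volume in the larger subspace. -/
lemma exists_measure_ellipsoid_le_of_range_lt (μ : Measure E) [μ.IsAddHaarMeasure]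
    (ν : Measure F) [ν.IsAddHaarMeasure] {B : E →ₗ[ℝ] V} {B' : F →ₗ[ℝ] V}
    (hB : Function.Injective B) (hB' : Function.Injective B')
    (hlt : LinearMap.range B < LinearMap.range B') {c : ℝ} (hc : 0 < c) (κ : ℝ) :
    ∃ n₀ > 0, ∀ n ≥ n₀, ∀ Ψ : V →ₗ[ℝ] G, (∀ δ, √(c * n) * ‖δ‖ ≤ ‖Ψ δ‖) →
      ENNReal.ofReal κ * ν {x | ‖Ψ (B' x)‖ ≤ 1} ≤ μ {x | ‖Ψ (B x)‖ ≤ 1} := by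
  let e : F ≃ₗ[ℝ] LinearMap.range B' := LinearEquiv.ofInjective B' hB'
  -- The smaller subspace in the coordinates of the larger one, so that `B' ∘ ι = B`.
  let ι : E →ₗ[ℝ] F := e.symm.toLinearMap ∘ₗ
    (LinearMap.codRestrict (LinearMap.range B') B fun x => hlt.le ⟨x, rfl⟩)
  have hι : ∀ x, B' (ι x) = B x := by
    intro x
    have : e (ι x) = ⟨B x, hlt.le ⟨x, rfl⟩⟩ := by simp [ι]; rfl
    exact congrArg Subtype.val this
  have hιinj : Function.Injective ι := by
    intro x y hxy
    apply hB
    rw [← hι, ← hι, hxy]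
  obtain ⟨W, hW⟩ := Submodule.exists_isCompl (LinearMap.range ι)
  have hWne : W ≠ ⊥ := by
    rintro rfl
    have htop : LinearMap.range ι = ⊤ := by simpa using hW.sup_eq_top
    refine hlt.not_ge ?_
    rintro _ ⟨y, rfl⟩
    obtain ⟨x, rfl⟩ : y ∈ LinearMap.range ι := htop ▸ Submodule.mem_top
    exact ⟨x, (hι x).symm⟩
  have hd : 0 < Module.finrank ℝ W := by
    rw [Module.finrank_pos_iff]
    exact Submodule.nontrivial_iff_ne_bot.2 hWne
  have : Nonempty (Fin (Module.finrank ℝ W)) := ⟨⟨0, hd⟩⟩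
  -- A complement W of the smaller subspace supplies the extra coordinates. It is nonzero, so balls
  -- of vanishing radius in it have vanishing volume.
  let T : (E × (Fin (Module.finrank ℝ W) → ℝ)) ≃ₗ[ℝ] F :=
    ((LinearEquiv.ofInjective ι hιinj).prodCongr (Module.finBasis ℝ W).equivFun.symm).trans
      (Submodule.prodEquivOfIsCompl _ _ hW)
  have hT : ∀ x, B' (T (x, 0)) = B x := by
    intro x
    rw [← hι]
    congr 1
    simp [T]
  have hHaar := Measure.prod.instIsAddHaarMeasure μ
    (volume : Measure (Fin (Module.finrank ℝ W) → ℝ))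
  obtain ⟨a, ha0, hat, ha⟩ := T.exists_lintegral_comp_eq
    (μ.prod (volume : Measure (Fin (Module.finrank ℝ W) → ℝ))) ν
  obtain ⟨b, hb, hbT⟩ := (B' ∘ₗ T.toLinearMap).exists_mul_norm_le (hB'.comp T.injective)
  have hlim := measure_closedBall_zero_tendsto
    (volume : Measure (Fin (Module.finrank ℝ W) → ℝ))
  -- The shadow of the ellipsoid in the extra coordinates lies in a ball of this radius, of order
  -- n^(-1/2).
  have hr : Tendsto (fun n : ℝ => 1 / (√(c * n) * b)) atTop (𝓝[>] 0) := by
    refine tendsto_nhdsWithin_iff.2 ⟨?_, ?_⟩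
    · refine Tendsto.div_atTop tendsto_const_nhds (Tendsto.atTop_mul_const hb ?_)
      exact Real.tendsto_sqrt_atTop.comp (tendsto_id.const_mul_atTop hc)
    · filter_upwards [eventually_gt_atTop 0] with n hn
      have : 0 < √(c * n) := Real.sqrt_pos.2 (by positivity)
      change (0 : ℝ) < 1 / (√(c * n) * b)
      positivity
  have hev := (ENNReal.Tendsto.const_mul (a := ENNReal.ofReal κ) (b := 0) (hlim.comp hr)
    (Or.inr (ENNReal.ofReal_ne_top (r := κ))))
  rw [mul_zero] at hev
  have hev2 := hev.eventually_le_const (show (0 : ENNReal) < a from pos_iff_ne_zero.2 ha0)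
  obtain ⟨n₀, hn₀⟩ := eventually_atTop.1 hev2
  refine ⟨max n₀ 1, by positivity, fun n hn Ψ hΨ => ?_⟩
  have hn0 : 0 < n := lt_of_lt_of_le one_pos ((le_max_right _ _).trans hn)
  have hs : 0 < √(c * n) := Real.sqrt_pos.2 (by positivity)
  have h1 := (Ψ ∘ₗ B' ∘ₗ T.toLinearMap).measure_prod_norm_le_one_le μ
    (volume : Measure (Fin (Module.finrank ℝ W) → ℝ)) (c := √(c * n) * b) (by positivity) (by
      intro x y
      have h2 := hbT (x, y)
      have h3 := hΨ (B' (T (x, y)))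
      have h4 : ‖y‖ ≤ ‖(x, y)‖ := le_max_right _ _
      calc √(c * n) * b * ‖y‖ ≤ √(c * n) * (b * ‖(x, y)‖) := by
            rw [mul_assoc]; gcongr
        _ ≤ √(c * n) * ‖B' (T (x, y))‖ := by gcongr; exact h2
        _ ≤ _ := h3)
  simp only [LinearMap.comp_apply, LinearEquiv.coe_coe, hT] at h1
  have hm' : MeasurableSet {x | ‖Ψ (B' x)‖ ≤ 1} :=
    (isClosed_le ((Ψ ∘ₗ B').continuous_of_finiteDimensional.norm) continuous_const).measurableSet
  have h5 : (μ.prod (volume : Measure (Fin (Module.finrank ℝ W) → ℝ)))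
      {z | ‖Ψ (B' (T z))‖ ≤ 1} = a * ν {x | ‖Ψ (B' x)‖ ≤ 1} := by
    rw [← lintegral_indicator_one hm', ← ha, ← lintegral_indicator_one]
    · rfl
    · exact T.toLinearMap.continuous_of_finiteDimensional.measurable hm'
  rw [h5] at h1
  have h6 := hn₀ n ((le_max_left _ _).trans hn)
  have h7 : a * (ENNReal.ofReal κ * ν {x | ‖Ψ (B' x)‖ ≤ 1}) ≤ a * μ {x | ‖Ψ (B x)‖ ≤ 1} := by
    calc a * (ENNReal.ofReal κ * ν {x | ‖Ψ (B' x)‖ ≤ 1})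
        = ENNReal.ofReal κ * (a * ν {x | ‖Ψ (B' x)‖ ≤ 1}) := by ring
      _ ≤ ENNReal.ofReal κ * (μ {x | ‖Ψ (B x)‖ ≤ 1} * volume (Metric.closedBall
          (0 : Fin (Module.finrank ℝ W) → ℝ) (1 / (√(c * n) * b)))) := by gcongr
      _ = (ENNReal.ofReal κ * volume (Metric.closedBall
          (0 : Fin (Module.finrank ℝ W) → ℝ) (1 / (√(c * n) * b)))) * μ {x | ‖Ψ (B x)‖ ≤ 1} := by
        ring
      _ ≤ _ := by gcongr; exact h6
  exact (ENNReal.mul_le_mul_iff_right ha0 hat).1 h7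

lemma measure_ellipsoid_le (μ : Measure E) [μ.IsAddHaarMeasure] {B : E →ₗ[ℝ] V} {b s : ℝ}
    (hb : 0 < b) (hs : 0 < s) (hB : ∀ x, b * ‖x‖ ≤ ‖B x‖) {Ψ : V →ₗ[ℝ] G}
    (hΨ : ∀ δ, s * ‖δ‖ ≤ ‖Ψ δ‖) :
    μ {x | ‖Ψ (B x)‖ ≤ 1}
      ≤ ENNReal.ofReal ((1 / (s * b)) ^ Module.finrank ℝ E) * μ (Metric.ball 0 1) := by
  rw [← Measure.addHaar_closedBall μ 0 (by positivity)]
  refine measure_mono fun x (hx : ‖Ψ (B x)‖ ≤ 1) => ?_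
  rw [mem_closedBall_zero_iff, le_div_iff₀ (by positivity)]
  have h1 := hΨ (B x)
  have h2 : s * (b * ‖x‖) ≤ s * ‖B x‖ := by gcongr; exact hB x
  nlinarith

lemma le_measure_ellipsoid (μ : Measure E) [μ.IsAddHaarMeasure] {B : E →ₗ[ℝ] V} {b s : ℝ}
    (hb : 0 < b) (hs : 0 < s) (hB : ∀ x, ‖B x‖ ≤ b * ‖x‖) {Ψ : V →ₗ[ℝ] G}
    (hΨ : ∀ δ, ‖Ψ δ‖ ≤ s * ‖δ‖) :
    ENNReal.ofReal ((1 / (s * b)) ^ Module.finrank ℝ E) * μ (Metric.ball 0 1)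
      ≤ μ {x | ‖Ψ (B x)‖ ≤ 1} := by
  rw [← Measure.addHaar_closedBall μ 0 (by positivity)]
  refine measure_mono fun x hx => ?_
  rw [mem_closedBall_zero_iff, le_div_iff₀ (by positivity)] at hx
  have h1 := hΨ (B x)
  have h2 : s * ‖B x‖ ≤ s * (b * ‖x‖) := by gcongr; exact hB x
  change ‖Ψ (B x)‖ ≤ 1
  nlinarith

/-- If the precision is of the same order `N` in all directions, then the volumes of ellipsoids in
subspaces are of the order given by the dimension. -/
lemma exists_measure_ellipsoid_le_of_finrank_lt (μ : Measure E) [μ.IsAddHaarMeasure]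
    (ν : Measure F) [ν.IsAddHaarMeasure] {B : E →ₗ[ℝ] V} {B' : F →ₗ[ℝ] V}
    (hB' : Function.Injective B')
    (hlt : Module.finrank ℝ E < Module.finrank ℝ F) {c C : ℝ} (hc : 0 < c) (hC : 0 < C) (κ : ℝ) :
    ∃ N₀ > 0, ∀ N ≥ N₀, ∀ Ψ : V →ₗ[ℝ] G, (∀ δ, √(c * N) * ‖δ‖ ≤ ‖Ψ δ‖) →
      (∀ δ, ‖Ψ δ‖ ≤ √(C * N) * ‖δ‖) →
      ENNReal.ofReal κ * ν {x | ‖Ψ (B' x)‖ ≤ 1} ≤ μ {x | ‖Ψ (B x)‖ ≤ 1} := by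
  obtain ⟨b, hb, hbB⟩ := B.exists_norm_le_mul
  obtain ⟨b', hb', hbB'⟩ := B'.exists_mul_norm_le hB'
  set p := Module.finrank ℝ E with hp
  set q := Module.finrank ℝ F with hq
  set v := (ν (Metric.ball 0 1)).toReal with hv
  have hv' : ν (Metric.ball 0 1) = ENNReal.ofReal v :=
    (ENNReal.ofReal_toReal measure_ball_lt_top.ne).symm
  set u := (μ (Metric.ball 0 1)).toReal with hu
  have hu' : μ (Metric.ball 0 1) = ENNReal.ofReal u :=
    (ENNReal.ofReal_toReal measure_ball_lt_top.ne).symm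
  have hu0 : 0 < u := ENNReal.toReal_pos (Metric.measure_ball_pos _ _ one_pos).ne'
    measure_ball_lt_top.ne
  have hv0 : 0 ≤ v := ENNReal.toReal_nonneg
  set α := (1 / (√c * b')) ^ q with hα
  set β := (1 / (√C * b)) ^ p with hβ
  have hsc : 0 < √c := Real.sqrt_pos.2 hc
  have hsC : 0 < √C := Real.sqrt_pos.2 hC
  have hα0 : 0 < α := by positivity
  have hβ0 : 0 < β := by positivity
  -- The volumes are of the orders N^(-q/2) and N^(-p/2). Since q ≥ p + 1, a factor N^(-1/2) is left
  -- over to absorb κ and the constants.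
  have hlim : Tendsto (fun N : ℝ => |κ| * (α * v) * (1 / √N)) atTop (𝓝 (|κ| * (α * v) * 0)) :=
    (Tendsto.div_atTop tendsto_const_nhds Real.tendsto_sqrt_atTop).const_mul _
  rw [mul_zero] at hlim
  obtain ⟨N₀, hN₀⟩ := eventually_atTop.1 (hlim.eventually_le_const (show 0 < β * u by positivity))
  refine ⟨max N₀ 1, by positivity, fun N hN Ψ h1 h2 => ?_⟩
  have hN1 : 1 ≤ N := (le_max_right _ _).trans hN
  have hN0 : 0 < N := by linarith
  have hsN : 1 ≤ √N := Real.one_le_sqrt.2 hN1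
  have hsN0 : 0 < √N := by linarith
  have h3 := measure_ellipsoid_le ν hb' (Real.sqrt_pos.2 (by positivity)) hbB' h1
  have h4 := le_measure_ellipsoid μ hb (Real.sqrt_pos.2 (by positivity)) hbB h2
  refine (mul_le_mul_right h3 _).trans (le_trans ?_ h4)
  rw [hv', hu', ← hp, ← hq, ← ENNReal.ofReal_mul (p := (1 / (√(c * N) * b')) ^ q) (by positivity),
    ← ENNReal.ofReal_mul (p := (1 / (√(C * N) * b)) ^ p) (by positivity)]
  have h5 : (1 / (√(c * N) * b')) ^ q = α * (1 / √N) ^ q := by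
    rw [hα, ← mul_pow, Real.sqrt_mul hc.le]
    congr 1
    field_simp
  have h6 : (1 / (√(C * N) * b)) ^ p = β * (1 / √N) ^ p := by
    rw [hβ, ← mul_pow, Real.sqrt_mul hC.le]
    congr 1
    field_simp
  refine (mul_le_mul_left (ENNReal.ofReal_le_ofReal (le_abs_self κ)) _).trans ?_
  rw [← ENNReal.ofReal_mul (abs_nonneg _)]
  refine ENNReal.ofReal_le_ofReal ?_
  rw [h5, h6]
  have h7 : (1 / √N) ^ q ≤ (1 / √N) ^ (p + 1) :=
    pow_le_pow_of_le_one (by positivity) (by rw [div_le_one hsN0]; exact hsN) hlt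
  have h8 := hN₀ N ((le_max_left _ _).trans hN)
  calc |κ| * (α * (1 / √N) ^ q * v) ≤ |κ| * (α * (1 / √N) ^ (p + 1) * v) := by gcongr
    _ = (|κ| * (α * v) * (1 / √N)) * (1 / √N) ^ p := by rw [pow_succ]; ring
    _ ≤ (β * u) * (1 / √N) ^ p := by gcongr
    _ = _ := by ring

end Elliptic

end

noncomputable section

/-! ### Mass away from the true parameter -/

section Far

variable {E V G : Type*}
  [NormedAddCommGroup E] [NormedSpace ℝ E] [FiniteDimensional ℝ E] [MeasurableSpace E] [BorelSpace E]
  [NormedAddCommGroup V] [NormedSpace ℝ V] [FiniteDimensional ℝ V] [MeasurableSpace V] [BorelSpace V]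
  [NormedAddCommGroup G] [InnerProductSpace ℝ G]

lemma EllipticBounds.le_lintegral {N n c C : ℝ} {Ψ : V →ₗ[ℝ] G} {H : V → ℝ} {δ₀ : V}
    (h : EllipticBounds N n c C Ψ H δ₀) (ν : Measure V) [ν.IsAddHaarMeasure] :
    ENNReal.ofReal (Real.exp (-(C + 1))) * ν {x | ‖Ψ x‖ ≤ 1}
      ≤ ∫⁻ x, ENNReal.ofReal (H x ^ (-N / 2)) ∂ν := by
  have h1 := h.le_setLIntegral ν LinearMap.id (R := Set.univ) (Set.subset_univ _)
  rw [setLIntegral_univ] at h1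
  simp only [LinearMap.id_apply] at h1
  rwa [lintegral_add_left_eq_self (fun x => ENNReal.ofReal (H x ^ (-N / 2))) δ₀] at h1

/-- The mass of an affine region at distance `η` of the true parameter, relative to the mass of the
whole space. -/
lemma EllipticBounds.exists_setLIntegral_le (μ : Measure E) [μ.IsAddHaarMeasure]
    (ν : Measure V) [ν.IsAddHaarMeasure] (B : E →ₗ[ℝ] V) (hB : Function.Injective B)
    {m c C η : ℝ} (hm1 : 1 ≤ m) (hm : (Module.finrank ℝ E : ℝ) < m) (hc : 0 < c) (hC : 0 < C)
    (hη : 0 < η) :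
    ∃ K ≥ 0, ∃ n₀ : ℝ, ∀ (N n : ℝ) (Ψ : V →ₗ[ℝ] G) (H : V → ℝ) (δ₀ : V),
      EllipticBounds N n c C Ψ H δ₀ → n₀ ≤ n → m ≤ N → ∀ (v : V) (R : Set E), MeasurableSet R →
      (∀ x ∈ R, η ≤ ‖v + B x‖) →
      ∫⁻ x in R, ENNReal.ofReal (H (δ₀ + (v + B x)) ^ (-N / 2)) ∂μ
        ≤ ENNReal.ofReal (K * √N ^ (Module.finrank ℝ E + Module.finrank ℝ V)
            * (1 + c * η ^ 2 / 4 * n / N) ^ (-(N - m) / 2))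
          * ∫⁻ x, ENNReal.ofReal (H x ^ (-N / 2)) ∂ν := by
  obtain ⟨K₁, hK₁, hle⟩ := exists_lintegral_one_add_norm_sq_le (G := G) μ hm1 hm
  obtain ⟨b, hb, hbB⟩ := B.exists_mul_norm_le hB
  have hm0 : 0 < m := by linarith
  set q := Module.finrank ℝ E with hq
  set D := Module.finrank ℝ V with hD
  set u := (μ (Metric.ball 0 1)).toReal with hu
  have hu' : μ (Metric.ball 0 1) = ENNReal.ofReal u :=
    (ENNReal.ofReal_toReal measure_ball_lt_top.ne).symm
  set w := (ν (Metric.ball 0 1)).toReal with hw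
  have hw' : ν (Metric.ball 0 1) = ENNReal.ofReal w :=
    (ENNReal.ofReal_toReal measure_ball_lt_top.ne).symm
  have hw0 : 0 < w := ENNReal.toReal_pos (Metric.measure_ball_pos _ _ one_pos).ne'
    measure_ball_lt_top.ne
  have hu0 : 0 ≤ u := ENNReal.toReal_nonneg
  set k₁ := K₁.toReal with hk₁
  have hk₁' : K₁ = ENNReal.ofReal k₁ := (ENNReal.ofReal_toReal hK₁).symm
  have hk₁0 : 0 ≤ k₁ := ENNReal.toReal_nonneg
  have hsmc : 0 < √(m * c) := Real.sqrt_pos.2 (by positivity)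
  have hsC : 0 < √C := Real.sqrt_pos.2 hC
  set e₁ := Real.exp (-(C + 1)) with he₁
  have he₁0 : 0 < e₁ := Real.exp_pos _
  -- The constant of the upper bound for the region, divided by the constant of the lower bound for
  -- the whole space. The powers of √N from both volumes are kept apart.
  set K := k₁ * (1 / (√(m * c) * b)) ^ q * u / (e₁ * (1 / √C) ^ D * w) with hK
  -- From n ≥ 4C / (cη²) on, the bounded deviation ‖Ψ δ₀‖ is at most half of the deviation √(cn) η
  -- of the region. The bound n ≥ 1 allows √c in place of √(cn).
  refine ⟨K, by positivity, max 1 (4 * C / (c * η ^ 2)), ?_⟩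
  intro N n Ψ H δ₀ h hn hmN v R hR hfar
  have hN := h.N_pos
  have hn1 : 1 ≤ n := (le_max_left _ _).trans hn
  have hn0 : 0 < n := by linarith
  have hsN : 0 < √N := Real.sqrt_pos.2 hN
  have hnC : 4 * C ≤ c * n * η ^ 2 := by
    have := (le_max_right _ _).trans hn
    rw [div_le_iff₀ (by positivity)] at this
    linarith
  set t₀ := 1 + c * η ^ 2 / 4 * n / N with ht₀
  have ht₀0 : 0 < t₀ := by positivity
  -- the sup bound away from the true parameter
  have hsup : ∀ x ∈ R, t₀ ≤ 1 + ‖Ψ (δ₀ + (v + B x))‖ ^ 2 / N := by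
    intro x hx
    have h1 := h.sqrt_mul_norm_le (v + B x)
    have h2 : √(c * n) * η ≤ ‖Ψ (v + B x)‖ := by
      refine le_trans ?_ h1
      gcongr
      exact hfar x hx
    have h3 : ‖Ψ δ₀‖ ≤ √(c * n) * η / 2 := by
      refine abs_le_of_sq_le_sq' ?_ (by positivity) |>.2
      rw [div_pow, mul_pow, Real.sq_sqrt (by positivity)]
      linarith [h.center]
    have h4 : √(c * n) * η / 2 ≤ ‖Ψ (δ₀ + (v + B x))‖ := by
      have h5 : ‖Ψ (v + B x)‖ ≤ ‖Ψ (δ₀ + (v + B x))‖ + ‖Ψ δ₀‖ := by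
        have : Ψ (v + B x) = Ψ (δ₀ + (v + B x)) - Ψ δ₀ := by rw [map_add Ψ δ₀]; abel
        rw [this]
        exact norm_sub_le _ _
      linarith
    have h6 : c * η ^ 2 / 4 * n ≤ ‖Ψ (δ₀ + (v + B x))‖ ^ 2 := by
      calc c * η ^ 2 / 4 * n = (√(c * n) * η / 2) ^ 2 := by
            rw [div_pow, mul_pow, Real.sq_sqrt (by positivity)]; ring
        _ ≤ _ := by gcongr
    rw [ht₀]
    gcongr
  -- With this scaling ‖Ψ'δ‖²/m = ‖Ψδ‖²/N, so the factor with exponent m is a Student kernel of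
  -- fixed degree.
  set Ψ' : V →ₗ[ℝ] G := √(m / N) • Ψ with hΨ'
  have hsmN : 0 < √(m / N) := Real.sqrt_pos.2 (by positivity)
  have hΨ'norm : ∀ δ, ‖Ψ' δ‖ = √(m / N) * ‖Ψ δ‖ := fun δ => by
    rw [hΨ', LinearMap.smul_apply, norm_smul, Real.norm_of_nonneg hsmN.le]
  have hΨ'inj : Function.Injective Ψ' := by
    intro x y hxy
    simp only [hΨ', LinearMap.smul_apply] at hxy
    exact h.injective (smul_right_injective G hsmN.ne' hxy)
  have hΨ'low : ∀ δ, √(m * c) / √N * ‖δ‖ ≤ ‖Ψ' δ‖ := by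
    intro δ
    rw [hΨ'norm]
    have h1 : √c * ‖δ‖ ≤ ‖Ψ δ‖ := by
      refine le_trans ?_ (h.sqrt_mul_norm_le δ)
      gcongr
      nlinarith
    calc √(m * c) / √N * ‖δ‖ = √(m / N) * (√c * ‖δ‖) := by
          rw [Real.sqrt_mul hm0.le, Real.sqrt_div hm0.le]; ring
      _ ≤ _ := by gcongr
  have hpt : ∀ x ∈ R, ENNReal.ofReal (H (δ₀ + (v + B x)) ^ (-N / 2))
      ≤ ENNReal.ofReal (t₀ ^ (-(N - m) / 2))
        * ENNReal.ofReal ((1 + ‖Ψ' (δ₀ + v) + (Ψ' ∘ₗ B) x‖ ^ 2 / m) ^ (-m / 2)) := by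
    intro x hx
    rw [← ENNReal.ofReal_mul (by positivity)]
    refine ENNReal.ofReal_le_ofReal ?_
    have h1 := hsup x hx
    have h2 : H (δ₀ + (v + B x)) ^ (-N / 2) ≤ (1 + ‖Ψ (δ₀ + (v + B x))‖ ^ 2 / N) ^ (-N / 2) :=
      Real.rpow_le_rpow_of_nonpos (by positivity) (h.one_add_le _) (by linarith)
    have h3 : ‖Ψ' (δ₀ + v) + (Ψ' ∘ₗ B) x‖ ^ 2 / m = ‖Ψ (δ₀ + (v + B x))‖ ^ 2 / N := by
      rw [LinearMap.comp_apply, ← map_add, add_assoc, hΨ'norm, mul_pow,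
        Real.sq_sqrt (by positivity)]
      field_simp
    rw [h3]
    refine h2.trans ?_
    -- The first part of the exponent is spent on the supremum bound over the region, the second is
    -- kept for integrability.
    have h4 : -N / 2 = -(N - m) / 2 + -m / 2 := by ring
    rw [h4, Real.rpow_add (by positivity)]
    gcongr ?_ * _
    exact Real.rpow_le_rpow_of_nonpos ht₀0 h1 (by linarith)
  have hupper : ∫⁻ x in R, ENNReal.ofReal (H (δ₀ + (v + B x)) ^ (-N / 2)) ∂μ
      ≤ ENNReal.ofReal (t₀ ^ (-(N - m) / 2) * (k₁ * ((1 / (√(m * c) / √N * b)) ^ q * u))) := by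
    calc _ ≤ ∫⁻ x in R, ENNReal.ofReal (t₀ ^ (-(N - m) / 2))
        * ENNReal.ofReal ((1 + ‖Ψ' (δ₀ + v) + (Ψ' ∘ₗ B) x‖ ^ 2 / m) ^ (-m / 2)) ∂μ :=
          setLIntegral_mono' hR hpt
      _ ≤ ∫⁻ x, ENNReal.ofReal (t₀ ^ (-(N - m) / 2))
        * ENNReal.ofReal ((1 + ‖Ψ' (δ₀ + v) + (Ψ' ∘ₗ B) x‖ ^ 2 / m) ^ (-m / 2)) ∂μ :=
          setLIntegral_le_lintegral _ _
      _ = ENNReal.ofReal (t₀ ^ (-(N - m) / 2)) * ∫⁻ x,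
          ENNReal.ofReal ((1 + ‖Ψ' (δ₀ + v) + (Ψ' ∘ₗ B) x‖ ^ 2 / m) ^ (-m / 2)) ∂μ :=
          lintegral_const_mul' _ _ ENNReal.ofReal_ne_top
      _ ≤ ENNReal.ofReal (t₀ ^ (-(N - m) / 2)) * (K₁ * μ {x | ‖(Ψ' ∘ₗ B) x‖ ≤ 1}) := by
          gcongr
          exact hle (Ψ' ∘ₗ B) (hΨ'inj.comp hB) _
      _ ≤ ENNReal.ofReal (t₀ ^ (-(N - m) / 2)) * (K₁ *
          (ENNReal.ofReal ((1 / (√(m * c) / √N * b)) ^ q) * μ (Metric.ball 0 1))) := by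
          gcongr
          exact measure_ellipsoid_le μ hb (by positivity) hbB hΨ'low
      _ = _ := by
          rw [hk₁', hu', ← ENNReal.ofReal_mul (p := (1 / (√(m * c) / √N * b)) ^ q) (by positivity),
            ← ENNReal.ofReal_mul (p := k₁) (by positivity),
            ← ENNReal.ofReal_mul (p := t₀ ^ (-(N - m) / 2)) (by positivity)]
  -- The whole space has at least the mass near the true parameter, where the ellipsoid contains a
  -- ball of radius 1/√(CN).
  have hlower : ENNReal.ofReal (e₁ * ((1 / (√(C * N) * 1)) ^ D * w))
      ≤ ∫⁻ x, ENNReal.ofReal (H x ^ (-N / 2)) ∂ν := by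
    refine le_trans ?_ (h.le_lintegral ν)
    have h1 := le_measure_ellipsoid ν (B := LinearMap.id) (b := 1) one_pos
      (Real.sqrt_pos.2 (by positivity)) (by simp) h.norm_le_sqrt_mul
    rw [ENNReal.ofReal_mul he₁0.le, ENNReal.ofReal_mul (p := (1 / (√(C * N) * 1)) ^ D)
      (by positivity), ← hw']
    gcongr
    exact h1
  refine hupper.trans (le_trans (le_of_eq ?_) (mul_le_mul_right hlower _))
  rw [← ENNReal.ofReal_mul (by positivity)]
  congr 1
  have h1 : (1 / (√(m * c) / √N * b)) ^ q = (1 / (√(m * c) * b)) ^ q * √N ^ q := by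
    rw [← mul_pow]
    congr 1
    field_simp
  have h2 : (1 / (√(C * N) * 1)) ^ D = (1 / √C) ^ D / √N ^ D := by
    rw [← div_pow, Real.sqrt_mul hC.le]
    congr 1
    field_simp
  rw [h1, h2, hK, pow_add]
  field_simp

end Far

/-- For 0 < x ≤ c one has log (1 + x) ≥ x / (1 + x) ≥ x / (1 + c). With x = c n/N this bounds the
last factor by exp (-c₂ n). The factor √N^p = exp ((p/2) log N) is at most exp (c₂ n/2), because log
N = o(n). -/
lemma tendsto_far_bound {α : Type*} {l : Filter α} {N n : α → ℝ} (hn : Tendsto n l atTop)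
    (hnN : ∀ᶠ a in l, n a ≤ N a) (hlog : Tendsto (fun a => Real.log (N a) / n a) l (𝓝 0))
    {K c m : ℝ} (hK : 0 ≤ K) (hc : 0 < c) (p : ℕ) :
    Tendsto (fun a => K * √(N a) ^ p * (1 + c * n a / N a) ^ (-(N a - m) / 2)) l (𝓝 0) := by
  -- The 4 stems from (N - m)/2 ≥ N/4, which holds once N ≥ 2m.
  set c₂ := c / (4 * (1 + c)) with hc₂
  have hc₂0 : 0 < c₂ := by positivity
  have hlim : Tendsto (fun a => K * Real.exp (-(c₂ / 2 * n a))) l (𝓝 (K * 0)) :=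
    (Real.tendsto_exp_neg_atTop_nhds_zero.comp
      (hn.const_mul_atTop (half_pos hc₂0))).const_mul K
  rw [mul_zero] at hlim
  have hp : Tendsto (fun a => (p : ℝ) / 2 * (Real.log (N a) / n a)) l (𝓝 ((p : ℝ) / 2 * 0)) :=
    hlog.const_mul _
  rw [mul_zero] at hp
  refine tendsto_of_tendsto_of_tendsto_of_le_of_le' tendsto_const_nhds hlim ?_ ?_
  · filter_upwards [hn.eventually_gt_atTop 0, hnN] with a h1 h2
    have : 0 < N a := by linarith
    positivity
  · filter_upwards [hn.eventually_gt_atTop 0, hn.eventually_ge_atTop (2 * m), hnN,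
      hp.eventually_le_const (half_pos hc₂0)] with a h1 h1' h2 h3
    have hN : 0 < N a := by linarith
    have h4 : (p : ℝ) / 2 * Real.log (N a) ≤ c₂ / 2 * n a := by
      rw [← mul_div_assoc, div_le_iff₀ h1] at h3
      exact h3
    have h5 : √(N a) ^ p = Real.exp ((p : ℝ) / 2 * Real.log (N a)) := by
      rw [Real.sqrt_eq_rpow, ← Real.rpow_natCast, ← Real.rpow_mul hN.le,
        Real.rpow_def_of_pos hN]
      congr 1
      ring
    have hx : 0 < c * n a / N a := by positivity
    have hxc : c * n a / N a ≤ c := by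
      rw [div_le_iff₀ hN]
      gcongr
    have h6 : (1 + c * n a / N a) ^ (-(N a - m) / 2) ≤ Real.exp (-(c₂ * n a)) := by
      rw [Real.rpow_def_of_pos (by positivity), Real.exp_le_exp]
      have h7 := Real.one_sub_inv_le_log_of_pos (show 0 < 1 + c * n a / N a by positivity)
      have h8 : c * n a / N a / (1 + c) ≤ 1 - (1 + c * n a / N a)⁻¹ := by
        have : 1 - (1 + c * n a / N a)⁻¹ = c * n a / N a / (1 + c * n a / N a) := by
          field_simp; ring
        rw [this]
        gcongr
      have h9 : N a / 4 ≤ (N a - m) / 2 := by linarith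
      have h10 : c₂ * n a = c * n a / N a / (1 + c) * (N a / 4) := by
        rw [hc₂]; field_simp
      have h11 : c * n a / N a / (1 + c) * (N a / 4)
          ≤ Real.log (1 + c * n a / N a) * ((N a - m) / 2) := by
        refine mul_le_mul (h8.trans h7) h9 (by positivity) ?_
        exact Real.log_nonneg (by linarith)
      rw [h10]
      linarith
    calc K * √(N a) ^ p * (1 + c * n a / N a) ^ (-(N a - m) / 2)
        ≤ K * Real.exp (c₂ / 2 * n a) * Real.exp (-(c₂ * n a)) := by
          rw [h5]
          gcongr
      _ = K * Real.exp (-(c₂ / 2 * n a)) := by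
          rw [mul_assoc, ← Real.exp_add]
          congr 2
          ring

end

noncomputable section

/-! ### Masses of constrained models -/

section Regime

variable {J L P : ℕ} {α G : Type*} [NormedAddCommGroup G] [InnerProductSpace ℝ G]

/-- The mass of the part `R` of the affine space of the model `M` under the kernel `H ^ (-N / 2)`,
where `H` is centered such that the parameter `θ` has the coordinate `δ₀`. -/
def sliceMass (M : ConstrainedModel J L P) (θ δ₀ : Param J L P) (H : Param J L P → ℝ) (N : ℝ)
    (R : Set (Fin M.q → ℝ)) : ENNReal :=
  ∫⁻ ζ in R, ENNReal.ofReal (H (δ₀ + (M.atEq ζ - θ)) ^ (-N / 2))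

/-- The mass of the whole parameter space under the kernel `H ^ (-N / 2)`. -/
def totalMass (H : Param J L P → ℝ) (N : ℝ) : ENNReal :=
  ∫⁻ δ, ENNReal.ofReal (H δ ^ (-N / 2))

/-- An asymptotic regime in which the elliptical bounds hold with fixed constants. -/
structure EllipticRegime (l : Filter α) (N n : α → ℝ) (c C : ℝ)
    (Ψ : α → Param J L P →ₗ[ℝ] G) (H : α → Param J L P → ℝ) (δ₀ : α → Param J L P) : Prop where
  bounds : ∀ᶠ a in l, EllipticBounds (N a) (n a) c C (Ψ a) (H a) (δ₀ a)
  tendsto_n : Tendsto n l atTop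
  tendsto_log : Tendsto (fun a => Real.log (N a) / n a) l (𝓝 0)

lemma ConstrainedModel.atEq_eq_add (M : ConstrainedModel J L P) (ζ : Fin M.q → ℝ) :
    M.atEq ζ = M.atEq 0 + M.freeDir ζ := by
  rw [M.atEq_eq M.RE_θ₀, M.atEq_eq M.RE_θ₀, add_assoc, ← map_add]
  congr 2
  abel

lemma ConstrainedModel.sliceMass_eq (M : ConstrainedModel J L P) (θ δ₀ : Param J L P)
    (H : Param J L P → ℝ) (N : ℝ) (R : Set (Fin M.q → ℝ)) : sliceMass M θ δ₀ H N R
      = ∫⁻ ζ in R, ENNReal.ofReal (H (δ₀ + ((M.atEq 0 - θ) + M.freeDir ζ)) ^ (-N / 2)) := by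
  unfold sliceMass
  refine lintegral_congr fun ζ => ?_
  rw [M.atEq_eq_add ζ, add_sub_right_comm]

lemma ConstrainedModel.exists_ball_subset (M : ConstrainedModel J L P) {θ : Param J L P}
    (hθ : θ ∈ M.space) : ∃ η > 0, ∀ δ, ‖δ‖ < η → M.RE *ᵥ δ = 0 → θ + δ ∈ M.space := by
  have hopen : IsOpen {x : Param J L P | ∀ i, M.rhsO i < (M.RO *ᵥ x) i} := by
    have : {x : Param J L P | ∀ i, M.rhsO i < (M.RO *ᵥ x) i}
        = ⋂ i, {x | M.rhsO i < (M.RO *ᵥ x) i} := by ext; simp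
    rw [this]
    exact isOpen_iInter_of_finite fun i => isOpen_lt continuous_const
      ((continuous_apply i).comp M.RO.mulVecLin.continuous_of_finiteDimensional)
  obtain ⟨η, hη, hball⟩ := Metric.isOpen_iff.1 hopen θ hθ.2
  refine ⟨η, hη, fun δ hδ hE => ⟨?_, hball (by simpa using hδ)⟩⟩
  rw [mulVec_add, hE, add_zero]
  exact hθ.1

lemma ConstrainedModel.rE_add_q (M : ConstrainedModel J L P) :
    M.rE + M.q = Module.finrank ℝ (Param J L P) := by
  rw [M.zeta.finrank_eq]
  simp

lemma ConstrainedModel.range_freeDir_lt_of_eqSpace_ssubset {M M' : ConstrainedModel J L P}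
    {θ : Param J L P} (hθ : θ ∈ M.eqSpace) (h : M.eqSpace ⊂ M'.eqSpace) :
    LinearMap.range M.freeDir < LinearMap.range M'.freeDir := by
  have hθ' := h.1 hθ
  rw [range_freeDir, range_freeDir]
  refine lt_of_le_not_ge (fun δ hδ => ?_) fun hle => h.2 fun x hx => ?_
  · rw [LinearMap.mem_ker, mulVecLin_apply] at hδ ⊢
    have h1 : θ + δ ∈ M'.eqSpace := h.1 (by
      change M.RE *ᵥ (θ + δ) = M.rhsE
      rw [mulVec_add, hδ, add_zero]; exact hθ)
    have h2 : M'.RE *ᵥ (θ + δ) = M'.rhsE := h1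
    rw [mulVec_add, show M'.RE *ᵥ θ = M'.rhsE from hθ'] at h2
    exact add_eq_left.1 h2
  · have h1 : x - θ ∈ LinearMap.ker M'.RE.mulVecLin := by
      rw [LinearMap.mem_ker, mulVecLin_apply, mulVec_sub, show M'.RE *ᵥ θ = M'.rhsE from hθ',
        show M'.RE *ᵥ x = M'.rhsE from hx, sub_self]
    have h2 := hle h1
    rw [LinearMap.mem_ker, mulVecLin_apply, mulVec_sub, sub_eq_zero] at h2
    exact h2.trans hθ

/-- The whole space is written as the range of the identity, so that the comparison of nested
subspaces also covers the unconstrained model. -/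
lemma ConstrainedModel.range_freeDir_lt_top (M : ConstrainedModel J L P) (h : 0 < M.rE) :
    LinearMap.range M.freeDir < LinearMap.range (LinearMap.id : Param J L P →ₗ[ℝ] Param J L P) := by
  rw [LinearMap.range_id, lt_top_iff_ne_top]
  intro htop
  have h1 := LinearMap.finrank_range_of_inj M.freeDir_injective
  rw [htop, finrank_top, ← M.rE_add_q, Module.finrank_fin_fun] at h1
  omega

namespace EllipticRegime

variable {l : Filter α} {N n : α → ℝ} {c C : ℝ} {Ψ : α → Param J L P →ₗ[ℝ] G}
  {H : α → Param J L P → ℝ} {δ₀ : α → Param J L P}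

lemma tendsto_N (h : EllipticRegime l N n c C Ψ H δ₀) : Tendsto N l atTop :=
  tendsto_atTop_mono' l (h.bounds.mono fun _ ha => ha.n_le) h.tendsto_n

/-- A far away region of an affine subspace has negligible mass. -/
lemma eventually_sliceMass_le (h : EllipticRegime l N n c C Ψ H δ₀)
    (M : ConstrainedModel J L P) (θ : Param J L P) {R : Set (Fin M.q → ℝ)} (hR : MeasurableSet R)
    {η : ℝ} (hη : 0 < η) (hfar : ∀ ζ ∈ R, η ≤ ‖M.atEq ζ - θ‖) {ε : ℝ} (hε : 0 < ε) :
    ∀ᶠ a in l, sliceMass M θ (δ₀ a) (H a) (N a) R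
      ≤ ENNReal.ofReal ε * totalMass (H a) (N a) := by
  -- Positivity of c and C is read off at an index where the bounds hold, so the trivial filter is
  -- treated separately.
  rcases l.eq_or_neBot with rfl | hl
  · simp
  obtain ⟨a₀, ha₀⟩ := h.bounds.exists
  have hc := ha₀.c_pos
  -- A Student kernel of exponent m is integrable in dimensions below m.
  set m : ℝ := Module.finrank ℝ (Fin M.q → ℝ) + 1 with hm
  obtain ⟨K, hK, n₀, hle⟩ := EllipticBounds.exists_setLIntegral_le (G := G)
    (volume : Measure (Fin M.q → ℝ)) (volume : Measure (Param J L P)) M.freeDir M.freeDir_injective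
    (m := m) (η := η) (by rw [hm]; exact le_add_of_nonneg_left (Nat.cast_nonneg _)) (by rw [hm]; linarith) hc ha₀.C_pos hη
  have hlim := tendsto_far_bound (m := m) h.tendsto_n (h.bounds.mono fun _ ha => ha.n_le)
    h.tendsto_log hK (show 0 < c * η ^ 2 / 4 by positivity)
    (Module.finrank ℝ (Fin M.q → ℝ) + Module.finrank ℝ (Param J L P))
  filter_upwards [h.bounds, hlim.eventually_le_const hε, h.tendsto_n.eventually_ge_atTop n₀,
    h.tendsto_N.eventually_ge_atTop m] with a h1 h2 h3 h4
  rw [M.sliceMass_eq]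
  refine (hle _ _ _ _ _ h1 h3 h4 (M.atEq 0 - θ) R hR fun ζ hζ => ?_).trans ?_
  · have := hfar ζ hζ
    rwa [M.atEq_eq_add, add_sub_right_comm] at this
  · unfold totalMass
    gcongr

/-- Order constraints are open, so directions of norm below some η preserve a true model. Vectors in
the ellipsoid have norm at most 1/√(cn), which drops below η; the ellipsoid around the true
parameter then lies in the order region. -/
lemma eventually_le_sliceMass (h : EllipticRegime l N n c C Ψ H δ₀) (M : ConstrainedModel J L P)
    {θ : Param J L P} (hθ : θ ∈ M.space) :
    ∀ᶠ a in l, ENNReal.ofReal (Real.exp (-(C + 1))) * volume {ζ | ‖Ψ a (M.freeDir ζ)‖ ≤ 1}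
      ≤ sliceMass M θ (δ₀ a) (H a) (N a) M.ordSet := by
  obtain ⟨η, hη, hball⟩ := M.exists_ball_subset hθ
  rcases l.eq_or_neBot with rfl | hl
  · simp
  obtain ⟨a₀, ha₀⟩ := h.bounds.exists
  have hc := ha₀.c_pos
  filter_upwards [h.bounds, h.tendsto_n.eventually_gt_atTop (1 / (c * η ^ 2))] with a h1 h2
  have hn := h1.n_pos
  -- The order region recentred at the free coordinates `M.D *ᵥ θ` of the true parameter.
  set R : Set (Fin M.q → ℝ) := (fun ζ => ζ + M.D *ᵥ θ) ⁻¹' M.ordSet with hR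
  have hsub : {ζ | ‖Ψ a (M.freeDir ζ)‖ ≤ 1} ⊆ R := by
    intro ζ hζ
    have hζ' : ‖Ψ a (M.freeDir ζ)‖ ≤ 1 := hζ
    rw [hR, Set.mem_preimage, M.mem_ordSet_iff, M.atEq_eq hθ.1, add_sub_cancel_right]
    refine hball _ ?_ (M.RE_mulVec_freeDir ζ)
    have h3 := h1.sqrt_mul_norm_le (M.freeDir ζ)
    have h4 : 1 < √(c * n a) * η := by
      rw [div_lt_iff₀ (by positivity)] at h2
      have h5 : √(c * n a) * η = √(c * n a * η ^ 2) := by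
        rw [Real.sqrt_mul (x := c * n a) (by positivity), Real.sqrt_sq hη.le]
      rw [h5]
      refine Real.lt_sqrt_of_sq_lt ?_
      nlinarith
    have h6 : √(c * n a) * ‖M.freeDir ζ‖ < √(c * n a) * η := by linarith
    exact lt_of_mul_lt_mul_left h6 (Real.sqrt_nonneg _)
  refine (h1.le_setLIntegral volume M.freeDir hsub).trans (le_of_eq ?_)
  unfold sliceMass
  rw [← lintegral_indicator (M.isOpen_ordSet.measurableSet),
    ← lintegral_indicator ((M.isOpen_ordSet.preimage (by fun_prop)).measurableSet),
    ← lintegral_add_right_eq_self (M.ordSet.indicator _) (M.D *ᵥ θ)]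
  refine lintegral_congr fun ζ => ?_
  by_cases hζ : ζ ∈ R
  · have hζ' : ζ + M.D *ᵥ θ ∈ M.ordSet := hζ
    rw [Set.indicator_of_mem hζ, Set.indicator_of_mem hζ', M.atEq_eq hθ.1, add_sub_cancel_right,
      add_sub_cancel_left]
  · have hζ' : ζ + M.D *ᵥ θ ∉ M.ordSet := hζ
    rw [Set.indicator_of_notMem hζ, Set.indicator_of_notMem hζ']

lemma exists_eventually_sliceMass_le (h : EllipticRegime l N n c C Ψ H δ₀)
    (M : ConstrainedModel J L P) (θ : Param J L P) :
    ∃ k : ℝ, ∀ᶠ a in l, sliceMass M θ (δ₀ a) (H a) (N a) Set.univ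
      ≤ ENNReal.ofReal k * volume {ζ | ‖Ψ a (M.freeDir ζ)‖ ≤ 1} := by
  set m : ℝ := Module.finrank ℝ (Fin M.q → ℝ) + 1 with hm
  obtain ⟨K, hK, hle⟩ := EllipticBounds.exists_lintegral_le (G := G)
    (volume : Measure (Fin M.q → ℝ)) M.freeDir M.freeDir_injective
    (m := m) (by rw [hm]; exact le_add_of_nonneg_left (Nat.cast_nonneg _)) (by rw [hm]; linarith)
  refine ⟨K.toReal, ?_⟩
  filter_upwards [h.bounds, h.tendsto_N.eventually_ge_atTop m] with a h1 h2
  rw [ENNReal.ofReal_toReal hK, M.sliceMass_eq, setLIntegral_univ]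
  simp_rw [← add_assoc]
  exact hle _ _ _ _ _ _ _ h2 h1 _

lemma exists_eventually_totalMass_le (h : EllipticRegime l N n c C Ψ H δ₀) :
    ∃ k : ℝ, ∀ᶠ a in l, totalMass (H a) (N a)
      ≤ ENNReal.ofReal k * volume {δ | ‖Ψ a δ‖ ≤ 1} := by
  set m : ℝ := Module.finrank ℝ (Param J L P) + 1 with hm
  obtain ⟨K, hK, hle⟩ := EllipticBounds.exists_lintegral_le (G := G)
    (volume : Measure (Param J L P)) LinearMap.id Function.injective_id
    (m := m) (by rw [hm]; exact le_add_of_nonneg_left (Nat.cast_nonneg _)) (by rw [hm]; linarith)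
  refine ⟨K.toReal, ?_⟩
  filter_upwards [h.bounds, h.tendsto_N.eventually_ge_atTop m] with a h1 h2
  rw [ENNReal.ofReal_toReal hK]
  have := hle _ _ _ _ _ _ _ h2 h1 0
  simpa [totalMass] using this

lemma eventually_totalMass_pos_lt_top (h : EllipticRegime l N n c C Ψ H δ₀) :
    ∀ᶠ a in l, 0 < totalMass (H a) (N a) ∧ totalMass (H a) (N a) < ⊤ := by
  obtain ⟨k, hk⟩ := h.exists_eventually_totalMass_le
  filter_upwards [h.bounds, hk] with a h1 h2
  have h3 := (Ψ a).measure_norm_le_one_pos_lt_top volume h1.injective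
  refine ⟨lt_of_lt_of_le ?_ (h1.le_lintegral volume),
    h2.trans_lt (ENNReal.mul_lt_top ENNReal.ofReal_lt_top h3.2)⟩
  exact ENNReal.mul_pos (ENNReal.ofReal_pos.2 (Real.exp_pos _)).ne' h3.1.ne'

lemma eventually_sliceMass_lt_top (h : EllipticRegime l N n c C Ψ H δ₀)
    (M : ConstrainedModel J L P) (θ : Param J L P) :
    ∀ᶠ a in l, sliceMass M θ (δ₀ a) (H a) (N a) Set.univ < ⊤ := by
  obtain ⟨k, hk⟩ := h.exists_eventually_sliceMass_le M θ
  filter_upwards [h.bounds, hk] with a h1 h2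
  have h3 := ((Ψ a) ∘ₗ M.freeDir).measure_norm_le_one_pos_lt_top volume
    (h1.injective.comp M.freeDir_injective)
  exact h2.trans_lt (ENNReal.mul_lt_top ENNReal.ofReal_lt_top h3.2)

/-- Comparison of masses by means of the volumes of ellipsoids. -/
lemma eventually_mul_le_of_volume {m₁ m₂ v₁ v₂ : α → ENNReal} {k e : ℝ} (he : 0 < e)
    (h₂ : ∀ᶠ a in l, m₂ a ≤ ENNReal.ofReal k * v₂ a)
    (h₁ : ∀ᶠ a in l, ENNReal.ofReal e * v₁ a ≤ m₁ a)
    (hv : ∀ κ : ℝ, ∀ᶠ a in l, ENNReal.ofReal κ * v₂ a ≤ v₁ a) (κ : ℝ) :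
    ∀ᶠ a in l, ENNReal.ofReal κ * m₂ a ≤ m₁ a := by
  -- The constants k and e are absorbed into κ, which is arbitrary. Truncation at zero keeps the
  -- products of real factors compatible with `ENNReal.ofReal`.
  filter_upwards [h₁, h₂, hv (max κ 0 * k / e)] with a h1 h2 h3
  have hκ : ENNReal.ofReal κ ≤ ENNReal.ofReal (max κ 0) := ENNReal.ofReal_le_ofReal (le_max_left _ _)
  have hm : 0 ≤ max κ 0 := le_max_right _ _
  calc ENNReal.ofReal κ * m₂ a ≤ ENNReal.ofReal (max κ 0) * (ENNReal.ofReal k * v₂ a) := by gcongr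
    _ = ENNReal.ofReal e * (ENNReal.ofReal (max κ 0 * k / e) * v₂ a) := by
        rw [← mul_assoc, ← mul_assoc, ← ENNReal.ofReal_mul hm, ← ENNReal.ofReal_mul he.le]
        congr 2
        field_simp
    _ ≤ ENNReal.ofReal e * v₁ a := by gcongr
    _ ≤ m₁ a := h1

lemma eventually_volume_le_of_range_lt (h : EllipticRegime l N n c C Ψ H δ₀) {E F : Type*}
    [NormedAddCommGroup E] [NormedSpace ℝ E] [FiniteDimensional ℝ E] [MeasurableSpace E]
    [BorelSpace E] [NormedAddCommGroup F] [NormedSpace ℝ F] [FiniteDimensional ℝ F]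
    [MeasurableSpace F] [BorelSpace F] (μ : Measure E) [μ.IsAddHaarMeasure] (ν : Measure F)
    [ν.IsAddHaarMeasure] {B : E →ₗ[ℝ] Param J L P} {B' : F →ₗ[ℝ] Param J L P}
    (hB : Function.Injective B) (hB' : Function.Injective B')
    (hlt : LinearMap.range B < LinearMap.range B') (κ : ℝ) :
    ∀ᶠ a in l, ENNReal.ofReal κ * ν {x | ‖Ψ a (B' x)‖ ≤ 1} ≤ μ {x | ‖Ψ a (B x)‖ ≤ 1} := by
  rcases l.eq_or_neBot with rfl | hl
  · simp
  obtain ⟨a₀, ha₀⟩ := h.bounds.exists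
  obtain ⟨n₀, -, hn₀⟩ := exists_measure_ellipsoid_le_of_range_lt (G := G) μ ν hB hB' hlt ha₀.c_pos κ
  filter_upwards [h.bounds, h.tendsto_n.eventually_ge_atTop n₀] with a h1 h2
  exact hn₀ _ h2 _ h1.sqrt_mul_norm_le

lemma eventually_volume_le_of_finrank_lt (h : EllipticRegime l N n c C Ψ H δ₀) {E F : Type*}
    [NormedAddCommGroup E] [NormedSpace ℝ E] [FiniteDimensional ℝ E] [MeasurableSpace E]
    [BorelSpace E] [NormedAddCommGroup F] [NormedSpace ℝ F] [FiniteDimensional ℝ F]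
    [MeasurableSpace F] [BorelSpace F] (μ : Measure E) [μ.IsAddHaarMeasure] (ν : Measure F)
    [ν.IsAddHaarMeasure] {B : E →ₗ[ℝ] Param J L P} {B' : F →ₗ[ℝ] Param J L P}
    (hB' : Function.Injective B') (hlt : Module.finrank ℝ E < Module.finrank ℝ F)
    {c₀ : ℝ} (hc₀ : 0 < c₀) (hn : ∀ᶠ a in l, c₀ * N a ≤ n a) (κ : ℝ) :
    ∀ᶠ a in l, ENNReal.ofReal κ * ν {x | ‖Ψ a (B' x)‖ ≤ 1} ≤ μ {x | ‖Ψ a (B x)‖ ≤ 1} := by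
  rcases l.eq_or_neBot with rfl | hl
  · simp
  obtain ⟨a₀, ha₀⟩ := h.bounds.exists
  have hc := ha₀.c_pos
  obtain ⟨N₀, -, hN₀⟩ := exists_measure_ellipsoid_le_of_finrank_lt (G := G) μ ν (B := B) hB' hlt
    (mul_pos hc hc₀) ha₀.C_pos κ
  filter_upwards [h.bounds, hn, h.tendsto_N.eventually_ge_atTop N₀] with a h1 h2 h3
  refine hN₀ _ h3 _ (fun δ => le_trans ?_ (h1.sqrt_mul_norm_le δ)) h1.norm_le_sqrt_mul
  gcongr ?_ * _
  refine Real.sqrt_le_sqrt ?_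
  rw [mul_assoc]
  gcongr

lemma eventually_mul_totalMass_le (h : EllipticRegime l N n c C Ψ H δ₀)
    (M : ConstrainedModel J L P) {θ : Param J L P} (hθ : θ ∈ M.space) (hM : 0 < M.rE) (κ : ℝ) :
    ∀ᶠ a in l, ENNReal.ofReal κ * totalMass (H a) (N a)
      ≤ sliceMass M θ (δ₀ a) (H a) (N a) M.ordSet := by
  obtain ⟨k, hle⟩ := h.exists_eventually_totalMass_le
  exact eventually_mul_le_of_volume (Real.exp_pos _) hle (h.eventually_le_sliceMass M hθ)
    (h.eventually_volume_le_of_range_lt volume volume M.freeDir_injective Function.injective_id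
      (M.range_freeDir_lt_top hM)) κ

/-- The true model M has a lower bound for its mass, while the upper bound for M' does not need θ to
satisfy M'. For direction spaces that are not nested, volumes are compared by dimension, which
requires the precision to have the same order N in all directions. -/
lemma eventually_mul_sliceMass_le (h : EllipticRegime l N n c C Ψ H δ₀)
    {M M' : ConstrainedModel J L P} {θ : Param J L P} (hθ : θ ∈ M.space)
    (hM : M.eqSpace ⊂ M'.eqSpace ∨
      (M'.rE < M.rE ∧ ∃ c₀ > 0, ∀ᶠ a in l, c₀ * N a ≤ n a)) (κ : ℝ) :
    ∀ᶠ a in l, ENNReal.ofReal κ * sliceMass M' θ (δ₀ a) (H a) (N a) M'.ordSet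
      ≤ sliceMass M θ (δ₀ a) (H a) (N a) M.ordSet := by
  obtain ⟨k, hle⟩ := h.exists_eventually_sliceMass_le M' θ
  refine eventually_mul_le_of_volume (Real.exp_pos _) (v₂ := fun a =>
    volume {ζ | ‖Ψ a (M'.freeDir ζ)‖ ≤ 1}) (hle.mono fun a ha => (lintegral_mono_set
      (Set.subset_univ _)).trans ha) (h.eventually_le_sliceMass M hθ) ?_ κ
  rcases hM with hM | ⟨hr, c₀, hc₀, hn⟩
  · exact h.eventually_volume_le_of_range_lt volume volume M.freeDir_injective
      M'.freeDir_injective (ConstrainedModel.range_freeDir_lt_of_eqSpace_ssubset hθ.1 hM)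
  · refine h.eventually_volume_le_of_finrank_lt volume volume M'.freeDir_injective ?_ hc₀ hn
    have h1 := M.rE_add_q
    have h2 := M'.rE_add_q
    rw [Module.finrank_fin_fun, Module.finrank_fin_fun]
    omega

end EllipticRegime

end Regime

end

noncomputable section

/-! ### Elliptical bounds for matrix `t` kernels -/

section Bounds

variable {J L P : ℕ}

/-- The linear map `Δ ↦ C Δ F` on vectorized coefficient matrices. -/
def sandwich (C : Matrix (Coef J L) (Coef J L) ℝ) (F : Matrix (Fin P) (Fin P) ℝ) :
    Param J L P →ₗ[ℝ] EuclideanSpace ℝ (Coef J L × Fin P) where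
  toFun δ := WithLp.toLp 2 fun x => (C * δ.toMat * F) x.1 x.2
  map_add' x y := by
    ext i
    simp [Param.toMat_add, Matrix.mul_add, Matrix.add_mul]
  map_smul' c x := by
    ext i
    simp [Param.toMat_smul]

lemma norm_sandwich_sq (C : Matrix (Coef J L) (Coef J L) ℝ) (F : Matrix (Fin P) (Fin P) ℝ)
    (δ : Param J L P) :
    ‖sandwich C F δ‖ ^ 2 = (Fᵀ * (δ.toMatᵀ * (Cᵀ * C) * δ.toMat) * F).trace := by
  have h : Fᵀ * (δ.toMatᵀ * (Cᵀ * C) * δ.toMat) * F = (C * δ.toMat * F)ᵀ * (C * δ.toMat * F) := by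
    simp only [transpose_mul, Matrix.mul_assoc]
  rw [h, trace_transpose_mul_self_eq_sum, EuclideanSpace.norm_sq_eq, Fintype.sum_prod_type]
  simp [sandwich]

lemma norm_sq_le_trace (δ : Param J L P) : ‖δ‖ ^ 2 ≤ (δ.toMatᵀ * δ.toMat).trace := by
  rw [trace_transpose_mul_self_eq_sum]
  have h0 : 0 ≤ ∑ a, ∑ p, δ.toMat a p ^ 2 := by positivity
  have : ‖δ‖ ≤ √(∑ a, ∑ p, δ.toMat a p ^ 2) := by
    refine (pi_norm_le_iff_of_nonneg (Real.sqrt_nonneg _)).2 fun x => ?_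
    rw [Real.norm_eq_abs]
    refine Real.abs_le_sqrt ?_
    calc δ x ^ 2 ≤ ∑ p, δ.toMat x.1 p ^ 2 :=
          Finset.single_le_sum (f := fun p => δ.toMat x.1 p ^ 2) (fun _ _ => sq_nonneg _)
            (Finset.mem_univ x.2)
      _ ≤ _ := Finset.single_le_sum (f := fun a => ∑ p, δ.toMat a p ^ 2)
            (fun _ _ => Finset.sum_nonneg fun _ _ => sq_nonneg _) (Finset.mem_univ x.1)
  calc ‖δ‖ ^ 2 ≤ √(∑ a, ∑ p, δ.toMat a p ^ 2) ^ 2 := by gcongr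
    _ = _ := Real.sq_sqrt h0

lemma trace_le_norm_sq (δ : Param J L P) :
    (δ.toMatᵀ * δ.toMat).trace ≤ Fintype.card (Coef J L × Fin P) * ‖δ‖ ^ 2 := by
  rw [trace_transpose_mul_self_eq_sum, ← Fintype.sum_prod_type (f := fun x : Coef J L × Fin P =>
    δ.toMat x.1 x.2 ^ 2), ← nsmul_eq_mul, ← Finset.card_univ]
  refine Finset.sum_le_card_nsmul _ _ _ fun x _ => ?_
  have := norm_le_pi_norm δ x
  rw [Real.norm_eq_abs] at this
  change δ x ^ 2 ≤ ‖δ‖ ^ 2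
  rw [← sq_abs]
  gcongr

/-- With A = C'C and S⁻¹ = FF', take Ψ δ = √N C Δ F. Then ‖Ψδ‖²/N is the trace of F'Δ'AΔF, and det
(1 + F'Δ'AΔF) is the kernel divided by its value at the centre. The lower order comes from `hA₁` and
`hW₁`, the upper one from `hA₂` and `hW₂`. -/
lemma exists_ellipticBounds {A : Matrix (Coef J L) (Coef J L) ℝ} {S : Matrix (Fin P) (Fin P) ℝ}
    (hA : A.PosDef) (hS : S.PosDef) {N n a a' w w' t : ℝ} (hN : 0 < N) (hn : 0 < n) (hnN : n ≤ N)
    (ha : 0 < a) (ha' : 0 < a') (hw : 0 < w) (hw' : 0 < w') (ht : 0 ≤ t)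
    (hA₁ : ∀ x, a * n * (x ⬝ᵥ x) ≤ x ⬝ᵥ (A *ᵥ x)) (hA₂ : ∀ x, x ⬝ᵥ (A *ᵥ x) ≤ a' * N * (x ⬝ᵥ x))
    (hW₁ : ∀ x, w * (x ⬝ᵥ x) ≤ x ⬝ᵥ ((N • S⁻¹) *ᵥ x))
    (hW₂ : ∀ x, x ⬝ᵥ ((N • S⁻¹) *ᵥ x) ≤ w' * (x ⬝ᵥ x))
    {δ₀ : Param J L P} (hδ₀ : (δ₀.toMatᵀ * A * δ₀.toMat).trace ≤ t) :
    ∃ Ψ : Param J L P →ₗ[ℝ] EuclideanSpace ℝ (Coef J L × Fin P),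
      EllipticBounds N n (w * a) (w' * (a' * Fintype.card (Coef J L × Fin P)) + w' * t + 1) Ψ
        (fun δ => detForm A S δ / S.det) δ₀ := by
  obtain ⟨C, hC⟩ := hA.posSemidef.exists_eq_transpose_mul_self
  obtain ⟨R, hR⟩ := hS.inv.posSemidef.exists_eq_transpose_mul_self
  have hF : S⁻¹ = Rᵀ * Rᵀᵀ := by rw [transpose_transpose]; exact hR
  set F := Rᵀ with hFdef
  have hdS := hS.det_pos
  set Q : Param J L P → ℝ := fun δ => (Fᵀ * (δ.toMatᵀ * A * δ.toMat) * F).trace with hQ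
  have hform : ∀ δ : Param J L P, detForm A S δ / S.det
      = (1 + Fᵀ * (δ.toMatᵀ * A * δ.toMat) * F).det := by
    intro δ
    rw [detForm, hS.det_add hF, mul_div_cancel_left₀ _ hdS.ne']
  have hpsd : ∀ δ : Param J L P, (Fᵀ * (δ.toMatᵀ * A * δ.toMat) * F).PosSemidef := fun δ =>
    (hA.posSemidef.transpose_mul_mul_same δ.toMat).transpose_mul_mul_same F
  have hΨ : ∀ δ, ‖(√N • sandwich C F) δ‖ ^ 2 = N * Q δ := by
    intro δ
    rw [LinearMap.smul_apply, norm_smul, mul_pow, norm_sandwich_sq, ← hC,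
      Real.norm_of_nonneg (Real.sqrt_nonneg _), Real.sq_sqrt hN.le]
  have hNQ : ∀ δ, N * Q δ = ((C * δ.toMat) * (N • S⁻¹) * (C * δ.toMat)ᵀ).trace := by
    intro δ
    rw [hQ, hF, Matrix.mul_smul, Matrix.smul_mul, trace_smul, smul_eq_mul]
    congr 1
    have h1 : Fᵀ * (δ.toMatᵀ * A * δ.toMat) * F = (C * δ.toMat * F)ᵀ * (C * δ.toMat * F) := by
      rw [hC]
      simp only [transpose_mul, Matrix.mul_assoc]
    change (Fᵀ * (δ.toMatᵀ * A * δ.toMat) * F).trace = _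
    rw [h1, trace_mul_comm]
    simp only [transpose_mul, Matrix.mul_assoc]
  have hCC : ∀ δ : Param J L P, ((C * δ.toMat) * (C * δ.toMat)ᵀ).trace
      = (δ.toMatᵀ * A * δ.toMat).trace := by
    intro δ
    rw [trace_mul_comm, hC]
    simp only [transpose_mul, Matrix.mul_assoc]
  have htr₁ : ∀ δ : Param J L P, a * n * ‖δ‖ ^ 2 ≤ (δ.toMatᵀ * A * δ.toMat).trace := by
    intro δ
    have h1 := le_trace_mul_mul_transpose hA₁ δ.toMatᵀ
    rw [transpose_transpose] at h1
    refine le_trans ?_ h1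
    gcongr
    exact norm_sq_le_trace δ
  have htr₂ : ∀ δ : Param J L P, (δ.toMatᵀ * A * δ.toMat).trace
      ≤ a' * N * (Fintype.card (Coef J L × Fin P) * ‖δ‖ ^ 2) := by
    intro δ
    have h1 := trace_mul_mul_transpose_le hA₂ δ.toMatᵀ
    rw [transpose_transpose] at h1
    refine h1.trans ?_
    gcongr
    exact trace_le_norm_sq δ
  have hlow : ∀ δ, w * (δ.toMatᵀ * A * δ.toMat).trace ≤ N * Q δ := by
    intro δ
    rw [hNQ, ← hCC]
    exact le_trace_mul_mul_transpose hW₁ _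
  have hup : ∀ δ, N * Q δ ≤ w' * (δ.toMatᵀ * A * δ.toMat).trace := by
    intro δ
    rw [hNQ, ← hCC]
    exact trace_mul_mul_transpose_le hW₂ _
  have hdiv : ∀ δ, ‖(√N • sandwich C F) δ‖ ^ 2 / N = Q δ := fun δ => by
    rw [hΨ, mul_div_cancel_left₀ _ hN.ne']
  have hcard : (0 : ℝ) ≤ Fintype.card (Coef J L × Fin P) := Nat.cast_nonneg _
  -- In the constant C the first term serves the upper bound of Ψ, the second the deviation of δ₀,
  -- and the 1 gives positivity.
  refine ⟨√N • sandwich C F, hN, hn, by positivity, by positivity, hnN, ?_, ?_, ?_, ?_, ?_⟩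
  · intro δ
    rw [hdiv, hform]
    exact (hpsd δ).one_add_trace_le_det
  · intro δ
    rw [hdiv, hform]
    exact (hpsd δ).det_one_add_le_exp_trace
  · intro δ
    rw [hΨ]
    refine le_trans ?_ (hlow δ)
    calc w * a * n * ‖δ‖ ^ 2 = w * (a * n * ‖δ‖ ^ 2) := by ring
      _ ≤ _ := by gcongr; exact htr₁ δ
  · intro δ
    rw [hΨ]
    refine (hup δ).trans ?_
    calc w' * (δ.toMatᵀ * A * δ.toMat).trace
        ≤ w' * (a' * N * (Fintype.card (Coef J L × Fin P) * ‖δ‖ ^ 2)) := by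
          gcongr; exact htr₂ δ
      _ = w' * (a' * Fintype.card (Coef J L × Fin P)) * N * ‖δ‖ ^ 2 := by ring
      _ ≤ _ := by
          gcongr
          have : 0 ≤ w' * t := by positivity
          linarith
  · rw [hΨ]
    refine (hup δ₀).trans ?_
    have h1 : w' * (δ₀.toMatᵀ * A * δ₀.toMat).trace ≤ w' * t := by gcongr
    have h2 : 0 ≤ w' * (a' * Fintype.card (Coef J L × Fin P)) := by positivity
    linarith

lemma Matrix.tendsto_nonsing_inv {ι α : Type*} [Fintype ι] [DecidableEq ι] {l : Filter α}
    {A : α → Matrix ι ι ℝ} {B : Matrix ι ι ℝ} (hB : B.det ≠ 0) (h : Tendsto A l (𝓝 B)) :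
    Tendsto (fun a => (A a)⁻¹) l (𝓝 B⁻¹) := by
  simp only [Matrix.inv_def, Ring.inverse_eq_inv']
  have h1 : Tendsto (fun a => (A a).det) l (𝓝 B.det) :=
    (continuous_id.matrix_det.tendsto B).comp h
  have h2 : Tendsto (fun a => (A a).adjugate) l (𝓝 B.adjugate) :=
    (continuous_id.matrix_adjugate.tendsto B).comp h
  exact (h1.inv₀ hB).smul h2

end Bounds

/-! ### Posterior quantities in terms of masses -/

section Posterior

variable {J L P : ℕ} {A : Matrix (Coef J L) (Coef J L) ℝ} {S : Matrix (Fin P) (Fin P) ℝ}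

/-- The power of `S.det` cancels in all densities and conditional probabilities. Integrability is
not required, since a divergent integral gives zero on both sides. -/
lemma integral_eq_toReal_mul_lintegral {X : Type*} [MeasurableSpace X] (μ : Measure X)
    {φ : X → Param J L P} (hφ : Measurable φ) (hA : A.PosDef) (hS : S.PosDef) (r : ℝ) :
    ∫ x, detForm A S (φ x) ^ r ∂μ
      = S.det ^ r * (∫⁻ x, ENNReal.ofReal ((detForm A S (φ x) / S.det) ^ r) ∂μ).toReal := by
  have hpos : ∀ x, 0 < detForm A S (φ x) / S.det := fun x =>
    div_pos (detForm_pos hA.posSemidef hS _) hS.det_pos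
  have h1 : ∀ x, detForm A S (φ x) ^ r = S.det ^ r * (detForm A S (φ x) / S.det) ^ r := fun x => by
    rw [← Real.mul_rpow hS.det_pos.le (hpos x).le, mul_div_cancel₀ _ hS.det_pos.ne']
  simp_rw [h1]
  rw [integral_const_mul, integral_eq_lintegral_of_nonneg_ae]
  · exact Eventually.of_forall fun x => Real.rpow_nonneg (hpos x).le _
  · exact ((((continuous_detForm A S).measurable.comp hφ).div_const _).pow_const _).aestronglyMeasurable

variable (M : ConstrainedModel J L P) (θ θ' : Param J L P) (N : ℝ)

lemma integral_atEq_eq_sliceMass (hA : A.PosDef) (hS : S.PosDef) (R : Set (Fin M.q → ℝ)) :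
    ∫ ζ in R, detForm A S (M.atEq ζ - θ') ^ (-N / 2) = S.det ^ (-N / 2) *
      (sliceMass M θ (θ - θ') (fun δ => detForm A S δ / S.det) N R).toReal := by
  rw [integral_eq_toReal_mul_lintegral _ (φ := fun ζ => M.atEq ζ - θ')
    (M.continuous_atEq.sub continuous_const).measurable hA hS]
  unfold sliceMass
  have h : ∀ ζ, θ - θ' + (M.atEq ζ - θ) = M.atEq ζ - θ' := fun ζ => by abel
  simp_rw [h]

lemma integral_eq_totalMass (hA : A.PosDef) (hS : S.PosDef) :
    ∫ ϑ, detForm A S (ϑ - θ') ^ (-N / 2) = S.det ^ (-N / 2) *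
      (totalMass (fun δ => detForm A S δ / S.det) N).toReal := by
  rw [integral_eq_toReal_mul_lintegral _ (by fun_prop) hA hS]
  unfold totalMass
  rw [lintegral_sub_right_eq_self (μ := volume)
    (fun ϑ => ENNReal.ofReal ((detForm A S ϑ / S.det) ^ (-N / 2)))]

lemma eqDensity_eq_mass (hA : A.PosDef) (hS : S.PosDef) :
    M.eqDensity (fun ϑ => detForm A S (ϑ - θ') ^ (-N / 2)
        / ∫ ϑ, detForm A S (ϑ - θ') ^ (-N / 2))
      = (sliceMass M θ (θ - θ') (fun δ => detForm A S δ / S.det) N Set.univ).toReal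
        / (totalMass (fun δ => detForm A S δ / S.det) N).toReal / √(M.H * M.Hᵀ).det := by
  have h := integral_atEq_eq_sliceMass M θ θ' N hA hS Set.univ
  rw [setIntegral_univ] at h
  rw [M.eqDensity_div, h, integral_eq_totalMass θ' N hA hS,
    mul_div_mul_left _ _ (Real.rpow_pos_of_pos hS.det_pos _).ne']

lemma ordProb_eq_mass (hA : A.PosDef) (hS : S.PosDef)
    (hT₀ : 0 < totalMass (fun δ => detForm A S δ / S.det) N)
    (hT : totalMass (fun δ => detForm A S δ / S.det) N < ⊤) :
    M.ordProb (fun ϑ => detForm A S (ϑ - θ') ^ (-N / 2)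
        / ∫ ϑ, detForm A S (ϑ - θ') ^ (-N / 2))
      = (sliceMass M θ (θ - θ') (fun δ => detForm A S δ / S.det) N M.ordSet).toReal
        / (sliceMass M θ (θ - θ') (fun δ => detForm A S δ / S.det) N Set.univ).toReal := by
  have hd := Real.rpow_pos_of_pos hS.det_pos (-N / 2)
  have hZ : ∫ ϑ, detForm A S (ϑ - θ') ^ (-N / 2) ≠ 0 := by
    rw [integral_eq_totalMass θ' N hA hS]
    exact (mul_pos hd (ENNReal.toReal_pos hT₀.ne' hT.ne)).ne'
  have h := integral_atEq_eq_sliceMass M θ θ' N hA hS Set.univ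
  rw [setIntegral_univ] at h
  rw [M.ordProb_div _ hZ, h, integral_atEq_eq_sliceMass M θ θ' N hA hS, mul_div_mul_left _ _ hd.ne']

lemma sliceMass_ordSet_pos (δ₀ : Param J L P) {H : Param J L P → ℝ} (hH : Continuous H)
    (hH0 : ∀ δ, 0 < H δ) : 0 < sliceMass M θ δ₀ H N M.ordSet := by
  unfold sliceMass
  rw [pos_iff_ne_zero, Ne, lintegral_eq_zero_iff' (by
    refine Measurable.aemeasurable (ENNReal.measurable_ofReal.comp (Measurable.pow_const ?_ _))
    exact (hH.comp (continuous_const.add (M.continuous_atEq.sub continuous_const))).measurable)]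
  intro h0
  have h1 : ∀ᵐ ζ ∂(volume.restrict M.ordSet), False := by
    filter_upwards [h0] with ζ hζ
    have := ENNReal.ofReal_pos.2 (Real.rpow_pos_of_pos (hH0 (δ₀ + (M.atEq ζ - θ))) (-N / 2))
    exact this.ne' hζ
  rw [eventually_false_iff_eq_bot, ae_eq_bot] at h1
  exact volume_restrict_ordSet_ne_zero M h1

/-- Without equality constraints, the affine space of the model is the whole space. -/
lemma ConstrainedModel.exists_lintegral_atEq_eq (hM : M.rE = 0) :
    ∃ c : ENNReal, c ≠ 0 ∧ c ≠ ⊤ ∧ ∀ f : Param J L P → ENNReal,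
      ∫⁻ ζ, f (M.atEq ζ) = c * ∫⁻ ϑ, f ϑ := by
  have hbij : Function.Bijective M.freeDir := by
    refine ⟨M.freeDir_injective, fun δ => ⟨M.D *ᵥ δ, M.freeDir_D_mulVec ?_⟩⟩
    ext i
    exact (Fin.cast hM i).elim0
  obtain ⟨c, h0, ht, hc⟩ := (LinearEquiv.ofBijective M.freeDir hbij).exists_lintegral_comp_eq
    volume volume
  refine ⟨c, h0, ht, fun f => ?_⟩
  have h1 := hc fun x => f (M.atEq 0 + x)
  rw [lintegral_add_left_eq_self f (M.atEq 0)] at h1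
  rw [← h1]
  refine lintegral_congr fun ζ => ?_
  rw [M.atEq_eq_add ζ]
  rfl

/-- Without equality constraints the free coordinates are an affine change of variables of the whole
space, so the value depends on the model only. Prior and posterior share it, and it cancels in the
Bayes factor. -/
lemma ConstrainedModel.exists_eqDensity_eq (hM : M.rE = 0) :
    ∃ c > 0, ∀ k : Param J L P → ℝ, Measurable k → (∀ ϑ, 0 ≤ k ϑ) → 0 < ∫ ϑ, k ϑ →
      M.eqDensity (fun ϑ => k ϑ / ∫ ϑ, k ϑ) = c := by
  obtain ⟨c, h0, ht, hc⟩ := M.exists_lintegral_atEq_eq hM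
  refine ⟨c.toReal / √(M.H * M.Hᵀ).det,
    div_pos (ENNReal.toReal_pos h0 ht) M.sqrt_det_pos, fun k hk hk0 hpos => ?_⟩
  have h1 : ∫ ζ, k (M.atEq ζ) = c.toReal * ∫ ϑ, k ϑ := by
    rw [integral_eq_lintegral_of_nonneg_ae (Eventually.of_forall fun ζ => hk0 _)
      (hk.comp M.continuous_atEq.measurable).aestronglyMeasurable,
      integral_eq_lintegral_of_nonneg_ae (Eventually.of_forall fun ζ => hk0 _)
      hk.aestronglyMeasurable, hc fun ϑ => ENNReal.ofReal (k ϑ), ENNReal.toReal_mul]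
  rw [M.eqDensity_div, h1, mul_div_cancel_right₀ _ hpos.ne']

end Posterior

end

noncomputable section

/-! ### Asymptotics of the posterior quantities for regular data -/

section RegularData

variable {J L P : ℕ} {α : Type*} {l : Filter α} {nn : α → Fin J → ℕ}
  {X : (a : α) → Matrix (Obs (nn a)) (Coef J L) ℝ} {Y : (a : α) → Matrix (Obs (nn a)) (Fin P) ℝ}
  {n : α → ℝ} {θ : Param J L P} {V : Matrix (Fin P) (Fin P) ℝ}

/-- The properties of the data that determine the large sample behavior of the posterior. -/
structure RegularData (l : Filter α) (X : (a : α) → Matrix (Obs (nn a)) (Coef J L) ℝ)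
    (Y : (a : α) → Matrix (Obs (nn a)) (Fin P) ℝ) (n : α → ℝ) (θ : Param J L P)
    (V : Matrix (Fin P) (Fin P) ℝ) : Prop where
  posDef : V.PosDef
  tendsto_n : Tendsto n l atTop
  n_le : ∀ᶠ a in l, n a ≤ ((∑ j, nn a j : ℕ) : ℝ)
  tendsto_log : Tendsto (fun a => Real.log ((∑ j, nn a j : ℕ) : ℝ) / n a) l (𝓝 0)
  le_gram : ∃ c > 0, ∀ᶠ a in l, ∀ x, c * n a * (x ⬝ᵥ x) ≤ x ⬝ᵥ (((X a)ᵀ * X a) *ᵥ x)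
  gram_le : ∃ c > 0, ∀ᶠ a in l, ∀ x,
    x ⬝ᵥ (((X a)ᵀ * X a) *ᵥ x) ≤ c * ((∑ j, nn a j : ℕ) : ℝ) * (x ⬝ᵥ x)
  tendsto_sumSq : Tendsto (fun a => ((∑ j, nn a j : ℕ) : ℝ)⁻¹ • sumSq (X a) (Y a)) l (𝓝 V)
  center : ∃ t ≥ 0, ∀ᶠ a in l, ((θ.toMat - lsEstimate (X a) (Y a))ᵀ * ((X a)ᵀ * X a)
    * (θ.toMat - lsEstimate (X a) (Y a))).trace ≤ t

namespace RegularData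

lemma isHermitian_gram {ι κ : Type*} [Fintype ι] (X : Matrix ι κ ℝ) : (Xᵀ * X).IsHermitian := by
  simp [IsHermitian]

lemma eventually_n_pos (h : RegularData l X Y n θ V) : ∀ᶠ a in l, 0 < n a :=
  h.tendsto_n.eventually_gt_atTop 0

lemma eventually_posDef_gram (h : RegularData l X Y n θ V) :
    ∀ᶠ a in l, ((X a)ᵀ * X a).PosDef := by
  obtain ⟨c, hc, hle⟩ := h.le_gram
  filter_upwards [hle, h.eventually_n_pos] with a h1 h2
  exact posDef_of_le_dotProduct (isHermitian_gram _) (mul_pos hc h2) h1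

lemma eventually_posDef_sumSq (h : RegularData l X Y n θ V) :
    ∀ᶠ a in l, (sumSq (X a) (Y a)).PosDef := by
  obtain ⟨c, hc, hle⟩ := h.posDef.exists_eventually_le_dotProduct
  filter_upwards [h.tendsto_sumSq.eventually hle, h.eventually_n_pos, h.n_le] with a h1 h2 h3
  have hN : 0 < ((∑ j, nn a j : ℕ) : ℝ) := by linarith
  refine posDef_of_le_dotProduct (isHermitian_gram _) (mul_pos hc hN) fun x => ?_
  have h4 := h1 x
  rw [smul_mulVec, dotProduct_smul, smul_eq_mul, inv_mul_eq_div, le_div_iff₀ hN] at h4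
  linarith

lemma exists_ellipticRegime (h : RegularData l X Y n θ V) :
    ∃ (c C : ℝ) (Ψ : α → Param J L P →ₗ[ℝ] EuclideanSpace ℝ (Coef J L × Fin P)),
      EllipticRegime l (fun a => ((∑ j, nn a j : ℕ) : ℝ)) n c C Ψ
        (fun a δ => detForm ((X a)ᵀ * X a) (sumSq (X a) (Y a)) δ / (sumSq (X a) (Y a)).det)
        (fun a => θ - Param.ofMat (lsEstimate (X a) (Y a))) := by
  rcases l.eq_or_neBot with rfl | hl
  · exact ⟨0, 0, 0, by simp, tendsto_bot, tendsto_bot⟩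
  obtain ⟨a₀, ha₀, hle⟩ := h.le_gram
  obtain ⟨a₁, ha₁, hge⟩ := h.gram_le
  obtain ⟨t, ht, hct⟩ := h.center
  obtain ⟨w, hw, hwle⟩ := h.posDef.inv.exists_eventually_le_dotProduct
  obtain ⟨w', hw', hwge⟩ := exists_eventually_dotProduct_le V⁻¹
  -- Since S/N tends to V, the matrices N S⁻¹ tend to V⁻¹ and have uniformly bounded quadratic
  -- forms.
  have hinv := Matrix.tendsto_nonsing_inv h.posDef.det_pos.ne' h.tendsto_sumSq
  have hev : ∀ᶠ a in l, ∃ Ψ : Param J L P →ₗ[ℝ] EuclideanSpace ℝ (Coef J L × Fin P),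
      EllipticBounds ((∑ j, nn a j : ℕ) : ℝ) (n a) (w * a₀)
        (w' * (a₁ * Fintype.card (Coef J L × Fin P)) + w' * t + 1) Ψ
        (fun δ => detForm ((X a)ᵀ * X a) (sumSq (X a) (Y a)) δ / (sumSq (X a) (Y a)).det)
        (θ - Param.ofMat (lsEstimate (X a) (Y a))) := by
    filter_upwards [hle, hge, hct, hinv.eventually hwle, hinv.eventually hwge, h.eventually_n_pos,
      h.n_le, h.eventually_posDef_gram, h.eventually_posDef_sumSq] with a h1 h2 h3 h4 h5 h6 h7 h8 h9
    have hN : 0 < ((∑ j, nn a j : ℕ) : ℝ) := by linarith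
    have hNinv : ((((∑ j, nn a j : ℕ) : ℝ)⁻¹) • sumSq (X a) (Y a))⁻¹
        = ((∑ j, nn a j : ℕ) : ℝ) • (sumSq (X a) (Y a))⁻¹ := by
      refine Matrix.inv_eq_right_inv ?_
      rw [Matrix.smul_mul, Matrix.mul_smul, smul_smul, inv_mul_cancel₀ hN.ne', one_smul,
        Matrix.mul_nonsing_inv _ h9.det_pos.ne'.isUnit]
    rw [hNinv] at h4 h5
    exact exists_ellipticBounds h8 h9 hN h6 h7 ha₀ ha₁ hw hw' ht h1 h2 h4 h5 h3
  obtain ⟨Ψ, hΨ⟩ := hev.choice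
  exact ⟨_, _, Ψ, hΨ, h.tendsto_n, h.tendsto_log⟩

lemma posterior_eq {a : α} (hX : ((X a)ᵀ * X a).PosDef) :
    _root_.posterior (X a) (Y a) = fun ϑ => detForm ((X a)ᵀ * X a) (sumSq (X a) (Y a))
        (ϑ - Param.ofMat (lsEstimate (X a) (Y a))) ^ (-((∑ j, nn a j : ℕ) : ℝ) / 2)
      / ∫ ϑ, detForm ((X a)ᵀ * X a) (sumSq (X a) (Y a))
        (ϑ - Param.ofMat (lsEstimate (X a) (Y a))) ^ (-((∑ j, nn a j : ℕ) : ℝ) / 2) := by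
  unfold _root_.posterior matrixTDensity
  have h : ∀ N : ℝ, -(N - ((J : ℝ) + L) - P + 1 + (J + L) + P - 1) / 2 = -N / 2 := fun N => by ring
  simp_rw [matrixTKernel_eq, nonsing_inv_nonsing_inv _ hX.det_pos.ne'.isUnit, h]

/-- The mass of the part `R` of the affine space of the model `M` under the posterior kernel. -/
def postSlice (X : (a : α) → Matrix (Obs (nn a)) (Coef J L) ℝ)
    (Y : (a : α) → Matrix (Obs (nn a)) (Fin P) ℝ) (θ : Param J L P) (M : ConstrainedModel J L P)
    (R : Set (Fin M.q → ℝ)) (a : α) : ENNReal :=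
  sliceMass M θ (θ - Param.ofMat (lsEstimate (X a) (Y a)))
    (fun δ => detForm ((X a)ᵀ * X a) (sumSq (X a) (Y a)) δ / (sumSq (X a) (Y a)).det)
    ((∑ j, nn a j : ℕ) : ℝ) R

/-- The mass of the parameter space under the posterior kernel. -/
def postTotal (X : (a : α) → Matrix (Obs (nn a)) (Coef J L) ℝ)
    (Y : (a : α) → Matrix (Obs (nn a)) (Fin P) ℝ) (a : α) : ENNReal :=
  totalMass (fun δ => detForm ((X a)ᵀ * X a) (sumSq (X a) (Y a)) δ / (sumSq (X a) (Y a)).det)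
    ((∑ j, nn a j : ℕ) : ℝ)

lemma eventually_postTotal (h : RegularData l X Y n θ V) :
    ∀ᶠ a in l, 0 < postTotal X Y a ∧ postTotal X Y a < ⊤ := by
  obtain ⟨c, C, Ψ, hr⟩ := h.exists_ellipticRegime
  exact hr.eventually_totalMass_pos_lt_top

lemma eventually_postSlice (h : RegularData l X Y n θ V) (M : ConstrainedModel J L P) :
    ∀ᶠ a in l, 0 < postSlice X Y θ M M.ordSet a ∧
      postSlice X Y θ M M.ordSet a ≤ postSlice X Y θ M Set.univ a ∧
      postSlice X Y θ M Set.univ a < ⊤ := by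
  obtain ⟨c, C, Ψ, hr⟩ := h.exists_ellipticRegime
  filter_upwards [hr.eventually_sliceMass_lt_top M θ, h.eventually_posDef_gram,
    h.eventually_posDef_sumSq] with a h1 h2 h3
  refine ⟨sliceMass_ordSet_pos _ _ _ _ ?_ fun δ => ?_, lintegral_mono_set (Set.subset_univ _), h1⟩
  · exact (continuous_detForm _ _).div_const _
  · exact div_pos (detForm_pos h2.posSemidef h3 _) h3.det_pos

lemma eventually_fitE_eq (h : RegularData l X Y n θ V) (M : ConstrainedModel J L P) :
    ∀ᶠ a in l, fitE M (X a) (Y a) = (postSlice X Y θ M Set.univ a).toReal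
      / (postTotal X Y a).toReal / √(M.H * M.Hᵀ).det := by
  filter_upwards [h.eventually_posDef_gram, h.eventually_posDef_sumSq] with a h1 h2
  rw [fitE, posterior_eq h1]
  exact eqDensity_eq_mass M θ _ _ h1 h2

lemma eventually_fitO_eq (h : RegularData l X Y n θ V) (M : ConstrainedModel J L P) :
    ∀ᶠ a in l, fitO M (X a) (Y a) = (postSlice X Y θ M M.ordSet a).toReal
      / (postSlice X Y θ M Set.univ a).toReal := by
  filter_upwards [h.eventually_posDef_gram, h.eventually_posDef_sumSq,
    h.eventually_postTotal] with a h1 h2 h3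
  rw [fitO, posterior_eq h1]
  exact ordProb_eq_mass M θ _ _ h1 h2 h3.1 h3.2

/-- The mass of the full slice is the numerator of f^E and the denominator of f^O, and cancels. -/
lemma eventually_fit_eq (h : RegularData l X Y n θ V) (M : ConstrainedModel J L P) :
    ∀ᶠ a in l, fitE M (X a) (Y a) * fitO M (X a) (Y a)
      = (postSlice X Y θ M M.ordSet a).toReal / (postTotal X Y a).toReal
        / √(M.H * M.Hᵀ).det := by
  filter_upwards [h.eventually_fitE_eq M, h.eventually_fitO_eq M, h.eventually_postSlice M]
    with a h1 h2 h3
  have h4 : (postSlice X Y θ M Set.univ a).toReal ≠ 0 :=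
    (ENNReal.toReal_pos (h3.1.trans_le h3.2.1).ne' h3.2.2.ne).ne'
  rw [h1, h2]
  field_simp

lemma eventually_fit_pos (h : RegularData l X Y n θ V) (M : ConstrainedModel J L P) :
    ∀ᶠ a in l, 0 < fitE M (X a) (Y a) * fitO M (X a) (Y a) := by
  filter_upwards [h.eventually_fit_eq M, h.eventually_postSlice M, h.eventually_postTotal]
    with a h1 h2 h3
  rw [h1]
  exact div_pos (div_pos (ENNReal.toReal_pos h2.1.ne' (h2.2.1.trans_lt h2.2.2).ne)
    (ENNReal.toReal_pos h3.1.ne' h3.2.ne)) M.sqrt_det_pos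

lemma toReal_mul_le {x y : ENNReal} {κ : ℝ} (hκ : 0 ≤ κ) (hy : y ≠ ⊤)
    (h : ENNReal.ofReal κ * x ≤ y) : κ * x.toReal ≤ y.toReal := by
  have := ENNReal.toReal_mono hy h
  rwa [ENNReal.toReal_mul, ENNReal.toReal_ofReal hκ] at this

lemma tendsto_fit_atTop (h : RegularData l X Y n θ V) (M : ConstrainedModel J L P)
    (hθ : θ ∈ M.space) (hM : 0 < M.rE) :
    Tendsto (fun a => fitE M (X a) (Y a) * fitO M (X a) (Y a)) l atTop := by
  obtain ⟨c, C, Ψ, hr⟩ := h.exists_ellipticRegime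
  refine tendsto_atTop.2 fun κ => ?_
  have hs := M.sqrt_det_pos
  filter_upwards [h.eventually_fit_eq M, h.eventually_postSlice M, h.eventually_postTotal,
    hr.eventually_mul_totalMass_le M hθ hM (max κ 0 * √(M.H * M.Hᵀ).det)] with a h1 h2 h3 h4
  have h5 := toReal_mul_le (mul_nonneg (le_max_right κ 0) hs.le) (h2.2.1.trans_lt h2.2.2).ne h4
  change max κ 0 * √(M.H * M.Hᵀ).det * (postTotal X Y a).toReal
    ≤ (postSlice X Y θ M M.ordSet a).toReal at h5
  have h6 := ENNReal.toReal_pos h3.1.ne' h3.2.ne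
  rw [h1, le_div_iff₀ hs, le_div_iff₀ h6]
  refine le_trans ?_ h5
  gcongr
  exact le_max_left _ _

/-- The total mass cancels in the quotient, which leaves the two slice masses and the Jacobians. -/
lemma tendsto_fit_div_fit_atTop (h : RegularData l X Y n θ V) {M M' : ConstrainedModel J L P}
    (hθ : θ ∈ M.space) (hM : M.eqSpace ⊂ M'.eqSpace ∨ (M'.rE < M.rE ∧ ∃ c₀ > 0,
      ∀ᶠ a in l, c₀ * ((∑ j, nn a j : ℕ) : ℝ) ≤ n a)) :
    Tendsto (fun a => (fitE M (X a) (Y a) * fitO M (X a) (Y a))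
      / (fitE M' (X a) (Y a) * fitO M' (X a) (Y a))) l atTop := by
  obtain ⟨c, C, Ψ, hr⟩ := h.exists_ellipticRegime
  refine tendsto_atTop.2 fun κ => ?_
  have hs := M.sqrt_det_pos
  have hs' := M'.sqrt_det_pos
  set κ' := max κ 0 * √(M.H * M.Hᵀ).det / √(M'.H * M'.Hᵀ).det with hκ'
  filter_upwards [h.eventually_fit_eq M, h.eventually_fit_eq M', h.eventually_fit_pos M',
    h.eventually_postSlice M, h.eventually_postTotal,
    hr.eventually_mul_sliceMass_le hθ hM κ'] with a h1 h1' h1'' h2 h3 h4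
  have h5 := toReal_mul_le (by have := le_max_right κ 0; positivity) (h2.2.1.trans_lt h2.2.2).ne h4
  change κ' * (postSlice X Y θ M' M'.ordSet a).toReal ≤ (postSlice X Y θ M M.ordSet a).toReal at h5
  have h6 := ENNReal.toReal_pos h3.1.ne' h3.2.ne
  rw [le_div_iff₀ h1'']
  refine (mul_le_mul_of_nonneg_right (le_max_left κ 0) h1''.le).trans ?_
  rw [h1, h1', le_div_iff₀ hs, le_div_iff₀ h6]
  refine le_trans (le_of_eq ?_) h5
  rw [hκ']
  field_simp

lemma tendsto_fit_zero (h : RegularData l X Y n θ V) {M : ConstrainedModel J L P}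
    (hθ : θ ∉ closure M.space) :
    Tendsto (fun a => fitE M (X a) (Y a) * fitO M (X a) (Y a)) l (𝓝 0) := by
  obtain ⟨c, C, Ψ, hr⟩ := h.exists_ellipticRegime
  rw [Metric.mem_closure_iff] at hθ
  push Not at hθ
  obtain ⟨η, hη, hfar⟩ := hθ
  have hs := M.sqrt_det_pos
  rw [Metric.tendsto_nhds]
  intro ε hε
  filter_upwards [h.eventually_fit_eq M, h.eventually_fit_pos M, h.eventually_postTotal,
    hr.eventually_sliceMass_le M θ M.isOpen_ordSet.measurableSet hη (fun ζ hζ => by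
      rw [← dist_eq_norm, dist_comm]
      exact hfar _ (M.mem_ordSet_iff.1 hζ))
    (show 0 < ε / 2 * √(M.H * M.Hᵀ).det by positivity)] with a h1 h2 h3 h4
  have h6 := ENNReal.toReal_pos h3.1.ne' h3.2.ne
  rw [Real.dist_eq, sub_zero, abs_of_pos h2, h1]
  have h5 := ENNReal.toReal_mono (ENNReal.mul_lt_top ENNReal.ofReal_lt_top h3.2).ne h4
  rw [ENNReal.toReal_mul, ENNReal.toReal_ofReal (by positivity)] at h5
  rw [div_lt_iff₀ hs, div_lt_iff₀ h6]
  refine lt_of_le_of_lt h5 ?_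
  refine mul_lt_mul_of_pos_right ?_ h6
  gcongr
  linarith

/-- The complement of the order region keeps a positive distance from the true parameter, so its
mass is negligible relative to the total. Without equality constraints the full slice has a fixed
multiple of the total mass. -/
lemma tendsto_fitO_one (h : RegularData l X Y n θ V) {M : ConstrainedModel J L P}
    (hθ : θ ∈ M.space) (hM : M.rE = 0) :
    Tendsto (fun a => fitO M (X a) (Y a)) l (𝓝 1) := by
  obtain ⟨c, C, Ψ, hr⟩ := h.exists_ellipticRegime
  obtain ⟨η, hη, hball⟩ := M.exists_ball_subset hθ
  obtain ⟨c₁, hc0, hct, hc⟩ := M.exists_lintegral_atEq_eq hM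
  have hm := M.isOpen_ordSet.measurableSet
  have hfar : ∀ ζ ∈ M.ordSetᶜ, η ≤ ‖M.atEq ζ - θ‖ := by
    intro ζ hζ
    by_contra hcon
    refine hζ (M.mem_ordSet_iff.2 ?_)
    have := hball (M.atEq ζ - θ) (not_le.1 hcon) (by ext i; exact (Fin.cast hM i).elim0)
    simpa using this
  have hslice : ∀ a, postSlice X Y θ M Set.univ a = c₁ * postTotal X Y a := by
    intro a
    unfold postSlice sliceMass postTotal totalMass
    rw [setLIntegral_univ, hc fun ϑ => ENNReal.ofReal ((fun δ => detForm ((X a)ᵀ * X a)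
      (sumSq (X a) (Y a)) δ / (sumSq (X a) (Y a)).det)
      (θ - Param.ofMat (lsEstimate (X a) (Y a)) + (ϑ - θ)) ^ (-((∑ j, nn a j : ℕ) : ℝ) / 2))]
    have h1 : ∀ ϑ, θ - Param.ofMat (lsEstimate (X a) (Y a)) + (ϑ - θ)
        = ϑ - Param.ofMat (lsEstimate (X a) (Y a)) := fun ϑ => by abel
    simp_rw [h1]
    rw [lintegral_sub_right_eq_self (μ := volume) (fun ϑ => ENNReal.ofReal ((detForm ((X a)ᵀ * X a)
      (sumSq (X a) (Y a)) ϑ / (sumSq (X a) (Y a)).det) ^ (-((∑ j, nn a j : ℕ) : ℝ) / 2)))]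
  have hc1 := ENNReal.toReal_pos hc0 hct
  rw [Metric.tendsto_nhds]
  intro ε hε
  filter_upwards [h.eventually_fitO_eq M, h.eventually_postSlice M, h.eventually_postTotal,
    hr.eventually_sliceMass_le M θ hm.compl hη hfar
      (show 0 < ε / 2 * c₁.toReal by positivity)] with a h1 h2 h3 h4
  have h6 := ENNReal.toReal_pos h3.1.ne' h3.2.ne
  have h5 := ENNReal.toReal_mono (ENNReal.mul_lt_top ENNReal.ofReal_lt_top h3.2).ne h4
  rw [ENNReal.toReal_mul, ENNReal.toReal_ofReal (by positivity)] at h5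
  change (postSlice X Y θ M M.ordSetᶜ a).toReal ≤ ε / 2 * c₁.toReal * (postTotal X Y a).toReal at h5
  have hadd : postSlice X Y θ M Set.univ a
      = postSlice X Y θ M M.ordSet a + postSlice X Y θ M M.ordSetᶜ a := by
    unfold postSlice sliceMass
    rw [setLIntegral_univ]
    exact (lintegral_add_compl _ hm).symm
  have hlt1 := (h2.2.1.trans_lt h2.2.2).ne
  have hlt2 : postSlice X Y θ M M.ordSetᶜ a ≠ ⊤ := by
    refine ne_top_of_le_ne_top h2.2.2.ne ?_
    rw [hadd]
    exact le_add_self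
  have hadd' := congrArg ENNReal.toReal hadd
  rw [ENNReal.toReal_add hlt1 hlt2] at hadd'
  have hu : 0 < (postSlice X Y θ M Set.univ a).toReal :=
    ENNReal.toReal_pos (h2.1.trans_le h2.2.1).ne' h2.2.2.ne
  have hu' : (postSlice X Y θ M Set.univ a).toReal = c₁.toReal * (postTotal X Y a).toReal := by
    rw [hslice, ENNReal.toReal_mul]
  have h7 : fitO M (X a) (Y a) - 1
      = -((postSlice X Y θ M M.ordSetᶜ a).toReal / (postSlice X Y θ M Set.univ a).toReal) := by
    rw [h1, hadd']
    rw [hadd'] at hu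
    field_simp
    ring
  rw [Real.dist_eq, h7, abs_neg, abs_of_nonneg (by positivity), div_lt_iff₀ hu, hu']
  refine lt_of_le_of_lt h5 ?_
  have : 0 < c₁.toReal * (postTotal X Y a).toReal := by positivity
  nlinarith

lemma eventually_fitE_eq_const (h : RegularData l X Y n θ V) {M : ConstrainedModel J L P} {c : ℝ}
    (hc : ∀ k : Param J L P → ℝ, Measurable k → (∀ ϑ, 0 ≤ k ϑ) → 0 < ∫ ϑ, k ϑ →
      M.eqDensity (fun ϑ => k ϑ / ∫ ϑ, k ϑ) = c) :
    ∀ᶠ a in l, fitE M (X a) (Y a) = c := by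
  filter_upwards [h.eventually_posDef_gram, h.eventually_posDef_sumSq,
    h.eventually_postTotal] with a h1 h2 h3
  rw [fitE, posterior_eq h1]
  refine hc _ ?_ (fun ϑ => Real.rpow_nonneg (detForm_pos h1.posSemidef h2 _).le _) ?_
  · exact ((continuous_detForm _ _).measurable.comp (by fun_prop)).pow_const _
  · rw [integral_eq_totalMass _ _ h1 h2]
    exact mul_pos (Real.rpow_pos_of_pos h2.det_pos _) (ENNReal.toReal_pos h3.1.ne' h3.2.ne)

end RegularData

end RegularData

end

noncomputable section

/-! ### Convergence in probability as convergence along a filter -/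

section InProb

variable {Ω : Type*} [MeasurableSpace Ω] {μ : Measure Ω}

/-- The filter of the events whose probability tends to one as the index tends to infinity. -/
def inProb (μ : Measure Ω) : Filter (ℕ × Ω) where
  sets := {s | Tendsto (fun k => μ {ω | (k, ω) ∉ s}) atTop (𝓝 0)}
  univ_sets := by simp
  sets_of_superset {s t} hs hst := tendsto_of_tendsto_of_tendsto_of_le_of_le tendsto_const_nhds hs
    (fun _ => zero_le) fun k => measure_mono fun ω hω h => hω (hst h)
  inter_sets {s t} hs ht := by
    refine tendsto_of_tendsto_of_tendsto_of_le_of_le tendsto_const_nhds (by simpa using hs.add ht)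
      (fun _ => zero_le) fun k => (measure_mono fun ω hω => ?_).trans (measure_union_le _ _)
    by_contra h
    simp only [Set.mem_union, not_or, Set.mem_ofPred_eq, not_not] at h
    exact hω h

lemma mem_inProb {s : Set (ℕ × Ω)} :
    s ∈ inProb μ ↔ Tendsto (fun k => μ {ω | (k, ω) ∉ s}) atTop (𝓝 0) := Iff.rfl

lemma tendsto_fst_inProb : Tendsto Prod.fst (inProb μ) atTop := by
  intro s hs
  rw [mem_map, mem_inProb]
  refine tendsto_const_nhds.congr' ?_
  filter_upwards [hs] with k hk
  simp [hk]

lemma tendstoInMeasure_iff_tendsto_inProb {Z : ℕ → Ω → ℝ} {c : ℝ} :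
    TendstoInMeasure μ Z atTop (fun _ => c)
      ↔ Tendsto (fun p : ℕ × Ω => Z p.1 p.2) (inProb μ) (𝓝 c) := by
  rw [tendstoInMeasure_iff_dist, Metric.tendsto_nhds]
  simp only [Filter.Eventually, mem_inProb, Set.mem_ofPred_eq, not_lt, gt_iff_lt]

lemma tendstoAtTopInProb_iff_tendsto_inProb {Z : ℕ → Ω → ℝ} :
    TendstoAtTopInProb μ Z ↔ Tendsto (fun p : ℕ × Ω => Z p.1 p.2) (inProb μ) atTop := by
  rw [(atTop_basis_Ioi (α := ℝ)).tendsto_right_iff]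
  simp only [TendstoAtTopInProb, Filter.Eventually, mem_inProb, Set.mem_ofPred_eq, Set.mem_Ioi,
    not_lt, forall_const]

/-- Convergence in probability may be checked on the events on which a tight sequence is
bounded. -/
lemma tendsto_inProb_of_tight {β : Type*} {Z : ℕ × Ω → β} {F : Filter β} {τ : ℕ → Ω → ℝ} {C : ℝ}
    (hτ : ∀ t > 0, ∀ k, μ {ω | t < τ k ω} ≤ ENNReal.ofReal (C / t))
    (hZ : ∀ t > 0, Tendsto Z (inProb μ ⊓ 𝓟 {p | τ p.1 p.2 ≤ t}) F) : Tendsto Z (inProb μ) F := by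
  intro s hs
  rw [mem_map, mem_inProb, ENNReal.tendsto_nhds_zero]
  intro ε hε
  have hε2 : 0 < ε / 2 := ENNReal.div_pos hε.ne' (by simp)
  have hlim : Tendsto (fun t : ℝ => ENNReal.ofReal (C / t)) atTop (𝓝 0) := by
    have := ENNReal.tendsto_ofReal (tendsto_const_nhds (x := C) |>.div_atTop tendsto_id)
    simpa using this
  -- Half of ε pays for the event that τ exceeds t, the other half for failure of the claim below t.
  obtain ⟨t, ht, ht0⟩ := ((ENNReal.tendsto_nhds_zero.1 hlim _ hε2).and
    (eventually_gt_atTop 0)).exists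
  have h1 := mem_inf_principal.1 (hZ t ht0 hs)
  rw [mem_inProb, ENNReal.tendsto_nhds_zero] at h1
  filter_upwards [h1 _ hε2] with k hk
  calc μ {ω | (k, ω) ∉ Z ⁻¹' s}
      ≤ μ ({ω | (k, ω) ∉ {p : ℕ × Ω | p ∈ {p : ℕ × Ω | τ p.1 p.2 ≤ t} → p ∈ Z ⁻¹' s}}
          ∪ {ω | t < τ k ω}) := by
        refine measure_mono fun ω hω => ?_
        rcases le_or_gt (τ k ω) t with h | h
        · exact Or.inl fun h' => hω (h' h)
        · exact Or.inr h
    _ ≤ ε / 2 + ε / 2 := (measure_union_le _ _).trans (add_le_add hk ((hτ t ht0 k).trans ht))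
    _ = ε := ENNReal.add_halves ε

end InProb

/-! ### Independence of two families of random variables -/

section Families

variable {Ω : Type*} [MeasurableSpace Ω] {μ : Measure Ω} [IsProbabilityMeasure μ]

/-- If the pairs `(f i, g i)` are independent and the components of each pair are independent,
then the families `f` and `g` are independent. -/
lemma indepFun_families {ι β γ : Type*} [Finite ι] [MeasurableSpace β] [MeasurableSpace γ]
    {f : ι → Ω → β} {g : ι → Ω → γ} (hf : ∀ i, Measurable (f i)) (hg : ∀ i, Measurable (g i))
    (h : iIndepFun (fun i ω => (f i ω, g i ω)) μ) (hfg : ∀ i, IndepFun (f i) (g i) μ) :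
    IndepFun (fun ω i => f i ω) (fun ω i => g i ω) μ := by
  have := Fintype.ofFinite ι
  have hP (i) : IsProbabilityMeasure (μ.map (f i)) := Measure.isProbabilityMeasure_map (hf i).aemeasurable
  have hQ (i) : IsProbabilityMeasure (μ.map (g i)) := Measure.isProbabilityMeasure_map (hg i).aemeasurable
  have h1 : iIndepFun f μ := h.comp (fun _ => Prod.fst) fun _ => measurable_fst
  have h2 : iIndepFun g μ := h.comp (fun _ => Prod.snd) fun _ => measurable_snd
  -- Both sides become product measures: the law of the pairs is a product of products, and
  -- exchanging the order of the factors yields the product of the two family laws.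
  rw [indepFun_iff_map_prod_eq_prod_map_map (measurable_pi_lambda _ hf).aemeasurable
    (measurable_pi_lambda _ hg).aemeasurable, h1.map_fun_eq_pi_map fun i => (hf i).aemeasurable,
    h2.map_fun_eq_pi_map fun i => (hg i).aemeasurable,
    ← (measurePreserving_arrowProdEquivProdArrow β γ ι (fun i => μ.map (f i))
      (fun i => μ.map (g i))).map_eq]
  have h3 := h.map_fun_eq_pi_map fun i => ((hf i).prodMk (hg i)).aemeasurable
  have h4 : (fun i => μ.map (fun ω => (f i ω, g i ω)))
      = fun i => (μ.map (f i)).prod (μ.map (g i)) := funext fun i =>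
    (indepFun_iff_map_prod_eq_prod_map_map (hf i).aemeasurable (hg i).aemeasurable).1 (hfg i)
  rw [h4] at h3
  rw [← h3, Measure.map_map (MeasurableEquiv.measurable _)
    (measurable_pi_lambda _ fun i => (hf i).prodMk (hg i))]
  rfl

end Families

/-! ### The projection onto the column space of the design matrix -/

section Projection

variable {ι κ π : Type*} [Fintype ι] [Fintype κ] [DecidableEq κ]

/-- The projection `X (X'X)⁻¹ X'`; it is zero if `X'X` is singular. -/
def hatMatrix (X : Matrix ι κ ℝ) : Matrix ι ι ℝ := X * (Xᵀ * X)⁻¹ * Xᵀ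

lemma gram_inv_isSymm (X : Matrix ι κ ℝ) : ((Xᵀ * X)⁻¹)ᵀ = (Xᵀ * X)⁻¹ := by
  rw [transpose_nonsing_inv, transpose_mul, transpose_transpose]

lemma hatMatrix_transpose (X : Matrix ι κ ℝ) : (hatMatrix X)ᵀ = hatMatrix X := by
  rw [hatMatrix, transpose_mul, transpose_mul, transpose_transpose, gram_inv_isSymm,
    Matrix.mul_assoc]

/-- If X'X is singular its inverse is 0 by convention and the identity still holds. The hat matrix
is therefore a symmetric idempotent for every outcome. -/
lemma gram_inv_mul_gram_mul_gram_inv (X : Matrix ι κ ℝ) :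
    (Xᵀ * X)⁻¹ * (Xᵀ * X) * (Xᵀ * X)⁻¹ = (Xᵀ * X)⁻¹ := by
  by_cases h : IsUnit (Xᵀ * X).det
  · rw [nonsing_inv_mul _ h, Matrix.one_mul]
  · rw [nonsing_inv_apply_not_isUnit _ h, Matrix.mul_zero]

lemma hatMatrix_mul_self (X : Matrix ι κ ℝ) : hatMatrix X * hatMatrix X = hatMatrix X := by
  calc hatMatrix X * hatMatrix X = X * ((Xᵀ * X)⁻¹ * (Xᵀ * X) * (Xᵀ * X)⁻¹) * Xᵀ := by
        simp only [hatMatrix, Matrix.mul_assoc]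
    _ = hatMatrix X := by rw [gram_inv_mul_gram_mul_gram_inv, hatMatrix]

lemma trace_hatMatrix_le (X : Matrix ι κ ℝ) : (hatMatrix X).trace ≤ Fintype.card κ := by
  rw [hatMatrix, Matrix.mul_assoc, trace_mul_comm, Matrix.mul_assoc]
  by_cases h : IsUnit (Xᵀ * X).det
  · rw [nonsing_inv_mul _ h, trace_one]
  · rw [nonsing_inv_apply_not_isUnit _ h, Matrix.zero_mul, trace_zero]
    positivity

/-- Symmetry and idempotence give Π_ii = ∑_k Π_ik² ≥ Π_ij². The case j = i yields Π_ii ≤ 1. -/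
lemma abs_hatMatrix_apply_le (X : Matrix ι κ ℝ) (i j : ι) : |hatMatrix X i j| ≤ 1 := by
  have hsum (i : ι) : hatMatrix X i i = ∑ k, hatMatrix X i k ^ 2 := by
    conv_lhs => rw [← hatMatrix_mul_self, Matrix.mul_apply]
    refine Finset.sum_congr rfl fun k _ => ?_
    rw [sq, ← congrFun₂ (hatMatrix_transpose X) k i, transpose_apply]
  have h1 (j : ι) : hatMatrix X i j ^ 2 ≤ hatMatrix X i i := by
    rw [hsum]
    exact Finset.single_le_sum (f := fun k => hatMatrix X i k ^ 2) (fun k _ => sq_nonneg _)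
      (Finset.mem_univ j)
  have h2 := h1 i
  have h3 : hatMatrix X i i ≤ 1 := by nlinarith
  exact (sq_le_one_iff_abs_le_one _).1 ((h1 j).trans h3)

lemma lsEstimate_mul_add (X : Matrix ι κ ℝ) (Θ : Matrix κ π ℝ) (E : Matrix ι π ℝ)
    (hX : IsUnit (Xᵀ * X).det) :
    lsEstimate X (X * Θ + E) = Θ + (Xᵀ * X)⁻¹ * Xᵀ * E := by
  rw [lsEstimate, Matrix.mul_add, ← Matrix.mul_assoc, Matrix.mul_assoc _ Xᵀ X,
    nonsing_inv_mul _ hX, Matrix.one_mul]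

/-- The residuals are (1 - Π) E, and 1 - Π is a symmetric idempotent. -/
lemma sumSq_mul_add (X : Matrix ι κ ℝ) (Θ : Matrix κ π ℝ) (E : Matrix ι π ℝ)
    (hX : IsUnit (Xᵀ * X).det) :
    sumSq X (X * Θ + E) = Eᵀ * E - Eᵀ * hatMatrix X * E := by
  have h1 : X * Θ + E - X * lsEstimate X (X * Θ + E) = E - hatMatrix X * E := by
    rw [lsEstimate_mul_add X Θ E hX, Matrix.mul_add, add_sub_add_left_eq_sub, hatMatrix]
    simp only [Matrix.mul_assoc]
  rw [sumSq, h1, transpose_sub, transpose_mul, hatMatrix_transpose, Matrix.sub_mul, Matrix.mul_sub,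
    Matrix.mul_sub, ← Matrix.mul_assoc (Eᵀ * hatMatrix X),
    Matrix.mul_assoc Eᵀ (hatMatrix X) (hatMatrix X), hatMatrix_mul_self, sub_self, sub_zero,
    Matrix.mul_assoc]

/-- The standardized deviation of the true parameter depends on the data only through E'ΠE, the
quantity whose trace is tight. -/
lemma sub_lsEstimate_mul_add (X : Matrix ι κ ℝ) (Θ : Matrix κ π ℝ) (E : Matrix ι π ℝ)
    (hX : IsUnit (Xᵀ * X).det) :
    (Θ - lsEstimate X (X * Θ + E))ᵀ * (Xᵀ * X) * (Θ - lsEstimate X (X * Θ + E))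
      = Eᵀ * hatMatrix X * E := by
  rw [lsEstimate_mul_add X Θ E hX, sub_add_cancel_left, transpose_neg, Matrix.neg_mul,
    Matrix.neg_mul, Matrix.mul_neg, neg_neg, transpose_mul, transpose_mul, transpose_transpose, gram_inv_isSymm]
  calc Eᵀ * (X * (Xᵀ * X)⁻¹) * (Xᵀ * X) * ((Xᵀ * X)⁻¹ * Xᵀ * E)
      = Eᵀ * (X * ((Xᵀ * X)⁻¹ * (Xᵀ * X) * (Xᵀ * X)⁻¹) * Xᵀ) * E := by
        simp only [Matrix.mul_assoc]
    _ = Eᵀ * hatMatrix X * E := by rw [gram_inv_mul_gram_mul_gram_inv, hatMatrix]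

lemma transpose_mul_hatMatrix_mul (X : Matrix ι κ ℝ) (E : Matrix ι π ℝ) :
    Eᵀ * hatMatrix X * E = (hatMatrix X * E)ᵀ * (hatMatrix X * E) := by
  rw [transpose_mul, hatMatrix_transpose, ← Matrix.mul_assoc,
    Matrix.mul_assoc Eᵀ (hatMatrix X) (hatMatrix X), hatMatrix_mul_self]

/-- The entries of a Gram matrix are bounded by its trace. -/
lemma abs_gram_apply_le_trace [Fintype π] (E : Matrix ι π ℝ) (p q : π) :
    |(Eᵀ * E) p q| ≤ (Eᵀ * E).trace := by
  have hdiag (p : π) : (Eᵀ * E) p p = ∑ i, E i p ^ 2 := by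
    simp [Matrix.mul_apply, sq]
  have hnonneg (p : π) : 0 ≤ (Eᵀ * E) p p := by
    rw [hdiag]; positivity
  have hle (p : π) : (Eᵀ * E) p p ≤ (Eᵀ * E).trace :=
    Finset.single_le_sum (f := fun p => (Eᵀ * E) p p) (fun k _ => hnonneg k) (Finset.mem_univ p)
  have h1 : 2 * |(Eᵀ * E) p q| ≤ (Eᵀ * E) p p + (Eᵀ * E) q q := by
    rw [hdiag, hdiag, ← Finset.sum_add_distrib, Matrix.mul_apply]
    calc 2 * |∑ i, Eᵀ p i * E i q| ≤ 2 * ∑ i, |Eᵀ p i * E i q| := by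
          gcongr; exact Finset.abs_sum_le_sum_abs _ _
      _ = ∑ i, 2 * |Eᵀ p i * E i q| := Finset.mul_sum _ _ _
      _ ≤ _ := by
          refine Finset.sum_le_sum fun i _ => ?_
          rw [transpose_apply, abs_mul, ← sq_abs (E i p), ← sq_abs (E i q)]
          nlinarith [sq_nonneg (|E i p| - |E i q|)]
  linarith [hle p, hle q]

end Projection

end

noncomputable section

/-! ### The part of the errors that is explained by the regressors -/

section Tightness

/-- The inverse is discontinuous at singular matrices, but as adjugate times inverse determinant it
is measurable everywhere. -/
lemma measurable_hatMatrix_apply {ι κ : Type*} [Fintype ι] [Fintype κ] [DecidableEq κ] (i j : ι) :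
    Measurable fun X : ι → κ → ℝ => hatMatrix (Matrix.of X) i j := by
  have h1 : Continuous fun X : ι → κ → ℝ => (Matrix.of X)ᵀ * Matrix.of X := by
    refine Continuous.matrix_mul (Continuous.matrix_transpose ?_) ?_ <;> exact continuous_id
  have h2 (a b : κ) : Measurable fun X : ι → κ → ℝ =>
      ((Matrix.of X)ᵀ * Matrix.of X)⁻¹ a b := by
    simp only [Matrix.inv_def, Ring.inverse_eq_inv', Matrix.smul_apply, smul_eq_mul]
    refine (h1.matrix_det.measurable.inv).mul (Continuous.measurable ?_)
    exact h1.matrix_adjugate.matrix_elem a b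
  have h3 : (fun X : ι → κ → ℝ => hatMatrix (Matrix.of X) i j)
      = fun X => ∑ b, (∑ a, X i a * ((Matrix.of X)ᵀ * Matrix.of X)⁻¹ a b) * X j b := by
    ext X
    simp [hatMatrix, Matrix.mul_apply]
  rw [h3]
  refine Finset.measurable_fun_sum _ fun b _ => Measurable.mul
    (Finset.measurable_fun_sum _ fun a _ => Measurable.mul ?_ (h2 a b)) ?_ <;> fun_prop

variable {Ω : Type*} [MeasurableSpace Ω] {μ : Measure Ω} [IsProbabilityMeasure μ]
  {ι κ π : Type*} [Fintype ι] [Fintype κ] [DecidableEq κ] [Fintype π]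
  {x : Ω → ι → κ → ℝ} {ε : Ω → ι → π → ℝ} {v : π → ℝ}

lemma integrable_hatMatrix_mul (hx : Measurable x)
    (hsq : ∀ i p, MemLp (fun ω => ε ω i p) 2 μ) (i j : ι) (p : π) :
    Integrable (fun ω => hatMatrix (Matrix.of (x ω)) i j * (ε ω i p * ε ω j p)) μ := by
  have hm : Measurable fun ω => hatMatrix (Matrix.of (x ω)) i j :=
    (measurable_hatMatrix_apply i j).comp hx
  refine Integrable.bdd_mul (c := 1) ?_ hm.aestronglyMeasurable (ae_of_all _ fun ω => ?_)
  · exact (hsq i p).integrable_mul (hsq j p)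
  · exact abs_hatMatrix_apply_le _ i j

/-- If the errors are uncorrelated with variances `v p` and independent of the regressors, the
expected trace of `E' Π E` is at most `K ∑ v p`. -/
lemma integral_trace_hatMatrix_le (hx : Measurable x) (hε : Measurable ε) (hind : IndepFun x ε μ)
    (hsq : ∀ i p, MemLp (fun ω => ε ω i p) 2 μ)
    (hcov : ∀ i j p, i ≠ j → ∫ ω, ε ω i p * ε ω j p ∂μ = 0)
    (hvar : ∀ i p, ∫ ω, ε ω i p * ε ω i p ∂μ = v p) (hv : ∀ p, 0 ≤ v p) :
    Integrable (fun ω => ((Matrix.of (ε ω))ᵀ * hatMatrix (Matrix.of (x ω))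
        * Matrix.of (ε ω)).trace) μ ∧
      ∫ ω, ((Matrix.of (ε ω))ᵀ * hatMatrix (Matrix.of (x ω)) * Matrix.of (ε ω)).trace ∂μ
        ≤ Fintype.card κ * ∑ p, v p := by
  classical
  have hexp (ω) : ((Matrix.of (ε ω))ᵀ * hatMatrix (Matrix.of (x ω)) * Matrix.of (ε ω)).trace
      = ∑ p, ∑ j, ∑ i, hatMatrix (Matrix.of (x ω)) i j * (ε ω i p * ε ω j p) := by
    simp only [Matrix.trace, Matrix.diag_apply, Matrix.mul_apply, transpose_apply, of_apply,
      Finset.sum_mul]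
    exact Finset.sum_congr rfl fun p _ => Finset.sum_congr rfl fun j _ =>
      Finset.sum_congr rfl fun i _ => by ring
  have hint := integrable_hatMatrix_mul hx hsq
  have hmul (i j : ι) (p : π) :
      ∫ ω, hatMatrix (Matrix.of (x ω)) i j * (ε ω i p * ε ω j p) ∂μ
        = (∫ ω, hatMatrix (Matrix.of (x ω)) i j ∂μ) * ∫ ω, ε ω i p * ε ω j p ∂μ := by
    have h2 : Measurable fun y : ι → π → ℝ => y i p * y j p := by fun_prop
    refine IndepFun.integral_fun_mul_eq_mul_integral
      (hind.comp (measurable_hatMatrix_apply i j) h2) ?_ ?_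
    · exact ((measurable_hatMatrix_apply i j).comp hx).aestronglyMeasurable
    · exact (h2.comp hε).aestronglyMeasurable
  have hdiag (i : ι) : Integrable (fun ω => hatMatrix (Matrix.of (x ω)) i i) μ :=
    Integrable.of_bound ((measurable_hatMatrix_apply i i).comp hx).aestronglyMeasurable 1
      (ae_of_all _ fun ω => abs_hatMatrix_apply_le _ i i)
  simp only [hexp]
  refine ⟨integrable_finsetSum _ fun p _ => integrable_finsetSum _ fun j _ =>
    integrable_finsetSum _ fun i _ => hint i j p, ?_⟩
  rw [integral_finsetSum _ fun p _ => integrable_finsetSum _ fun j _ =>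
    integrable_finsetSum _ fun i _ => hint i j p, Finset.mul_sum]
  refine Finset.sum_le_sum fun p _ => ?_
  rw [integral_finsetSum _ fun j _ => integrable_finsetSum _ fun i _ => hint i j p]
  -- By independence of regressors and errors each term factors. Only i = j survives, since errors
  -- of different observations are uncorrelated, and the expected trace of Π remains.
  have h1 (j : ι) : ∫ ω, ∑ i, hatMatrix (Matrix.of (x ω)) i j * (ε ω i p * ε ω j p) ∂μ
      = (∫ ω, hatMatrix (Matrix.of (x ω)) j j ∂μ) * v p := by
    rw [integral_finsetSum _ fun i _ => hint i j p, Finset.sum_eq_single j, hmul, hvar]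
    · intro i _ hij
      rw [hmul, hcov i j p hij, mul_zero]
    · simp
  simp only [h1]
  rw [← Finset.sum_mul, ← integral_finsetSum _ fun i _ => hdiag i]
  refine mul_le_mul_of_nonneg_right ?_ (hv p)
  calc ∫ ω, ∑ i, hatMatrix (Matrix.of (x ω)) i i ∂μ ≤ ∫ _, (Fintype.card κ : ℝ) ∂μ :=
        integral_mono (integrable_finsetSum _ fun i _ => hdiag i) (integrable_const _) fun ω =>
          trace_hatMatrix_le (Matrix.of (x ω))
    _ = Fintype.card κ := by simp

/-- Markov's inequality; the trace is nonnegative because E'ΠE = (ΠE)'(ΠE). -/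
lemma measure_lt_trace_hatMatrix_le (hx : Measurable x) (hε : Measurable ε)
    (hind : IndepFun x ε μ) (hsq : ∀ i p, MemLp (fun ω => ε ω i p) 2 μ)
    (hcov : ∀ i j p, i ≠ j → ∫ ω, ε ω i p * ε ω j p ∂μ = 0)
    (hvar : ∀ i p, ∫ ω, ε ω i p * ε ω i p ∂μ = v p) (hv : ∀ p, 0 ≤ v p) {t : ℝ} (ht : 0 < t) :
    μ {ω | t < ((Matrix.of (ε ω))ᵀ * hatMatrix (Matrix.of (x ω)) * Matrix.of (ε ω)).trace}
      ≤ ENNReal.ofReal ((Fintype.card κ * ∑ p, v p) / t) := by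
  classical
  obtain ⟨h1, h2⟩ := integral_trace_hatMatrix_le hx hε hind hsq hcov hvar hv
  have h0 (ω) : 0 ≤ ((Matrix.of (ε ω))ᵀ * hatMatrix (Matrix.of (x ω)) * Matrix.of (ε ω)).trace := by
    rw [transpose_mul_hatMatrix_mul]
    exact (posSemidef_transpose_mul_self _).trace_nonneg
  have h3 := mul_meas_ge_le_integral_of_nonneg (ae_of_all μ h0) h1 t
  calc μ {ω | t < ((Matrix.of (ε ω))ᵀ * hatMatrix (Matrix.of (x ω)) * Matrix.of (ε ω)).trace}
      ≤ μ {ω | t ≤ ((Matrix.of (ε ω))ᵀ * hatMatrix (Matrix.of (x ω)) * Matrix.of (ε ω)).trace} :=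
        measure_mono (Set.ofPred_subset_ofPred.2 fun ω hω => hω.le)
    _ ≤ _ := by
        rw [← ofReal_measureReal]
        exact ENNReal.ofReal_le_ofReal ((le_div_iff₀' ht).2 (h3.trans h2))

end Tightness

end

noncomputable section

/-! ### The sampling model -/

section Sampling

variable {J L P : ℕ} {Ω : Type*} [MeasurableSpace Ω]

/-- The `i`-th observation of group `j` has predictors `w j i` and errors `e j i`; the pairs are
independent, predictors and errors are independent, the predictors are identically distributed
within groups with finite second moments, and the errors are normal with covariance matrix `V`. -/
structure SamplingModel (μ : Measure Ω) (w : Fin J → ℕ → Ω → Fin L → ℝ)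
    (e : Fin J → ℕ → Ω → EuclideanSpace ℝ (Fin P)) (V : Matrix (Fin P) (Fin P) ℝ) : Prop where
  measurable_w : ∀ j i, Measurable (w j i)
  measurable_e : ∀ j i, Measurable (e j i)
  iIndepFun_pairs : iIndepFun (fun (a : Fin J × ℕ) ω => (w a.1 a.2 ω, e a.1 a.2 ω)) μ
  indepFun_w_e : ∀ j i, IndepFun (w j i) (e j i) μ
  identDistrib_w : ∀ j i, IdentDistrib (w j i) (w j 0) μ μ
  memLp_w : ∀ j l, MemLp (fun ω => w j 0 ω l) 2 μ
  posDef : V.PosDef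
  hasLaw_e : ∀ j i, HasLaw (e j i) (multivariateGaussian 0 V) μ

namespace SamplingModel

variable {μ : Measure Ω} [IsProbabilityMeasure μ] {w : Fin J → ℕ → Ω → Fin L → ℝ}
  {e : Fin J → ℕ → Ω → EuclideanSpace ℝ (Fin P)} {V : Matrix (Fin P) (Fin P) ℝ}

lemma measurable_e_apply (h : SamplingModel μ w e V) (j i p) :
    Measurable fun ω => e j i ω p := by
  have := h.measurable_e j i
  fun_prop

lemma memLp_e (h : SamplingModel μ w e V) (j i p) : MemLp (fun ω => e j i ω p) 2 μ := by
  have h1 : MemLp (fun x : EuclideanSpace ℝ (Fin P) => x p) 2 (multivariateGaussian 0 V) :=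
    (EuclideanSpace.proj (𝕜 := ℝ) p).comp_memLp' IsGaussian.memLp_two_id
  rw [← (h.hasLaw_e j i).map_eq] at h1
  exact h1.comp_of_map (h.measurable_e j i).aemeasurable

lemma integral_e (h : SamplingModel μ w e V) (j i p) : ∫ ω, e j i ω p ∂μ = 0 := by
  have h1 : ∫ x : EuclideanSpace ℝ (Fin P), x p ∂(multivariateGaussian 0 V) = 0 := by
    have := (EuclideanSpace.proj (𝕜 := ℝ) p).integral_comp_comm
      (IsGaussian.integrable_id (μ := multivariateGaussian (0 : EuclideanSpace ℝ (Fin P)) V))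
    simpa using this
  rw [← (h.hasLaw_e j i).map_eq, integral_map (h.measurable_e j i).aemeasurable
    (by fun_prop)] at h1
  exact h1

lemma integral_e_mul (h : SamplingModel μ w e V) (j i p q) :
    ∫ ω, e j i ω p * e j i ω q ∂μ = V p q := by
  have h1 := covariance_eval_multivariateGaussian (μ := (0 : EuclideanSpace ℝ (Fin P)))
    h.posDef.posSemidef p q
  rw [← (h.hasLaw_e j i).map_eq, covariance_map (by fun_prop) (by fun_prop)
    (h.measurable_e j i).aemeasurable, covariance_eq_sub] at h1
  · simp only [Function.comp_def, Pi.mul_apply, h.integral_e, mul_zero, sub_zero] at h1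
    exact h1
  · exact h.memLp_e j i p
  · exact h.memLp_e j i q

lemma integral_e_mul_of_ne (h : SamplingModel μ w e V) {a b : Fin J × ℕ} (hab : a ≠ b) (p q) :
    ∫ ω, e a.1 a.2 ω p * e b.1 b.2 ω q ∂μ = 0 := by
  have h1 : IndepFun (fun ω => e a.1 a.2 ω p) (fun ω => e b.1 b.2 ω q) μ :=
    (h.iIndepFun_pairs.indepFun hab).comp
      (φ := fun y : (Fin L → ℝ) × EuclideanSpace ℝ (Fin P) => y.2 p)
      (ψ := fun y : (Fin L → ℝ) × EuclideanSpace ℝ (Fin P) => y.2 q) (by fun_prop) (by fun_prop)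
  rw [h1.integral_fun_mul_eq_mul_integral (h.measurable_e_apply _ _ _).aestronglyMeasurable
    (h.measurable_e_apply _ _ _).aestronglyMeasurable, h.integral_e, zero_mul]

lemma measurable_designRow (j : Fin J) (a : Coef J L) :
    Measurable fun w : Fin L → ℝ => designRow j w a := by
  rcases a with a | a <;> simp only [designRow, Sum.elim_inl, Sum.elim_inr] <;> fun_prop

lemma memLp_designRow (h : SamplingModel μ w e V) (j a) :
    MemLp (fun ω => designRow j (w j 0 ω) a) 2 μ := by
  rcases a with a | a
  · exact memLp_const _
  · exact h.memLp_w j a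

lemma integral_designRow_mul_e (h : SamplingModel μ w e V) (j a p) :
    ∫ ω, designRow j (w j 0 ω) a * e j 0 ω p ∂μ = 0 := by
  have h1 : IndepFun (fun ω => designRow j (w j 0 ω) a) (fun ω => e j 0 ω p) μ :=
    (h.indepFun_w_e j 0).comp (φ := fun y => designRow j y a)
      (ψ := fun y : EuclideanSpace ℝ (Fin P) => y p) (measurable_designRow j a) (by fun_prop)
  rw [h1.integral_fun_mul_eq_mul_integral (h.memLp_designRow j a).aestronglyMeasurable
    (h.measurable_e_apply _ _ _).aestronglyMeasurable, h.integral_e, mul_zero]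

/-- The weak law of large numbers within a group. -/
lemma tendsto_groupMean (h : SamplingModel μ w e V) {n : ℕ → Fin J → ℕ} (j : Fin J)
    (hn : Tendsto (fun k => n k j) atTop atTop)
    {φ : (Fin L → ℝ) × EuclideanSpace ℝ (Fin P) → ℝ} (hφ : Measurable φ)
    (hint : Integrable (fun ω => φ (w j 0 ω, e j 0 ω)) μ) :
    Tendsto (fun a : ℕ × Ω => (∑ i : Fin (n a.1 j), φ (w j i a.2, e j i a.2)) / (n a.1 j : ℝ))
      (inProb μ) (𝓝 (∫ ω, φ (w j 0 ω, e j 0 ω) ∂μ)) := by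
  have hm (i) : Measurable fun ω => φ (w j i ω, e j i ω) :=
    hφ.comp ((h.measurable_w j i).prodMk (h.measurable_e j i))
  have hindep : Pairwise fun i i' => IndepFun (fun ω => φ (w j i ω, e j i ω))
      (fun ω => φ (w j i' ω, e j i' ω)) μ := fun i i' hi =>
    (h.iIndepFun_pairs.indepFun (i := (j, i)) (j := (j, i')) (by simpa using hi)).comp hφ hφ
  have hident (i) : IdentDistrib (fun ω => φ (w j i ω, e j i ω))
      (fun ω => φ (w j 0 ω, e j 0 ω)) μ μ := by
    have h2 : IdentDistrib (e j i) (e j 0) μ μ :=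
      ⟨(h.measurable_e j i).aemeasurable, (h.measurable_e j 0).aemeasurable,
        by rw [(h.hasLaw_e j i).map_eq, (h.hasLaw_e j 0).map_eq]⟩
    exact ((h.identDistrib_w j i).prodMk h2 (h.indepFun_w_e j i) (h.indepFun_w_e j 0)).comp hφ
  -- Almost sure convergence along all sample sizes passes to the sizes `n k j`, and then to
  -- convergence in measure.
  have h1 := strong_law_ae_real (fun i ω => φ (w j i ω, e j i ω)) hint hindep hident
  have hmeas (k) : AEStronglyMeasurable
      (fun ω => (∑ i : Fin (n k j), φ (w j i ω, e j i ω)) / (n k j : ℝ)) μ :=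
    ((Finset.measurable_fun_sum Finset.univ fun (i : Fin (n k j)) _ => hm i).div_const
      _).aestronglyMeasurable
  have hlim : ∀ᵐ ω ∂μ, Tendsto (fun k => (∑ i : Fin (n k j), φ (w j i ω, e j i ω)) / (n k j : ℝ))
      atTop (𝓝 (∫ ω, φ (w j 0 ω, e j 0 ω) ∂μ)) := by
    filter_upwards [h1] with ω hω
    refine (hω.comp hn).congr fun k => ?_
    simp only [Function.comp_apply]
    rw [Fin.sum_univ_eq_sum_range (fun i => φ (w j i ω, e j i ω))]
  have h2 := tendstoInMeasure_of_tendsto_ae hmeas hlim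
  exact (tendstoInMeasure_iff_tendsto_inProb (μ := μ)
    (Z := fun k ω => (∑ i : Fin (n k j), φ (w j i ω, e j i ω)) / (n k j : ℝ))
    (c := ∫ ω, φ (w j 0 ω, e j 0 ω) ∂μ)).1 h2

/-- The matrix of the errors. -/
def errorMatrix (n : Fin J → ℕ) (e : Fin J → ℕ → EuclideanSpace ℝ (Fin P)) :
    Matrix (Obs n) (Fin P) ℝ := Matrix.of fun o p => e o.1 o.2 p

/-- The part of the total sum of squares of the errors that is explained by the regressors. -/
def explained (n : Fin J → ℕ) (w : Fin J → ℕ → Fin L → ℝ)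
    (e : Fin J → ℕ → EuclideanSpace ℝ (Fin P)) : ℝ :=
  ((errorMatrix n e)ᵀ * hatMatrix (designMatrix n w) * errorMatrix n e).trace

/-- The bound K tr V / t is the same for all group sizes, which is the tightness needed by
`tendsto_inProb_of_tight`. -/
lemma measure_lt_explained_le (h : SamplingModel μ w e V) (n : Fin J → ℕ) {t : ℝ} (ht : 0 < t) :
    μ {ω | t < explained n (fun j i => w j i ω) (fun j i => e j i ω)}
      ≤ ENNReal.ofReal ((Fintype.card (Coef J L) * ∑ p, V p p) / t) := by
  let g : Obs n → Fin J × ℕ := fun o => (o.1, o.2)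
  have hg : Function.Injective g := by
    rintro ⟨j, i⟩ ⟨j', i'⟩ hij
    simp only [g, Prod.mk.injEq] at hij
    obtain ⟨rfl, hij⟩ := hij
    rw [Fin.ext hij]
  have hind := indepFun_families (fun o : Obs n => h.measurable_w o.1 o.2)
    (fun o : Obs n => h.measurable_e o.1 o.2) (h.iIndepFun_pairs.precomp hg)
    fun o => h.indepFun_w_e o.1 o.2
  have hx : Measurable fun (y : Obs n → Fin L → ℝ) o => designRow o.1 (y o) :=
    measurable_pi_lambda _ fun o => measurable_pi_lambda _ fun a =>
      (measurable_designRow o.1 a).comp (measurable_pi_apply o)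
  have hε : Measurable fun (y : Obs n → EuclideanSpace ℝ (Fin P)) o p => y o p := by fun_prop
  have hx' : Measurable fun ω (o : Obs n) => designRow o.1 (w o.1 o.2 ω) :=
    hx.comp (measurable_pi_lambda _ fun o : Obs n => h.measurable_w o.1 o.2)
  have hε' : Measurable fun ω (o : Obs n) p => e o.1 o.2 ω p :=
    hε.comp (measurable_pi_lambda _ fun o : Obs n => h.measurable_e o.1 o.2)
  have hind' : IndepFun (fun ω (o : Obs n) => designRow o.1 (w o.1 o.2 ω))
      (fun ω (o : Obs n) p => e o.1 o.2 ω p) μ := hind.comp hx hε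
  have hcov (o o' : Obs n) (p : Fin P) (ho : o ≠ o') :
      ∫ ω, e o.1 o.2 ω p * e o'.1 o'.2 ω p ∂μ = 0 :=
    h.integral_e_mul_of_ne (a := (o.1, o.2)) (b := (o'.1, o'.2)) (hg.ne ho) p p
  have h1 := measure_lt_trace_hatMatrix_le (v := fun p => V p p) hx' hε' hind'
    (fun o p => h.memLp_e o.1 o.2 p) hcov
    (fun o p => h.integral_e_mul o.1 o.2 p p) (fun p => h.posDef.posSemidef.diag_nonneg) ht
  exact h1

end SamplingModel

end Sampling

end

noncomputable section

/-! ### Cross products of the data -/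

section CrossProducts

lemma Matrix.tendsto_of_apply {α m n : Type*} {l : Filter α} {A : α → Matrix m n ℝ}
    {B : Matrix m n ℝ} (h : ∀ i j, Tendsto (fun a => A a i j) l (𝓝 (B i j))) :
    Tendsto A l (𝓝 B) :=
  tendsto_pi_nhds.2 fun i => tendsto_pi_nhds.2 fun j => h i j

lemma Matrix.dotProduct_gram_mulVec {ι κ : Type*} [Fintype ι] [Fintype κ] (A : Matrix ι κ ℝ)
    (x : κ → ℝ) : x ⬝ᵥ ((Aᵀ * A) *ᵥ x) = ∑ i, (A *ᵥ x) i ^ 2 := by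
  rw [← mulVec_mulVec, dotProduct_mulVec, vecMul_transpose, dotProduct]
  simp only [sq]

variable {ι κ π : Type*} [Fintype ι] [Fintype κ]

lemma scaleRows_add (b : ι → ℝ) (A B : Matrix ι κ ℝ) :
    scaleRows b (A + B) = scaleRows b A + scaleRows b B := by
  ext i k
  simp [scaleRows, mul_add]

lemma scaleRows_mul (b : ι → ℝ) (A : Matrix ι κ ℝ) (B : Matrix κ π ℝ) :
    scaleRows b (A * B) = scaleRows b A * B := by
  ext i k
  simp [scaleRows, Matrix.mul_apply, Finset.mul_sum, mul_assoc]

lemma scaleRows_mulVec (b : ι → ℝ) (A : Matrix ι κ ℝ) (x : κ → ℝ) (i : ι) :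
    (scaleRows b A *ᵥ x) i = √(b i) * (A *ᵥ x) i := by
  simp [scaleRows, mulVec, dotProduct, Finset.mul_sum, mul_assoc]

lemma scaleRows_transpose_mul_apply {b : ι → ℝ} (hb : ∀ i, 0 ≤ b i) (A : Matrix ι κ ℝ)
    (B : Matrix ι π ℝ) (k : κ) (p : π) :
    ((scaleRows b A)ᵀ * scaleRows b B) k p = ∑ i, b i * (A i k * B i p) := by
  rw [Matrix.mul_apply]
  refine Finset.sum_congr rfl fun i _ => ?_
  simp only [transpose_apply, scaleRows, of_apply]
  linear_combination A i k * B i p * Real.mul_self_sqrt (hb i)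

variable {J : ℕ} {n : Fin J → ℕ}

lemma fraction_nonneg (L P : ℕ) (o : Obs n) : 0 ≤ fraction L P n o := by
  unfold fraction; positivity

lemma transpose_mul_apply_obs (A : Matrix (Obs n) κ ℝ) (B : Matrix (Obs n) π ℝ) (k : κ) (p : π) :
    (Aᵀ * B) k p = ∑ j, ∑ i : Fin (n j), A ⟨j, i⟩ k * B ⟨j, i⟩ p := by
  rw [Matrix.mul_apply, Fintype.sum_sigma]
  rfl

/-- The cross products of the data that are scaled by the fractions are sums of means over the
groups. -/
lemma scaleRows_fraction_transpose_mul_apply (L P : ℕ) (A : Matrix (Obs n) κ ℝ)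
    (B : Matrix (Obs n) π ℝ) (k : κ) (p : π) :
    ((scaleRows (fraction L P n) A)ᵀ * scaleRows (fraction L P n) B) k p
      = ((P : ℝ) + ((J : ℝ) + (L : ℝ))) / (J : ℝ)
        * ∑ j, (∑ i : Fin (n j), A ⟨j, i⟩ k * B ⟨j, i⟩ p) / (n j : ℝ) := by
  rw [scaleRows_transpose_mul_apply (fraction_nonneg L P), Fintype.sum_sigma, Finset.mul_sum]
  refine Finset.sum_congr rfl fun j _ => ?_
  rw [Finset.sum_div, Finset.mul_sum]
  refine Finset.sum_congr rfl fun i _ => ?_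
  rw [fraction, ← div_div]
  ring

/-- Each group contributes (P + K)/J, so the prior has one degree of freedom. -/
lemma sum_fraction (L P : ℕ) (hJ : 0 < J) (hn : ∀ j, 0 < n j) :
    ∑ o, fraction L P n o = (P : ℝ) + ((J : ℝ) + (L : ℝ)) := by
  rw [Fintype.sum_sigma]
  have h1 (j : Fin J) : ∑ i : Fin (n j), fraction L P n ⟨j, i⟩
      = ((P : ℝ) + ((J : ℝ) + (L : ℝ))) / J := by
    have : (n j : ℝ) ≠ 0 := by exact_mod_cast (hn j).ne'
    simp only [fraction, Finset.sum_const, Finset.card_univ, Fintype.card_fin, nsmul_eq_mul]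
    field_simp
  have hJ' : (J : ℝ) ≠ 0 := by exact_mod_cast hJ.ne'
  simp only [h1, Finset.sum_const, Finset.card_univ, Fintype.card_fin, nsmul_eq_mul]
  field_simp

/-- Since b_i n_j = (P + K)/J in group j, the weight m b_i is at most (P + K)/J when m ≤ n_j. The
converging scaled Gram matrix thus bounds X'X from below at the order of the smallest group. -/
lemma mul_dotProduct_scaled_gram_le (L P : ℕ) {m : ℝ} (hn : ∀ j, 0 < n j)
    (hm : ∀ j, m ≤ n j) (A : Matrix (Obs n) κ ℝ) (x : κ → ℝ) :
    m * (x ⬝ᵥ (((scaleRows (fraction L P n) A)ᵀ * scaleRows (fraction L P n) A) *ᵥ x))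
      ≤ ((P : ℝ) + ((J : ℝ) + (L : ℝ))) / (J : ℝ) * (x ⬝ᵥ ((Aᵀ * A) *ᵥ x)) := by
  rw [dotProduct_gram_mulVec, dotProduct_gram_mulVec, Finset.mul_sum, Finset.mul_sum]
  refine Finset.sum_le_sum fun o _ => ?_
  rw [scaleRows_mulVec, mul_pow, Real.sq_sqrt (fraction_nonneg L P o), ← mul_assoc]
  refine mul_le_mul_of_nonneg_right ?_ (sq_nonneg _)
  have h1 : (0 : ℝ) < n o.1 := by exact_mod_cast hn o.1
  rw [fraction, ← div_div, mul_div_assoc', div_le_iff₀ h1, mul_comm]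
  exact mul_le_mul_of_nonneg_left (hm _) (by positivity)

lemma dotProduct_gram_le_mul_scaled (L P : ℕ) {m : ℝ} (hn : ∀ j, 0 < n j)
    (hm : ∀ j, n j ≤ m) (A : Matrix (Obs n) κ ℝ) (x : κ → ℝ) :
    ((P : ℝ) + ((J : ℝ) + (L : ℝ))) / (J : ℝ) * (x ⬝ᵥ ((Aᵀ * A) *ᵥ x))
      ≤ m * (x ⬝ᵥ (((scaleRows (fraction L P n) A)ᵀ * scaleRows (fraction L P n) A) *ᵥ x)) := by
  rw [dotProduct_gram_mulVec, dotProduct_gram_mulVec, Finset.mul_sum, Finset.mul_sum]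
  refine Finset.sum_le_sum fun o _ => ?_
  rw [scaleRows_mulVec, mul_pow, Real.sq_sqrt (fraction_nonneg L P o), ← mul_assoc]
  refine mul_le_mul_of_nonneg_right ?_ (sq_nonneg _)
  have h1 : (0 : ℝ) < n o.1 := by exact_mod_cast hn o.1
  rw [fraction, ← div_div, mul_div_assoc', le_div_iff₀ h1, mul_comm m]
  exact mul_le_mul_of_nonneg_left (hm _) (by positivity)

end CrossProducts

/-! ### Laws of large numbers for the cross products -/

section Limits

namespace SamplingModel

variable {J L P : ℕ} {Ω : Type*} [MeasurableSpace Ω] {μ : Measure Ω} [IsProbabilityMeasure μ]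
  {w : Fin J → ℕ → Ω → Fin L → ℝ} {e : Fin J → ℕ → Ω → EuclideanSpace ℝ (Fin P)}
  {V : Matrix (Fin P) (Fin P) ℝ} {n : ℕ → Fin J → ℕ}

/-- The design matrix as a function of the index of the group sizes and of the outcome. -/
def design (w : Fin J → ℕ → Ω → Fin L → ℝ) (n : ℕ → Fin J → ℕ) (a : ℕ × Ω) :
    Matrix (Obs (n a.1)) (Coef J L) ℝ := designMatrix (n a.1) fun j i => w j i a.2

/-- The matrix of errors as a function of the index of the group sizes and of the outcome. -/
def error (e : Fin J → ℕ → Ω → EuclideanSpace ℝ (Fin P)) (n : ℕ → Fin J → ℕ) (a : ℕ × Ω) :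
    Matrix (Obs (n a.1)) (Fin P) ℝ := errorMatrix (n a.1) fun j i => e j i a.2

/-- The response matrix as a function of the index of the group sizes and of the outcome. -/
def response (w : Fin J → ℕ → Ω → Fin L → ℝ) (e : Fin J → ℕ → Ω → EuclideanSpace ℝ (Fin P))
    (θ : Param J L P) (n : ℕ → Fin J → ℕ) (a : ℕ × Ω) : Matrix (Obs (n a.1)) (Fin P) ℝ :=
  responseMatrix (n a.1) θ (fun j i => w j i a.2) (fun j i => e j i a.2)

lemma response_eq (θ : Param J L P) (a : ℕ × Ω) :
    response w e θ n a = design w n a * θ.toMat + error e n a := rfl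

/-- The matrix with the rows `√b_i • a_i'` for the fractions `b_i`. -/
def scaled (P : ℕ) {κ : Type*} (n : ℕ → Fin J → ℕ) (L : ℕ)
    (A : (a : ℕ × Ω) → Matrix (Obs (n a.1)) κ ℝ) (a : ℕ × Ω) : Matrix (Obs (n a.1)) κ ℝ :=
  scaleRows (fraction L P (n a.1)) (A a)

lemma tendsto_scaled_gram (h : SamplingModel μ w e V)
    (hn : ∀ j, Tendsto (fun k => n k j) atTop atTop) :
    Tendsto (fun a => (scaled P n L (design w n) a)ᵀ * scaled P n L (design w n) a) (inProb μ)
      (𝓝 ((((P : ℝ) + ((J : ℝ) + (L : ℝ))) / (J : ℝ)) • populationGram μ w)) := by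
  refine Matrix.tendsto_of_apply fun k k' => ?_
  simp only [scaled, scaleRows_fraction_transpose_mul_apply, Matrix.smul_apply, smul_eq_mul,
    populationGram, Matrix.sum_apply, of_apply]
  refine Tendsto.const_mul _ (tendsto_finsetSum _ fun j _ => ?_)
  exact h.tendsto_groupMean (φ := fun y => designRow j y.1 k * designRow j y.1 k') j (hn j)
    (((measurable_designRow j k).comp measurable_fst).mul
      ((measurable_designRow j k').comp measurable_fst))
    ((h.memLp_designRow j k).integrable_mul (h.memLp_designRow j k'))

lemma tendsto_scaled_cross (h : SamplingModel μ w e V)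
    (hn : ∀ j, Tendsto (fun k => n k j) atTop atTop) :
    Tendsto (fun a => (scaled P n L (design w n) a)ᵀ * scaled P n L (error e n) a) (inProb μ)
      (𝓝 0) := by
  refine Matrix.tendsto_of_apply fun k p => ?_
  simp only [scaled, scaleRows_fraction_transpose_mul_apply, Matrix.zero_apply]
  rw [← mul_zero (((P : ℝ) + ((J : ℝ) + (L : ℝ))) / (J : ℝ)),
    ← Finset.sum_const_zero (s := (Finset.univ : Finset (Fin J)))]
  refine Tendsto.const_mul _ (tendsto_finsetSum _ fun j _ => ?_)
  rw [← h.integral_designRow_mul_e j k p]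
  exact h.tendsto_groupMean (φ := fun y => designRow j y.1 k * y.2 p) j (hn j)
    (((measurable_designRow j k).comp measurable_fst).mul (by fun_prop))
    ((h.memLp_designRow j k).integrable_mul (h.memLp_e j 0 p))

lemma tendsto_groupMean_e_mul (h : SamplingModel μ w e V)
    (hn : ∀ j, Tendsto (fun k => n k j) atTop atTop)
    (j p q) : Tendsto (fun a : ℕ × Ω =>
      (∑ i : Fin (n a.1 j), error e n a ⟨j, i⟩ p * error e n a ⟨j, i⟩ q) / (n a.1 j : ℝ))
      (inProb μ) (𝓝 (V p q)) := by
  rw [← h.integral_e_mul j 0 p q]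
  exact h.tendsto_groupMean (φ := fun y => y.2 p * y.2 q) j (hn j) (by fun_prop)
    ((h.memLp_e j 0 p).integrable_mul (h.memLp_e j 0 q))

lemma tendsto_scaled_error (h : SamplingModel μ w e V)
    (hn : ∀ j, Tendsto (fun k => n k j) atTop atTop)
    (hJ : 0 < J) :
    Tendsto (fun a => (scaled P n L (error e n) a)ᵀ * scaled P n L (error e n) a) (inProb μ)
      (𝓝 (((P : ℝ) + ((J : ℝ) + (L : ℝ))) • V)) := by
  refine Matrix.tendsto_of_apply fun p q => ?_
  have hJ' : (J : ℝ) ≠ 0 := by exact_mod_cast hJ.ne'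
  have h1 := Tendsto.const_mul (((P : ℝ) + ((J : ℝ) + (L : ℝ))) / (J : ℝ))
    (tendsto_finsetSum Finset.univ fun j _ => h.tendsto_groupMean_e_mul hn j p q)
  simp only [scaled, scaleRows_fraction_transpose_mul_apply]
  convert h1 using 2
  simp only [Matrix.smul_apply, smul_eq_mul, Finset.sum_const, Finset.card_univ, Fintype.card_fin,
    nsmul_eq_mul]
  field_simp

/-- The group shares n_j/N need not converge. They lie in [0, 1] and sum to one, while all group
means have the same limit V, so the error is at most the sum of the group errors. -/
lemma tendsto_error_gram (h : SamplingModel μ w e V)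
    (hn : ∀ j, Tendsto (fun k => n k j) atTop atTop)
    (hJ : 0 < J) :
    Tendsto (fun a => (((∑ j, n a.1 j : ℕ) : ℝ)⁻¹) • ((error e n a)ᵀ * error e n a)) (inProb μ)
      (𝓝 V) := by
  refine Matrix.tendsto_of_apply fun p q => ?_
  let m : (a : ℕ × Ω) → Fin J → ℝ := fun a j =>
    (∑ i : Fin (n a.1 j), error e n a ⟨j, i⟩ p * error e n a ⟨j, i⟩ q) / (n a.1 j : ℝ)
  have hm : Tendsto (fun a => ∑ j, |m a j - V p q|) (inProb μ) (𝓝 0) := by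
    rw [← Finset.sum_const_zero (s := (Finset.univ : Finset (Fin J)))]
    refine tendsto_finsetSum _ fun j _ => ?_
    have := ((h.tendsto_groupMean_e_mul hn j p q).sub_const (V p q)).abs
    simpa using this
  have hpos : ∀ᶠ a : ℕ × Ω in inProb μ, ∀ j, 0 < n a.1 j :=
    eventually_all.2 fun j => ((hn j).comp tendsto_fst_inProb).eventually_gt_atTop 0
  rw [tendsto_iff_norm_sub_tendsto_zero]
  refine squeeze_zero' (Eventually.of_forall fun _ => norm_nonneg _) ?_ hm
  filter_upwards [hpos] with a ha
  have hN : (0 : ℝ) < ((∑ j, n a.1 j : ℕ) : ℝ) := by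
    exact_mod_cast Finset.sum_pos (fun j _ => ha j) ⟨⟨0, hJ⟩, Finset.mem_univ _⟩
  have h1 : (((∑ j, n a.1 j : ℕ) : ℝ)⁻¹ • ((error e n a)ᵀ * error e n a)) p q - V p q
      = ∑ j, (n a.1 j : ℝ) / ((∑ j, n a.1 j : ℕ) : ℝ) * (m a j - V p q) := by
    have h2 (j) : (n a.1 j : ℝ) / ((∑ j, n a.1 j : ℕ) : ℝ) * (m a j - V p q)
        = ((∑ j, n a.1 j : ℕ) : ℝ)⁻¹
            * (∑ i : Fin (n a.1 j), error e n a ⟨j, i⟩ p * error e n a ⟨j, i⟩ q)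
          - n a.1 j * (((∑ j, n a.1 j : ℕ) : ℝ)⁻¹ * V p q) := by
      have : (n a.1 j : ℝ) ≠ 0 := by exact_mod_cast (ha j).ne'
      simp only [m]
      field_simp
    simp only [h2]
    rw [Finset.sum_sub_distrib, ← Finset.mul_sum, ← Finset.sum_mul, Matrix.smul_apply, smul_eq_mul,
      transpose_mul_apply_obs, ← Nat.cast_sum, ← mul_assoc, mul_inv_cancel₀ hN.ne', one_mul]
  rw [h1, Real.norm_eq_abs]
  refine (Finset.abs_sum_le_sum_abs _ _).trans (Finset.sum_le_sum fun j _ => ?_)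
  rw [abs_mul, abs_of_nonneg (by positivity)]
  refine mul_le_of_le_one_left (abs_nonneg _) ((div_le_one hN).2 ?_)
  exact_mod_cast Finset.single_le_sum (f := fun j => n a.1 j) (fun _ _ => Nat.zero_le _)
    (Finset.mem_univ j)

/-- The scaled residual sum of squares is E_b'E_b - (X_b'E_b)'(X_b'X_b)⁻¹(X_b'E_b). The cross
products vanish in the limit and the inverse Gram matrix converges, so only the error part remains.
-/
lemma tendsto_scaled_sumSq (h : SamplingModel μ w e V)
    (hn : ∀ j, Tendsto (fun k => n k j) atTop atTop)
    (hJ : 0 < J) (hG : (populationGram μ w).PosDef) (θ : Param J L P) :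
    Tendsto (fun a => sumSq (scaled P n L (design w n) a) (scaled P n L (response w e θ n) a))
      (inProb μ) (𝓝 (((P : ℝ) + ((J : ℝ) + (L : ℝ))) • V)) := by
  have hJ' : (0 : ℝ) < J := by exact_mod_cast hJ
  have hκ : (0 : ℝ) < ((P : ℝ) + ((J : ℝ) + (L : ℝ))) / (J : ℝ) := by positivity
  have hdet := (hG.smul hκ).det_pos
  have h1 := h.tendsto_scaled_gram hn
  have h2 := h.tendsto_scaled_cross hn
  have hcont : Continuous fun q : Matrix (Coef J L) (Fin P) ℝ × Matrix (Coef J L) (Coef J L) ℝ =>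
      q.1ᵀ * q.2 * q.1 :=
    (continuous_fst.matrix_transpose.matrix_mul continuous_snd).matrix_mul continuous_fst
  have h3 := (h.tendsto_scaled_error hn hJ).sub ((hcont.tendsto _).comp
    (h2.prodMk_nhds (Matrix.tendsto_nonsing_inv hdet.ne' h1)))
  simp only [Matrix.mul_zero, sub_zero] at h3
  refine h3.congr' ?_
  have h4 := (continuous_id.matrix_det.tendsto _).comp h1
  filter_upwards [h4.eventually_const_lt hdet] with a ha
  have h5 : scaled P n L (response w e θ n) a
      = scaled P n L (design w n) a * θ.toMat + scaled P n L (error e n) a := by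
    simp only [scaled, response_eq, scaleRows_add, scaleRows_mul]
  rw [Function.comp_apply, h5, sumSq_mul_add _ _ _ (ne_of_gt ha).isUnit, hatMatrix, transpose_mul, transpose_transpose]
  simp only [Matrix.mul_assoc]

end SamplingModel

end Limits

end

noncomputable section

/-! ### Consistency of the default Bayes factor -/

section Consistency

namespace SamplingModel

variable {J L P : ℕ} [NeZero J] [NeZero P] {Ω : Type*} [MeasurableSpace Ω] {μ : Measure Ω}
  [IsProbabilityMeasure μ] {w : Fin J → ℕ → Ω → Fin L → ℝ}
  {e : Fin J → ℕ → Ω → EuclideanSpace ℝ (Fin P)} {V : Matrix (Fin P) (Fin P) ℝ}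
  {n : ℕ → Fin J → ℕ} {θ : Param J L P}

/-- The events on which the explained sum of squares of the errors is at most `t`. -/
def boundedEvents (w : Fin J → ℕ → Ω → Fin L → ℝ) (e : Fin J → ℕ → Ω → EuclideanSpace ℝ (Fin P))
    (n : ℕ → Fin J → ℕ) (t : ℝ) : Set (ℕ × Ω) :=
  {a | explained (n a.1) (fun j i => w j i a.2) (fun j i => e j i a.2) ≤ t}

lemma tendsto_of_boundedEvents (h : SamplingModel μ w e V) {β : Type*} {Z : ℕ × Ω → β}
    {F : Filter β} (hZ : ∀ t > 0, Tendsto Z (inProb μ ⊓ 𝓟 (boundedEvents w e n t)) F) :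
    Tendsto Z (inProb μ) F :=
  tendsto_inProb_of_tight (fun _ ht k => h.measure_lt_explained_le (n k) ht) hZ

lemma eventually_of_boundedEvents (h : SamplingModel μ w e V) {p : ℕ × Ω → Prop}
    (hp : ∀ t > 0, ∀ᶠ a in inProb μ ⊓ 𝓟 (boundedEvents w e n t), p a) :
    ∀ᶠ a in inProb μ, p a :=
  tendsto_principal.1 (h.tendsto_of_boundedEvents fun t ht => tendsto_principal.2 (hp t ht) :
    Tendsto id (inProb μ) (𝓟 {a | p a}))

lemma iInf_le_size (n : Fin J → ℕ) (j : Fin J) : ⨅ j, (n j : ℝ) ≤ n j :=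
  ciInf_le (Set.finite_range _).bddBelow j

lemma le_sum_size (n : Fin J → ℕ) (j : Fin J) : (n j : ℝ) ≤ ((∑ j, n j : ℕ) : ℝ) := by
  exact_mod_cast Finset.single_le_sum (f := n) (fun _ _ => Nat.zero_le _) (Finset.mem_univ j)

lemma tendsto_iInf_size (hn : ∀ j, Tendsto (fun k => n k j) atTop atTop) :
    Tendsto (fun k => ⨅ j, (n k j : ℝ)) atTop atTop := by
  refine tendsto_atTop.2 fun C => ?_
  filter_upwards [eventually_all.2 fun j =>
    (tendsto_natCast_atTop_atTop.comp (hn j)).eventually_ge_atTop C] with k hk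
  exact le_ciInf hk

lemma tendsto_log_div_iInf_size
    (hlog : ∀ j, Tendsto (fun k => Real.log ((∑ i, n k i : ℕ) : ℝ) / (n k j : ℝ)) atTop (𝓝 0)) :
    Tendsto (fun k => Real.log ((∑ i, n k i : ℕ) : ℝ) / ⨅ j, (n k j : ℝ)) atTop (𝓝 0) := by
  have h1 : Tendsto (fun k => ∑ j, ‖Real.log ((∑ i, n k i : ℕ) : ℝ) / (n k j : ℝ)‖) atTop
      (𝓝 0) := by
    rw [← Finset.sum_const_zero (s := (Finset.univ : Finset (Fin J)))]
    exact tendsto_finsetSum _ fun j _ => tendsto_zero_iff_norm_tendsto_zero.1 (hlog j)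
  refine squeeze_zero_norm (fun k => ?_) h1
  obtain ⟨j, hj⟩ := exists_eq_ciInf_of_finite (f := fun j => (n k j : ℝ))
  rw [← hj]
  exact Finset.single_le_sum
    (f := fun j => ‖Real.log ((∑ i, n k i : ℕ) : ℝ) / (n k j : ℝ)‖)
    (fun _ _ => norm_nonneg _) (Finset.mem_univ j)

lemma eventually_size_pos (hn : ∀ j, Tendsto (fun k => n k j) atTop atTop) :
    ∀ᶠ a : ℕ × Ω in inProb μ, ∀ j, 0 < n a.1 j :=
  eventually_all.2 fun j => ((hn j).comp tendsto_fst_inProb).eventually_gt_atTop 0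

lemma factor_pos (J L P : ℕ) [NeZero J] :
    (0 : ℝ) < ((P : ℝ) + ((J : ℝ) + (L : ℝ))) / (J : ℝ) := by
  have : (0 : ℝ) < J := by exact_mod_cast Nat.pos_of_neZero J
  positivity

/-- The precision parameter is the smallest group size. Gram bounds follow from the limit of the
scaled Gram matrix, and restriction to `boundedEvents` supplies the bound for the centre. -/
lemma regularData (h : SamplingModel μ w e V) (hG : (populationGram μ w).PosDef)
    (hn : ∀ j, Tendsto (fun k => n k j) atTop atTop)
    (hlog : ∀ j, Tendsto (fun k => Real.log ((∑ i, n k i : ℕ) : ℝ) / (n k j : ℝ)) atTop (𝓝 0))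
    (θ : Param J L P) {t : ℝ} (ht : 0 < t) :
    RegularData (inProb μ ⊓ 𝓟 (boundedEvents w e n t)) (design w n) (response w e θ n)
      (fun a => ⨅ j, (n a.1 j : ℝ)) θ V := by
  have hJ := Nat.pos_of_neZero J
  have hκ := factor_pos J L P
  have hfst : Tendsto Prod.fst (inProb μ ⊓ 𝓟 (boundedEvents w e n t)) atTop :=
    tendsto_fst_inProb.mono_left inf_le_left
  have hpos : ∀ᶠ a : ℕ × Ω in inProb μ ⊓ 𝓟 (boundedEvents w e n t), ∀ j, 0 < n a.1 j :=
    Eventually.filter_mono inf_le_left (eventually_size_pos hn)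
  have hgram : Tendsto _ (inProb μ ⊓ 𝓟 (boundedEvents w e n t)) _ :=
    (h.tendsto_scaled_gram hn).mono_left inf_le_left
  have hN : Tendsto (fun a : ℕ × Ω => ((∑ j, n a.1 j : ℕ) : ℝ))
      (inProb μ ⊓ 𝓟 (boundedEvents w e n t)) atTop :=
    tendsto_atTop_mono (fun a => (iInf_le_size _ 0).trans (le_sum_size (n a.1) 0))
      ((tendsto_iInf_size hn).comp hfst)
  have hle : ∃ c > 0, ∀ᶠ a in inProb μ ⊓ 𝓟 (boundedEvents w e n t), ∀ x,
      c * (⨅ j, (n a.1 j : ℝ)) * (x ⬝ᵥ x) ≤ x ⬝ᵥ (((design w n a)ᵀ * design w n a) *ᵥ x) := by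
    obtain ⟨c, hc, hev⟩ := (hG.smul hκ).exists_eventually_le_dotProduct
    refine ⟨c / (((P : ℝ) + ((J : ℝ) + (L : ℝ))) / (J : ℝ)), div_pos hc hκ, ?_⟩
    filter_upwards [hgram.eventually hev, hpos] with a h1 h2 x
    have h3 := mul_dotProduct_scaled_gram_le L P h2 (iInf_le_size (n a.1)) (design w n a) x
    have h4 : 0 ≤ ⨅ j, (n a.1 j : ℝ) := le_ciInf fun j => Nat.cast_nonneg _
    have h5 := (mul_le_mul_of_nonneg_left (h1 x) h4).trans h3
    rw [div_mul_eq_mul_div, div_mul_eq_mul_div, div_le_iff₀ hκ]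
    linarith
  have hge : ∃ c > 0, ∀ᶠ a in inProb μ ⊓ 𝓟 (boundedEvents w e n t), ∀ x,
      x ⬝ᵥ (((design w n a)ᵀ * design w n a) *ᵥ x)
        ≤ c * ((∑ j, n a.1 j : ℕ) : ℝ) * (x ⬝ᵥ x) := by
    obtain ⟨c, hc, hev⟩ := exists_eventually_dotProduct_le
      ((((P : ℝ) + ((J : ℝ) + (L : ℝ))) / (J : ℝ)) • populationGram μ w)
    refine ⟨c / (((P : ℝ) + ((J : ℝ) + (L : ℝ))) / (J : ℝ)), div_pos hc hκ, ?_⟩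
    filter_upwards [hgram.eventually hev, hpos] with a h1 h2 x
    have h3 := dotProduct_gram_le_mul_scaled L P h2 (le_sum_size (n a.1)) (design w n a) x
    have h5 := h3.trans (mul_le_mul_of_nonneg_left (h1 x) (Nat.cast_nonneg _))
    rw [div_mul_eq_mul_div, div_mul_eq_mul_div, le_div_iff₀ hκ]
    linarith
  have hinf : Tendsto (fun a : ℕ × Ω => ⨅ j, (n a.1 j : ℝ))
      (inProb μ ⊓ 𝓟 (boundedEvents w e n t)) atTop := (tendsto_iInf_size hn).comp hfst
  have hdet : ∀ᶠ a in inProb μ ⊓ 𝓟 (boundedEvents w e n t),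
      IsUnit ((design w n a)ᵀ * design w n a).det := by
    obtain ⟨c, hc, hev⟩ := hle
    filter_upwards [hev, hinf.eventually_gt_atTop 0] with a h1 h2
    exact (posDef_of_le_dotProduct (RegularData.isHermitian_gram _) (mul_pos hc h2)
      h1).det_pos.ne'.isUnit
  have hbd : ∀ᶠ a in inProb μ ⊓ 𝓟 (boundedEvents w e n t),
      ((error e n a)ᵀ * hatMatrix (design w n a) * error e n a).trace ≤ t :=
    Eventually.filter_mono inf_le_right (mem_principal_self (boundedEvents w e n t))
  refine ⟨h.posDef, hinf, Eventually.of_forall fun a =>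
    (iInf_le_size _ 0).trans (le_sum_size (n a.1) 0), (tendsto_log_div_iInf_size hlog).comp hfst,
    hle, hge, ?_, t, ht.le, ?_⟩
  -- Entries of E'ΠE are bounded by its trace, hence by t, and vanish after division by N. Thus S/N
  -- has the limit of E'E/N.
  · have h1 : Tendsto (fun a => (((∑ j, n a.1 j : ℕ) : ℝ)⁻¹)
        • ((error e n a)ᵀ * hatMatrix (design w n a) * error e n a))
        (inProb μ ⊓ 𝓟 (boundedEvents w e n t)) (𝓝 0) := by
      refine Matrix.tendsto_of_apply fun p q => ?_
      have h2 := hN.inv_tendsto_atTop.mul_const t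
      rw [zero_mul] at h2
      refine squeeze_zero_norm' ?_ h2
      filter_upwards [hbd] with a ha
      rw [Matrix.smul_apply, smul_eq_mul, norm_mul, Real.norm_of_nonneg (by positivity)]
      refine mul_le_mul_of_nonneg_left ?_ (by positivity)
      rw [transpose_mul_hatMatrix_mul] at ha ⊢
      exact (abs_gram_apply_le_trace _ p q).trans ha
    have h2 := ((h.tendsto_error_gram hn hJ).mono_left inf_le_left).sub h1
    rw [sub_zero] at h2
    refine h2.congr' ?_
    filter_upwards [hdet] with a ha
    rw [response_eq, sumSq_mul_add _ _ _ ha, smul_sub]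
  · filter_upwards [hdet, hbd] with a ha hb
    rw [response_eq, sub_lsEstimate_mul_add _ _ _ ha]
    exact hb

/-! #### The default prior -/

lemma defaultPrior_eq {m : Fin J → ℕ} (hm : ∀ j, 0 < m j) (θ₀ : Param J L P)
    (X : Matrix (Obs m) (Coef J L) ℝ) (Y : Matrix (Obs m) (Fin P) ℝ) :
    defaultPrior θ₀ X Y = matrixTDensity θ₀.toMat
      ((scaleRows (fraction L P m) X)ᵀ * scaleRows (fraction L P m) X)⁻¹
      (sumSq (scaleRows (fraction L P m) X) (scaleRows (fraction L P m) Y)) 1 := by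
  simp only [defaultPrior]
  rw [sum_fraction L P (Nat.pos_of_neZero J) hm]
  congr 1
  ring

lemma posDef_limit (h : SamplingModel μ w e V) (hG : (populationGram μ w).PosDef) :
    ((((P : ℝ) + ((J : ℝ) + (L : ℝ))) / (J : ℝ)) • populationGram μ w).PosDef ∧
      (((P : ℝ) + ((J : ℝ) + (L : ℝ))) • V).PosDef := by
  have : (0 : ℝ) < P := by exact_mod_cast Nat.pos_of_neZero P
  exact ⟨hG.smul (factor_pos J L P), h.posDef.smul (by positivity)⟩

lemma tendsto_prior (h : SamplingModel μ w e V) (hG : (populationGram μ w).PosDef)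
    (hn : ∀ j, Tendsto (fun k => n k j) atTop atTop) (θ : Param J L P) :
    Tendsto (fun a => ((scaled P n L (design w n) a)ᵀ * scaled P n L (design w n) a,
        sumSq (scaled P n L (design w n) a) (scaled P n L (response w e θ n) a))) (inProb μ)
      (𝓝[hermitianPairs J L P] ((((P : ℝ) + ((J : ℝ) + (L : ℝ))) / (J : ℝ)) • populationGram μ w,
        ((P : ℝ) + ((J : ℝ) + (L : ℝ))) • V)) :=
  tendsto_nhdsWithin_iff.2 ⟨(h.tendsto_scaled_gram hn).prodMk_nhds
    (h.tendsto_scaled_sumSq hn (Nat.pos_of_neZero J) hG θ), Eventually.of_forall fun _ =>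
    ⟨RegularData.isHermitian_gram _, RegularData.isHermitian_gram _⟩⟩

lemma tendsto_complexityE (h : SamplingModel μ w e V) (hG : (populationGram μ w).PosDef)
    (hn : ∀ j, Tendsto (fun k => n k j) atTop atTop) (θ : Param J L P)
    (M : ConstrainedModel J L P) :
    Tendsto (fun a => complexityE M (design w n a) (response w e θ n a)) (inProb μ)
      (𝓝 (M.eqDensity (limitPrior M.θ₀ (populationGram μ w) V))) := by
  obtain ⟨hA, hS⟩ := h.posDef_limit hG
  refine ((tendsto_eqDensity_cauchy M hA hS).comp (h.tendsto_prior hG hn θ)).congr' ?_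
  filter_upwards [eventually_size_pos hn] with a ha
  rw [complexityE, defaultPrior_eq ha]
  rfl

lemma tendsto_complexityO (h : SamplingModel μ w e V) (hG : (populationGram μ w).PosDef)
    (hn : ∀ j, Tendsto (fun k => n k j) atTop atTop) (θ : Param J L P)
    (M : ConstrainedModel J L P) :
    Tendsto (fun a => complexityO M (design w n a) (response w e θ n a)) (inProb μ)
      (𝓝 (M.ordProb (limitPrior M.θ₀ (populationGram μ w) V))) := by
  obtain ⟨hA, hS⟩ := h.posDef_limit hG
  refine ((tendsto_ordProb_cauchy M hA hS).comp (h.tendsto_prior hG hn θ)).congr' ?_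
  filter_upwards [eventually_size_pos hn] with a ha
  rw [complexityO, defaultPrior_eq ha]
  rfl

lemma limit_pos (h : SamplingModel μ w e V) (hG : (populationGram μ w).PosDef)
    (M : ConstrainedModel J L P) :
    0 < M.eqDensity (limitPrior M.θ₀ (populationGram μ w) V) ∧
      0 < M.ordProb (limitPrior M.θ₀ (populationGram μ w) V) := by
  obtain ⟨hA, hS⟩ := h.posDef_limit hG
  exact ⟨eqDensity_cauchy_pos M hA hS, ordProb_cauchy_pos M hA hS⟩

/-! #### Bayes factors -/

lemma bayesFactor_eq {m : Fin J → ℕ} (M : ConstrainedModel J L P)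
    (X : Matrix (Obs m) (Coef J L) ℝ) (Y : Matrix (Obs m) (Fin P) ℝ) :
    bayesFactor M X Y = fitE M X Y * fitO M X Y * (complexityE M X Y * complexityO M X Y)⁻¹ := by
  rw [bayesFactor, div_mul_div_comm, div_eq_mul_inv]

lemma tendsto_complexity_inv (h : SamplingModel μ w e V) (hG : (populationGram μ w).PosDef)
    (hn : ∀ j, Tendsto (fun k => n k j) atTop atTop) (θ : Param J L P)
    (M : ConstrainedModel J L P) :
    Tendsto (fun a => (complexityE M (design w n a) (response w e θ n a)
        * complexityO M (design w n a) (response w e θ n a))⁻¹) (inProb μ)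
      (𝓝 (M.eqDensity (limitPrior M.θ₀ (populationGram μ w) V)
        * M.ordProb (limitPrior M.θ₀ (populationGram μ w) V))⁻¹) :=
  ((h.tendsto_complexityE hG hn θ M).mul (h.tendsto_complexityO hG hn θ M)).inv₀
    (mul_pos (h.limit_pos hG M).1 (h.limit_pos hG M).2).ne'

/-- For a true model without equality constraints the order constraints hold with posterior
probability tending to one, and the density factor is the same constant as under the prior. -/
lemma tendsto_fit_of_rE_eq_zero (h : SamplingModel μ w e V) (hG : (populationGram μ w).PosDef)
    (hn : ∀ j, Tendsto (fun k => n k j) atTop atTop)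
    (hlog : ∀ j, Tendsto (fun k => Real.log ((∑ i, n k i : ℕ) : ℝ) / (n k j : ℝ)) atTop (𝓝 0))
    {M : ConstrainedModel J L P} (hθ : θ ∈ M.space) (hM : M.rE = 0) :
    Tendsto (fun a => fitE M (design w n a) (response w e θ n a)
        * fitO M (design w n a) (response w e θ n a)) (inProb μ)
      (𝓝 (M.eqDensity (limitPrior M.θ₀ (populationGram μ w) V))) := by
  obtain ⟨c, hc, hceq⟩ := M.exists_eqDensity_eq hM
  obtain ⟨hA, hS⟩ := h.posDef_limit hG
  have h1 : M.eqDensity (limitPrior M.θ₀ (populationGram μ w) V) = c := by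
    rw [limitPrior, matrixTDensity_cauchy_eq _ hA.det_pos.ne']
    refine hceq _ ?_ (fun ϑ => Real.rpow_nonneg (detForm_pos hA.posSemidef hS _).le _)
      (integral_cauchy_pos hA hS M.θ₀)
    exact ((continuous_detForm _ _).measurable.comp (by fun_prop)).pow_const _
  rw [h1]
  refine h.tendsto_of_boundedEvents (n := n) fun t ht => ?_
  have hr := h.regularData hG hn hlog θ ht
  have h2 := (hr.tendsto_fitO_one hθ hM).const_mul c
  rw [mul_one] at h2
  refine h2.congr' ?_
  filter_upwards [hr.eventually_fitE_eq_const hceq] with a ha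
  rw [ha]

lemma tendsto_fit_atTop (h : SamplingModel μ w e V) (hG : (populationGram μ w).PosDef)
    (hn : ∀ j, Tendsto (fun k => n k j) atTop atTop)
    (hlog : ∀ j, Tendsto (fun k => Real.log ((∑ i, n k i : ℕ) : ℝ) / (n k j : ℝ)) atTop (𝓝 0))
    {M : ConstrainedModel J L P} (hθ : θ ∈ M.space) (hM : 0 < M.rE) :
    Tendsto (fun a => fitE M (design w n a) (response w e θ n a)
        * fitO M (design w n a) (response w e θ n a)) (inProb μ) atTop :=
  h.tendsto_of_boundedEvents fun _ ht => (h.regularData hG hn hlog θ ht).tendsto_fit_atTop M hθ hM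

lemma tendsto_fit_zero (h : SamplingModel μ w e V) (hG : (populationGram μ w).PosDef)
    (hn : ∀ j, Tendsto (fun k => n k j) atTop atTop)
    (hlog : ∀ j, Tendsto (fun k => Real.log ((∑ i, n k i : ℕ) : ℝ) / (n k j : ℝ)) atTop (𝓝 0))
    {M : ConstrainedModel J L P} (hθ : θ ∉ closure M.space) :
    Tendsto (fun a => fitE M (design w n a) (response w e θ n a)
        * fitO M (design w n a) (response w e θ n a)) (inProb μ) (𝓝 0) :=
  h.tendsto_of_boundedEvents fun _ ht => (h.regularData hG hn hlog θ ht).tendsto_fit_zero hθ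

lemma eventually_fit_pos (h : SamplingModel μ w e V) (hG : (populationGram μ w).PosDef)
    (hn : ∀ j, Tendsto (fun k => n k j) atTop atTop)
    (hlog : ∀ j, Tendsto (fun k => Real.log ((∑ i, n k i : ℕ) : ℝ) / (n k j : ℝ)) atTop (𝓝 0))
    (θ : Param J L P) (M : ConstrainedModel J L P) :
    ∀ᶠ a in inProb μ, 0 < fitE M (design w n a) (response w e θ n a)
        * fitO M (design w n a) (response w e θ n a) :=
  h.eventually_of_boundedEvents fun _ ht => (h.regularData hG hn hlog θ ht).eventually_fit_pos M

/-- If θ lies outside the closure of the competing model, the denominator tends to zero through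
positive values while the numerator has a positive limit or tends to infinity. Otherwise slice
masses are compared directly; both fits may diverge then. -/
lemma tendsto_fit_div_fit_atTop (h : SamplingModel μ w e V) (hG : (populationGram μ w).PosDef)
    (hn : ∀ j, Tendsto (fun k => n k j) atTop atTop)
    (hlog : ∀ j, Tendsto (fun k => Real.log ((∑ i, n k i : ℕ) : ℝ) / (n k j : ℝ)) atTop (𝓝 0))
    {M M' : ConstrainedModel J L P} (hθ : θ ∈ M.space)
    (hM : θ ∉ closure M'.space ∨ M.eqSpace ⊂ M'.eqSpace ∨ (M'.rE < M.rE ∧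
      ∃ c : ℝ, 0 < c ∧ ∀ᶠ k in atTop, ∀ i j, c * (n k i : ℝ) ≤ (n k j : ℝ))) :
    Tendsto (fun a => (fitE M (design w n a) (response w e θ n a)
        * fitO M (design w n a) (response w e θ n a))
      / (fitE M' (design w n a) (response w e θ n a)
        * fitO M' (design w n a) (response w e θ n a))) (inProb μ) atTop := by
  rcases hM with hM | hM
  · have h1 : Tendsto (fun a => (fitE M' (design w n a) (response w e θ n a)
        * fitO M' (design w n a) (response w e θ n a))⁻¹) (inProb μ) atTop :=
      tendsto_inv_nhdsGT_zero.comp (tendsto_nhdsWithin_iff.2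
        ⟨h.tendsto_fit_zero hG hn hlog hM, h.eventually_fit_pos hG hn hlog θ M'⟩)
    simp only [div_eq_mul_inv]
    rcases Nat.eq_zero_or_pos M.rE with h0 | h0
    · exact (h.tendsto_fit_of_rE_eq_zero hG hn hlog hθ h0).pos_mul_atTop (h.limit_pos hG M).1 h1
    · exact (h.tendsto_fit_atTop hG hn hlog hθ h0).atTop_mul_atTop₀ h1
  · refine h.tendsto_of_boundedEvents fun t ht =>
      (h.regularData hG hn hlog θ ht).tendsto_fit_div_fit_atTop hθ (hM.imp_right ?_)
    rintro ⟨h1, c, hc, hev⟩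
    have hJ : (0 : ℝ) < J := by exact_mod_cast Nat.pos_of_neZero J
    -- Summing c n_i ≤ n_j over the J groups gives c N ≤ J n_j for every j.
    refine ⟨h1, c / J, div_pos hc hJ, ?_⟩
    filter_upwards [(tendsto_fst_inProb.mono_left inf_le_left).eventually hev] with a ha
    refine le_ciInf fun j => ?_
    rw [div_mul_eq_mul_div, div_le_iff₀ hJ]
    calc c * ((∑ i, n a.1 i : ℕ) : ℝ) = ∑ i, c * (n a.1 i : ℝ) := by
          rw [Nat.cast_sum, Finset.mul_sum]
      _ ≤ ∑ _i : Fin J, (n a.1 j : ℝ) := Finset.sum_le_sum fun i _ => ha i j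
      _ = n a.1 j * J := by simp [mul_comm]

end SamplingModel

end Consistency

end

theorem lemma2 {J L P T : ℕ} (hJ : 0 < J) (hP : 0 < P)
    {Ω : Type*} [MeasurableSpace Ω] (μ : Measure Ω) [IsProbabilityMeasure μ]
    -- predictors and errors of the `i`-th observation of group `j`
    (w : Fin J → ℕ → Ω → Fin L → ℝ) (e : Fin J → ℕ → Ω → EuclideanSpace ℝ (Fin P))
    (hw : ∀ j i, Measurable (w j i)) (he : ∀ j i, Measurable (e j i))
    (h_indep : iIndepFun (fun (a : Fin J × ℕ) ω => (w a.1 a.2 ω, e a.1 a.2 ω)) μ)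
    (h_indep_we : ∀ j i, IndepFun (w j i) (e j i) μ)
    (hw_ident : ∀ j i, IdentDistrib (w j i) (w j 0) μ μ)
    (hw_sq : ∀ j l, MemLp (fun ω => w j 0 ω l) 2 μ)
    (hw_gram : (populationGram μ w).PosDef)
    (V : Matrix (Fin P) (Fin P) ℝ) (hV : V.PosDef)
    (he_law : ∀ j i, HasLaw (e j i) (multivariateGaussian 0 V) μ)
    -- the true parameter and the competing models
    (θ : Param J L P) (M : Fin T → ConstrainedModel J L P)
    -- the group sizes
    (n : ℕ → Fin J → ℕ) (hn : ∀ j, Tendsto (fun k => n k j) atTop atTop)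
    (hn_log : ∀ j, Tendsto (fun k => Real.log ((∑ i, n k i : ℕ) : ℝ) / (n k j : ℝ)) atTop (𝓝 0)) :
    let X : (k : ℕ) → Ω → Matrix (Obs (n k)) (Coef J L) ℝ :=
      fun k ω => designMatrix (n k) (fun j i => w j i ω)
    let Y : (k : ℕ) → Ω → Matrix (Obs (n k)) (Fin P) ℝ :=
      fun k ω => responseMatrix (n k) θ (fun j i => w j i ω) (fun j i => e j i ω)
    let B : Fin T → ℕ → Ω → ℝ := fun t k ω => bayesFactor (M t) (X k ω) (Y k ω)
    let cE : Fin T → ℝ := fun t => (M t).eqDensity (limitPrior (M t).θ₀ (populationGram μ w) V)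
    let cO : Fin T → ℝ := fun t => (M t).ordProb (limitPrior (M t).θ₀ (populationGram μ w) V)
    -- the prior quantities of every model converge to those of a fixed matrix Cauchy prior
    (∀ t, 0 < cE t ∧ 0 < cO t ∧
      TendstoInMeasure μ (fun k ω => complexityE (M t) (X k ω) (Y k ω)) atTop (fun _ => cE t) ∧
      TendstoInMeasure μ (fun k ω => complexityO (M t) (X k ω) (Y k ω)) atTop (fun _ => cO t)) ∧
    -- a true model against the unconstrained model
    (∀ t, θ ∈ (M t).space → 0 < (M t).rE → TendstoAtTopInProb μ (B t)) ∧
    (∀ t, θ ∈ (M t).space → (M t).rE = 0 → TendstoInMeasure μ (B t) atTop (fun _ => (cO t)⁻¹)) ∧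
    -- an incorrect model against the unconstrained model
    (∀ s, θ ∉ closure (M s).space → TendstoInMeasure μ (B s) atTop (fun _ => 0)) ∧
    -- a true model against a competing model
    (∀ t s, θ ∈ (M t).space →
      (θ ∉ closure (M s).space ∨ (M t).eqSpace ⊂ (M s).eqSpace ∨
        ((M s).rE < (M t).rE ∧
          ∃ c : ℝ, 0 < c ∧ ∀ᶠ k in atTop, ∀ i j, c * (n k i : ℝ) ≤ (n k j : ℝ))) →
      TendstoAtTopInProb μ (fun k ω => B t k ω / B s k ω)) := by
  intro X Y B cE cO
  have : NeZero J := ⟨hJ.ne'⟩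
  have : NeZero P := ⟨hP.ne'⟩
  have h : SamplingModel μ w e V :=
    ⟨hw, he, h_indep, h_indep_we, hw_ident, hw_sq, hV, he_law⟩
  have hc (t) : 0 < cE t ∧ 0 < cO t := h.limit_pos hw_gram (M t)
  have hcE (t) : Tendsto (fun a : ℕ × Ω => complexityE (M t) (X a.1 a.2) (Y a.1 a.2)) (inProb μ)
      (𝓝 (cE t)) := h.tendsto_complexityE hw_gram hn θ (M t)
  have hcO (t) : Tendsto (fun a : ℕ × Ω => complexityO (M t) (X a.1 a.2) (Y a.1 a.2)) (inProb μ)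
      (𝓝 (cO t)) := h.tendsto_complexityO hw_gram hn θ (M t)
  have hinv (t) : Tendsto (fun a : ℕ × Ω => (complexityE (M t) (X a.1 a.2) (Y a.1 a.2)
      * complexityO (M t) (X a.1 a.2) (Y a.1 a.2))⁻¹) (inProb μ) (𝓝 (cE t * cO t)⁻¹) :=
    h.tendsto_complexity_inv hw_gram hn θ (M t)
  have hcpos (t) : 0 < (cE t * cO t)⁻¹ := inv_pos.2 (mul_pos (hc t).1 (hc t).2)
  have hB (t) : (fun a : ℕ × Ω => B t a.1 a.2) = fun a =>
      fitE (M t) (X a.1 a.2) (Y a.1 a.2) * fitO (M t) (X a.1 a.2) (Y a.1 a.2)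
        * (complexityE (M t) (X a.1 a.2) (Y a.1 a.2)
          * complexityO (M t) (X a.1 a.2) (Y a.1 a.2))⁻¹ :=
    funext fun a => SamplingModel.bayesFactor_eq (M t) (X a.1 a.2) (Y a.1 a.2)
  refine ⟨fun t => ⟨(hc t).1, (hc t).2, tendstoInMeasure_iff_tendsto_inProb.2 (hcE t),
    tendstoInMeasure_iff_tendsto_inProb.2 (hcO t)⟩, fun t hθ hr => ?_, fun t hθ hr => ?_,
    fun s hθ => ?_, fun t s hθ hs => ?_⟩
  · rw [tendstoAtTopInProb_iff_tendsto_inProb, hB]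
    exact (h.tendsto_fit_atTop hw_gram hn hn_log hθ hr).atTop_mul_pos (hcpos t) (hinv t)
  · rw [tendstoInMeasure_iff_tendsto_inProb, hB]
    have h1 := (h.tendsto_fit_of_rE_eq_zero hw_gram hn hn_log hθ hr).mul (hinv t)
    -- The fit tends to c^E because the density factors of prior and posterior agree, which leaves
    -- only the order complexity.
    have h2 : cE t * (cE t * cO t)⁻¹ = (cO t)⁻¹ := by
      rw [mul_inv, mul_inv_cancel_left₀ (hc t).1.ne']
    rw [← h2]
    exact h1
  · rw [tendstoInMeasure_iff_tendsto_inProb, hB, ← zero_mul (cE s * cO s)⁻¹]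
    exact (h.tendsto_fit_zero hw_gram hn hn_log hθ).mul (hinv s)
  · rw [tendstoAtTopInProb_iff_tendsto_inProb]
    -- The quotient of the complexities has a positive limit, so divergence of the quotient of the
    -- fits decides.
    have h1 : (fun a : ℕ × Ω => B t a.1 a.2 / B s a.1 a.2) = fun a =>
        (fitE (M t) (X a.1 a.2) (Y a.1 a.2) * fitO (M t) (X a.1 a.2) (Y a.1 a.2))
          / (fitE (M s) (X a.1 a.2) (Y a.1 a.2) * fitO (M s) (X a.1 a.2) (Y a.1 a.2))
        * ((complexityE (M t) (X a.1 a.2) (Y a.1 a.2)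
            * complexityO (M t) (X a.1 a.2) (Y a.1 a.2))⁻¹
          / (complexityE (M s) (X a.1 a.2) (Y a.1 a.2)
            * complexityO (M s) (X a.1 a.2) (Y a.1 a.2))⁻¹) := by
      funext a
      rw [congrFun (hB t) a, congrFun (hB s) a, div_mul_div_comm]
    rw [h1]
    exact (h.tendsto_fit_div_fit_atTop hw_gram hn hn_log hθ hs).atTop_mul_pos
      (div_pos (hcpos t) (hcpos s)) ((hinv t).div (hinv s) (hcpos s).ne')
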